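/- Let $l,G>0$. On the region $r>R_0>0$ with coordinates $(\tau,r,\phi)$, $\phi\sim\phi+2\pi$, write $x^A=(\tau,\phi)$, $x^\pm=\tau\pm\phi$, $\partial_\pm=\frac12(\partial_\tau\pm\partial_\phi)$, $\bar\gamma=-d\tau^2+d\phi^2$. Let the phase space consist of the smooth Lorentzian metrics $$g_{rr}=\frac{l^2}{r^2}+\frac{C_{rr}}{r^{4}}+o(r^{-4}),\quad g_{rA}=O(r^{-3}),\quad g_{AB}=r^2\gamma_{AB}+C_{AB}+o(1),\quad \gamma=e^{2\varphi}\bar\gamma,$$ with $\varphi,C_{rr},C_{AB}$ smooth real functions of $(\tau,\phi)$ (depending on the metric) that satisfy $\rho\equiv\gamma^{AB}C_{AB}+l^{-2}C_{rr}=0$. Put $\Xi_{AB}=C_{AB}-\frac12\bar\gamma_{AB}\bar\gamma^{CD}C_{CD}$. All expansions hold as $r\to\infty$, locally uniformly in $(\tau,\phi)$, and may be differentiated (twice for metrics and vector fields, once for variations of metrics; $\partial_r$ lowers the order by one). "On shell" means $G_{\mu\nu}-l^{-2}g_{\mu\nu}=0$. A symmetry parameter is a pair $(Y^A,\psi)$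 of smooth complex, $2\pi$-periodic data on the cylinder with $Y$ a conformal Killing vector of $\bar\gamma$ and $\bar\Delta\psi=0$. An asymptotic symmetry of $g$ with parameter $(Y,\psi)$ is a smooth periodic vector field $$\xi^r=-\tfrac12\psi r+X r^{-1}+o(r^{-1}),\qquad \xi^A=Y^A-\tfrac{l^2}{4r^2}\gamma^{AB}\partial_B\psi+O(r^{-4}),$$ with $X$ any smooth function of $(\tau,\phi)$. Let $\delta\hspace{-0.5em}/\mathcal Q_\xi[h,g]$ be the limit $r\to\infty$ of the integral of the Barnich–Brandt form $$\frac{\sqrt{-g}}{16\pi G}(dx)_{\mu\nu}\Big[\xi^\nu\nabla^\mu h-\xi^\nu\nabla_\sigma h^{\mu\sigma}+\xi_\sigma\nabla^\nu h^{\mu\sigma}+\tfrac12h\nabla^\nu\xi^\mu+\tfrac12h^{\nu\sigma}(\nabla^\mu\xi_\sigma-\nabla_\sigma\xi^\mu)-(\mu\leftrightarrow\nu)\Big]$$ over the circle $\tau=\tau_0$, $r$ constant, where $(dx)_{\mu\nu}=\frac12\epsilon_{\mu\nu\alpha}dx^\alpha$ and $\epsilon_{\tau r\phi}=1$. Then,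 for every $\tau_0$: 1. Every symmetry parameter is realized by asymptotic symmetries $\xi$ of each metric $g$ of the phase space, and $\mathcal L_\xi g$ is tangent to the phase space (including $\delta\rho=0$). 2. The charges are integrable: for every smooth path $g_s$ in the phase space (whose expansions may be differentiated in $s$), every symmetry parameter and every asymptotic symmetry $\xi$ of $g_s$ with that parameter, the limit $\delta\hspace{-0.5em}/\mathcal Q_\xi[\partial_sg_s,g_s]$ exists and equals $\frac{d}{ds}\mathcal Q_{(Y,\psi)}[g_s]$, where $$\mathcal Q_{(Y,\psi)}[g]=\frac1{16\pi Gl}\int_0^{2\pi}d\phi\,\big[l^2(\psi\,\partial_\tau\varphi-\varphi\,\partial_\tau\psi)+2Y^A\Xi_{\tau A}\big]_{\tau=\tau_0},$$ and $\mathcal Q_{(Y,\psi)}$ vanishes at the massless BTZ metric $-r^2d\tau^2+\frac{l^2}{r^2}dr^2+r^2d\phi^2$. 3. On shell, the bracket $[\mathcal Q_a,\mathcal Q_b]\equiv\delta\hspace{-0.5em}/\mathcal Q_{\xi_1}[\mathcal L_{\xi_2}g,g]$ exists for all symmetry parameters $a,b$, does not depend on the choice of asymptotic symmetries $\xi_1,\xi_2$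 with parameters $a,b$, and is antisymmetric. For $m\in\mathbb Z$ let $L^\pm_m,P^\pm_m,Q$ be the charges of the symmetry parameters $e^{imx^\pm}\partial_\pm$ ($\psi=0$), $\psi=e^{imx^\pm}$ ($Y=0$) and $\psi=\tau$ ($Y=0$). Then, on shell, for all $m,n\in\mathbb Z$, $$\begin{aligned} i[L^\pm_m,L^\pm_n]&=(m-n)L^\pm_{m+n}, & i[L^\pm_m,L^\mp_n]&=0,\\ i[L^\pm_m,P^\pm_n]&=-nP^\pm_{m+n}+\tfrac{l}{8G}im^2\delta_{m+n,0}, & i[L^\pm_m,P^\mp_n]&=0,\\ i[P^\pm_m,P^\pm_n]&=-\tfrac{l}{8G}m\,\delta_{m+n,0}, & i[P^\pm_m,P^\mp_n]&=0,\\ i[L^\pm_m,Q]&=\tfrac i2P^\pm_m, & i[P^\pm_m,Q]&=-i\tfrac{l}{16G}\delta_{m,0}. \end{aligned}$$ In particular there is no Virasoro central term in this basis. 4. Let $\tilde L^\pm_m=L^\pm_m+imP^\pm_m$, the charge of the parameter $(e^{imx^\pm}\partial_\pm,\ \psi=im\,e^{imx^\pm})$. On shell, with $c^\pm=\frac{3l}{2G}$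 and $k=-\frac{l}{8G}$, $$\begin{aligned} i[\tilde L^\pm_m,\tilde L^\pm_n]&=(m-n)\tilde L^\pm_{m+n}+\tfrac{c^\pm}{12}m^3\delta_{m+n,0}, & i[\tilde L^\pm_m,\tilde L^\mp_n]&=0,\\ i[\tilde L^\pm_m,P^\pm_n]&=-nP^\pm_{m+n}, & i[\tilde L^\pm_m,P^\mp_n]&=0,\\ i[P^\pm_m,P^\pm_n]&=k\,m\,\delta_{m+n,0}, & i[P^\pm_m,P^\mp_n]&=0,\\ i[\tilde L^\pm_m,Q]&=\tfrac i2P^\pm_m, & i[P^\pm_m,Q]&=i\tfrac k2\delta_{m,0}. \end{aligned}$$ -/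

import Mathlib

open Filter Topology
open scoped ContDiff

noncomputable section

namespace AdSCharges

/-- Points of the bulk region near infinity, in coordinates `(τ, r, φ)` (indices `0, 1, 2`);
the angle `φ` is `2π`-periodic, which is imposed on all fields. -/
abbrev Pt := Fin 3 → ℝ

/-- Points of the cylinder at infinity, in coordinates `x^A = (τ, φ)` (indices `0, 1`). -/
abbrev Bdy := Fin 2 → ℝ

/-- The bulk index of a boundary index: `τ ↦ 0`, `φ ↦ 2`. -/
def bIdx : Fin 2 → Fin 3 := ![0, 2]

/-- The boundary coordinates `(τ, φ)` of a bulk point `(τ, r, φ)`. -/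
def proj (x : Pt) : Bdy := fun A => x (bIdx A)

/-- The partial derivative `∂_i f`. -/
def pd {n : ℕ} {E : Type*} [NormedAddCommGroup E] [NormedSpace ℝ E]
    (i : Fin n) (f : (Fin n → ℝ) → E) (x : Fin n → ℝ) : E :=
  fderiv ℝ f x (Pi.single i 1)

/-- The flat boundary metric `-dτ² + dφ²`. The same matrix is its inverse. -/
def flat : Matrix (Fin 2) (Fin 2) ℝ := Matrix.diagonal ![-1, 1]

/-! ### Asymptotic orders -/

section Orders

variable {E : Type*} [NormedAddCommGroup E] [NormedSpace ℝ E]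

/-- `f = O(r^n)` as `r → ∞`, locally uniformly in `(τ, φ)`, where up to `k` derivatives may be
taken: each `∂_r` lowers the exponent by one and `∂_τ`, `∂_φ` do not change it. -/
def BigO : ℕ → (Pt → E) → ℤ → Prop
  | 0, f, n => ∀ K : Set Bdy, IsCompact K →
      ∃ c R : ℝ, ∀ x : Pt, proj x ∈ K → R < x 1 → ‖f x‖ ≤ c * x 1 ^ n
  | k + 1, f, n => BigO 0 f n ∧ BigO k (pd 0 f) n ∧ BigO k (pd 1 f) (n - 1) ∧ BigO k (pd 2 f) n

/-- `f = o(r^n)` as `r → ∞`, with the same conventions as in `BigO`. -/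
def LittleO : ℕ → (Pt → E) → ℤ → Prop
  | 0, f, n => ∀ K : Set Bdy, IsCompact K → ∀ ε : ℝ, 0 < ε →
      ∃ R : ℝ, ∀ x : Pt, proj x ∈ K → R < x 1 → ‖f x‖ ≤ ε * x 1 ^ n
  | k + 1, f, n =>
      LittleO 0 f n ∧ LittleO k (pd 0 f) n ∧ LittleO k (pd 1 f) (n - 1) ∧ LittleO k (pd 2 f) n

end Orders

/-! ### Metrics, curvature, Lie derivative -/

section Bulk

variable (g : Pt → Matrix (Fin 3) (Fin 3) ℝ)

/-- The Christoffel symbols `Γ^a_{bc}`. -/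
def christoffel (a b c : Fin 3) (x : Pt) : ℝ :=
  (1 / 2) * ∑ e, (g x)⁻¹ a e *
    (pd b (fun y => g y e c) x + pd c (fun y => g y e b) x - pd e (fun y => g y b c) x)

/-- The Ricci tensor `R_{bc}`. -/
def ricci (b c : Fin 3) (x : Pt) : ℝ :=
  ∑ a, (pd a (christoffel g a b c) x - pd c (christoffel g a b a) x
    + ∑ e, (christoffel g a a e x * christoffel g e b c x
        - christoffel g a c e x * christoffel g e b a x))

/-- The scalar curvature. -/
def scalarCurv (x : Pt) : ℝ := ∑ a, ∑ b, (g x)⁻¹ a b * ricci g a b x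

/-- The covariant derivative `∇_c ξ^a` of a complex vector field. -/
def covV (ξ : Pt → Fin 3 → ℂ) (c a : Fin 3) (x : Pt) : ℂ :=
  pd c (fun y => ξ y a) x + ∑ e, (christoffel g a c e x : ℂ) * ξ x e

/-- The covariant derivative `∇_c h_{ab}` of a complex covariant 2-tensor. -/
def covH (h : Pt → Matrix (Fin 3) (Fin 3) ℂ) (c a b : Fin 3) (x : Pt) : ℂ :=
  pd c (fun y => h y a b) x
    - ∑ e, ((christoffel g e c a x : ℂ) * h x e b + (christoffel g e c b x : ℂ) * h x a e)

/-- The Lie derivative `(𝓛_ξ g)_{ab}`. -/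
def lieMetric (ξ : Pt → Fin 3 → ℂ) (x : Pt) : Matrix (Fin 3) (Fin 3) ℂ := fun a b =>
  ∑ c, (ξ x c * (pd c (fun y => g y a b) x : ℝ)
    + (g x c b : ℂ) * pd a (fun y => ξ y c) x + (g x a c : ℂ) * pd b (fun y => ξ y c) x)

/-- `∇^m ξ^a`. -/
def covVUp (ξ : Pt → Fin 3 → ℂ) (m a : Fin 3) (x : Pt) : ℂ :=
  ∑ c, ((g x)⁻¹ m c : ℂ) * covV g ξ c a x

/-- `∇_c ξ_a`. -/
def covVLow (ξ : Pt → Fin 3 → ℂ) (c a : Fin 3) (x : Pt) : ℂ :=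
  ∑ e, (g x a e : ℂ) * covV g ξ c e x

/-- `∇^m ξ_a`. -/
def covVMix (ξ : Pt → Fin 3 → ℂ) (m a : Fin 3) (x : Pt) : ℂ :=
  ∑ c, ((g x)⁻¹ m c : ℂ) * covVLow g ξ c a x

/-- The trace `h = g^{ab} h_{ab}`. -/
def trH (h : Pt → Matrix (Fin 3) (Fin 3) ℂ) (x : Pt) : ℂ :=
  ∑ a, ∑ b, ((g x)⁻¹ a b : ℂ) * h x a b

/-- `∇^m h` for the trace `h` (computed as `g^{mc} g^{ab} ∇_c h_{ab}`, since `∇ g = 0`). -/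
def covTrUp (h : Pt → Matrix (Fin 3) (Fin 3) ℂ) (m : Fin 3) (x : Pt) : ℂ :=
  ∑ c, ∑ a, ∑ b, ((g x)⁻¹ m c : ℂ) * ((g x)⁻¹ a b : ℂ) * covH g h c a b x

/-- `h^{ab}`. -/
def hUp (h : Pt → Matrix (Fin 3) (Fin 3) ℂ) (a b : Fin 3) (x : Pt) : ℂ :=
  ∑ c, ∑ d, ((g x)⁻¹ a c : ℂ) * ((g x)⁻¹ b d : ℂ) * h x c d

/-- `∇_c h^{ab}`. -/
def covHUp (h : Pt → Matrix (Fin 3) (Fin 3) ℂ) (c a b : Fin 3) (x : Pt) : ℂ :=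
  ∑ d, ∑ e, ((g x)⁻¹ a d : ℂ) * ((g x)⁻¹ b e : ℂ) * covH g h c d e x

/-- `∇^m h^{ab}`. -/
def covHUpUp (h : Pt → Matrix (Fin 3) (Fin 3) ℂ) (m a b : Fin 3) (x : Pt) : ℂ :=
  ∑ c, ((g x)⁻¹ m c : ℂ) * covHUp g h c a b x

/-- The expression in the Barnich-Brandt superpotential, before antisymmetrization in `μ, ν`:
`ξ^ν ∇^μ h - ξ^ν ∇_σ h^{μσ} + ξ_σ ∇^ν h^{μσ} + ½ h ∇^ν ξ^μ + ½ h^{νσ} (∇^μ ξ_σ - ∇_σ ξ^μ)`. -/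
def bbTerm (ξ : Pt → Fin 3 → ℂ) (h : Pt → Matrix (Fin 3) (Fin 3) ℂ) (μ ν : Fin 3) (x : Pt) : ℂ :=
  ξ x ν * covTrUp g h μ x
    - ξ x ν * ∑ σ, covHUp g h σ μ σ x
    + ∑ σ, (∑ e, (g x σ e : ℂ) * ξ x e) * covHUpUp g h ν μ σ x
    + (1 / 2) * trH g h x * covVUp g ξ ν μ x
    + (1 / 2) * ∑ σ, hUp g h ν σ x * (covVMix g ξ μ σ x - covV g ξ σ μ x)

/-- The Barnich-Brandt superpotential `k^{μν}`, antisymmetric in `μ, ν`. -/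
def bbForm (ξ : Pt → Fin 3 → ℂ) (h : Pt → Matrix (Fin 3) (Fin 3) ℂ) (μ ν : Fin 3) (x : Pt) : ℂ :=
  bbTerm g ξ h μ ν x - bbTerm g ξ h ν μ x

/-- The Barnich-Brandt integral over the circle of constant `τ = τ₀` and `r`: the integral of
`√(-g) / (16πG) k^{μν} (dx)_{μν}` with `(dx)_{μν} = ½ ε_{μνα} dx^α`. On the circle only
`α = φ` counts, and `ε_{τrφ} = 1`. -/
def bbCircle (G τ₀ : ℝ) (ξ : Pt → Fin 3 → ℂ) (h : Pt → Matrix (Fin 3) (Fin 3) ℂ) (r : ℝ) : ℂ :=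
  ∫ φ in (0 : ℝ)..(2 * Real.pi),
    ((Real.sqrt (-(g ![τ₀, r, φ]).det) / (16 * Real.pi * G) : ℝ) : ℂ) *
      ((1 / 2) * (bbForm g ξ h 0 1 ![τ₀, r, φ] - bbForm g ξ h 1 0 ![τ₀, r, φ]))

end Bulk

/-! ### The phase space -/

/-- A metric that satisfies the enhanced asymptotically `AdS₃` boundary conditions with radius `l`:
`g_rr = l²/r² + C_rr r⁻⁴ + o(r⁻⁴)`, `g_rA = O(r⁻³)`, `g_AB = r² e^{2φ} γ̄_AB + C_AB + o(1)`
and `ρ = γ^{AB} C_AB + C_rr / l² = 0` for `γ = e^{2φ} γ̄`. It lives on the region `r > R₀`.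
The boundary data `conf` (the field `φ` above), `Crr`, `C` are determined by `g`. -/
structure PhasePoint (l : ℝ) where
  g : Pt → Matrix (Fin 3) (Fin 3) ℝ
  R₀ : ℝ
  conf : Bdy → ℝ
  Crr : Bdy → ℝ
  C : Bdy → Matrix (Fin 2) (Fin 2) ℝ
  R₀_pos : 0 < R₀
  smooth_g : ∀ a b, ContDiffOn ℝ ∞ (fun x => g x a b) {x | R₀ < x 1}
  symm_g : ∀ x, R₀ < x 1 → (g x).IsSymm
  /-- Together with the expansions this gives signature `(-,+,+)` on the whole region. -/
  lorentz_g : ∀ x, R₀ < x 1 → (g x).det < 0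
  periodic_g : ∀ x, R₀ < x 1 → g (x + Pi.single 2 (2 * Real.pi)) = g x
  smooth_conf : ContDiff ℝ ∞ conf
  smooth_Crr : ContDiff ℝ ∞ Crr
  smooth_C : ∀ A B, ContDiff ℝ ∞ (fun y => C y A B)
  symm_C : ∀ y, (C y).IsSymm
  periodic_conf : ∀ y, conf (y + Pi.single 1 (2 * Real.pi)) = conf y
  periodic_Crr : ∀ y, Crr (y + Pi.single 1 (2 * Real.pi)) = Crr y
  periodic_C : ∀ y, C (y + Pi.single 1 (2 * Real.pi)) = C y
  expand_rr : LittleO 2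
    (fun x => g x 1 1 - l ^ 2 * x 1 ^ (-2 : ℤ) - Crr (proj x) * x 1 ^ (-4 : ℤ)) (-4)
  expand_rA : ∀ A, BigO 2 (fun x => g x 1 (bIdx A)) (-3)
  expand_AB : ∀ A B, LittleO 2
    (fun x => g x (bIdx A) (bIdx B)
      - x 1 ^ (2 : ℤ) * Real.exp (2 * conf (proj x)) * flat A B - C (proj x) A B) 0
  rho_eq_zero : ∀ y,
    (∑ A, ∑ B, Real.exp (-2 * conf y) * flat A B * C y A B) + Crr y / l ^ 2 = 0

/-- Einstein's equations `G_{ab} - g_{ab} / l² = 0` on the region where the metric lives. -/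
def OnShell {l : ℝ} (p : PhasePoint l) : Prop :=
  ∀ x, p.R₀ < x 1 → ∀ a b,
    ricci p.g a b x - (1 / 2) * scalarCurv p.g x * p.g x a b - (1 / l ^ 2) * p.g x a b = 0

/-- The trace-free part `Ξ_AB = C_AB - ½ γ̄_AB γ̄^{CD} C_CD`, indices moved by `γ̄`. -/
def PhasePoint.Xi {l : ℝ} (p : PhasePoint l) (y : Bdy) (A B : Fin 2) : ℝ :=
  p.C y A B - (1 / 2) * flat A B * ∑ D, ∑ E, flat D E * p.C y D E

/-- `h` is an infinitesimal variation `δg` of `p` with `δφ = om`, `δC_rr = ηrr`, `δC_AB = η_AB`. -/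
structure HasVariation {l : ℝ} (p : PhasePoint l) (h : Pt → Matrix (Fin 3) (Fin 3) ℂ)
    (om ηrr : Bdy → ℂ) (η : Bdy → Matrix (Fin 2) (Fin 2) ℂ) : Prop where
  smooth_om : ContDiff ℝ ∞ om
  smooth_ηrr : ContDiff ℝ ∞ ηrr
  smooth_η : ∀ A B, ContDiff ℝ ∞ (fun y => η y A B)
  expand_rr : LittleO 1 (fun x => h x 1 1 - ηrr (proj x) * (x 1 : ℂ) ^ (-4 : ℤ)) (-4)
  expand_rA : ∀ A, BigO 1 (fun x => h x 1 (bIdx A)) (-3)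
  expand_AB : ∀ A B, LittleO 1
    (fun x => h x (bIdx A) (bIdx B)
      - 2 * om (proj x) * (Real.exp (2 * p.conf (proj x)) : ℝ) * (flat A B : ℝ) * (x 1 : ℂ) ^ (2 : ℤ)
      - η (proj x) A B) 0

/-- `h` is tangent to the space of metrics obeying the boundary conditions: it has a variation of
the form above, and the linearized constraint `δρ = 0` holds. -/
def IsTangent {l : ℝ} (p : PhasePoint l) (h : Pt → Matrix (Fin 3) (Fin 3) ℂ) : Prop :=
  ∃ (om ηrr : Bdy → ℂ) (η : Bdy → Matrix (Fin 2) (Fin 2) ℂ), HasVariation p h om ηrr η ∧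
    ∀ y, (∑ A, ∑ B, (Real.exp (-2 * p.conf y) * flat A B : ℝ) *
      (-2 * om y * (p.C y A B : ℂ) + η y A B)) + ηrr y / (l : ℂ) ^ 2 = 0

/-- The derivative `∂_s g_s` of a family of metrics. -/
def velocity {l : ℝ} (pt : ℝ → PhasePoint l) (s : ℝ) (x : Pt) : Matrix (Fin 3) (Fin 3) ℂ :=
  fun a b => ((deriv (fun t => (pt t).g x a b) s : ℝ) : ℂ)

/-- A smooth path in the phase space, whose asymptotic expansions may be differentiated with
respect to the parameter. -/
structure PhasePath (l : ℝ) where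
  pt : ℝ → PhasePoint l
  R : ℝ
  R₀_le : ∀ s, (pt s).R₀ ≤ R
  smooth_g : ∀ a b,
    ContDiffOn ℝ ∞ (fun z : ℝ × Pt => (pt z.1).g z.2 a b) {z | R < z.2 1}
  smooth_conf : ContDiff ℝ ∞ (fun z : ℝ × Bdy => (pt z.1).conf z.2)
  smooth_Crr : ContDiff ℝ ∞ (fun z : ℝ × Bdy => (pt z.1).Crr z.2)
  smooth_C : ∀ A B, ContDiff ℝ ∞ (fun z : ℝ × Bdy => (pt z.1).C z.2 A B)
  variation : ∀ s, HasVariation (pt s) (velocity pt s)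
    (fun y => ((deriv (fun t => (pt t).conf y) s : ℝ) : ℂ))
    (fun y => ((deriv (fun t => (pt t).Crr y) s : ℝ) : ℂ))
    (fun y A B => ((deriv (fun t => (pt t).C y A B) s : ℝ) : ℂ))

/-! ### Asymptotic symmetries -/

/-- Leading data `(Y^A, ψ)` of an asymptotic symmetry, complexified. -/
abbrev Param := (Bdy → Fin 2 → ℂ) × (Bdy → ℂ)

/-- `Y` is a conformal Killing vector of `γ̄` and `ψ` is harmonic on the cylinder. -/
structure IsSymmetry (a : Param) : Prop where
  smooth_Y : ∀ A, ContDiff ℝ ∞ (fun y => a.1 y A)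
  smooth_ψ : ContDiff ℝ ∞ a.2
  periodic_Y : ∀ y, a.1 (y + Pi.single 1 (2 * Real.pi)) = a.1 y
  periodic_ψ : ∀ y, a.2 (y + Pi.single 1 (2 * Real.pi)) = a.2 y
  killing : ∀ y A B,
    ∑ D, ((flat D B : ℂ) * pd A (fun z => a.1 z D) y + (flat A D : ℂ) * pd B (fun z => a.1 z D) y)
      = (flat A B : ℂ) * ∑ D, pd D (fun z => a.1 z D) y
  harmonic : ∀ y, ∑ A, ∑ B, (flat A B : ℂ) * pd A (pd B a.2) y = 0

/-- `ξ` is an asymptotic symmetry vector field of the metric `p` with leading data `a = (Y, ψ)`: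
`ξ^r = -½ ψ r + X r⁻¹ + o(r⁻¹)` and `ξ^A = Y^A - l²/(4r²) γ^{AB} ∂_B ψ + O(r⁻⁴)`. -/
structure IsGenerator {l : ℝ} (p : PhasePoint l) (a : Param) (ξ : Pt → Fin 3 → ℂ) : Prop where
  smooth : ∃ R : ℝ, ∀ c, ContDiffOn ℝ ∞ (fun x => ξ x c) {x | R < x 1}
  periodic : ∃ R : ℝ, ∀ x, R < x 1 → ξ (x + Pi.single 2 (2 * Real.pi)) = ξ x
  expand_r : ∃ X : Bdy → ℂ, ContDiff ℝ ∞ X ∧ LittleO 2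
    (fun x => ξ x 1 + (1 / 2) * a.2 (proj x) * (x 1 : ℂ) - X (proj x) * (x 1 : ℂ) ^ (-1 : ℤ)) (-1)
  expand_A : ∀ A, BigO 2
    (fun x => ξ x (bIdx A) - a.1 (proj x) A
      + (l ^ 2 / 4 * Real.exp (-2 * p.conf (proj x)) : ℝ) * (x 1 : ℂ) ^ (-2 : ℤ) *
        ∑ B, (flat A B : ℂ) * pd B a.2 (proj x)) (-4)

/-- `e^{imx^±}` with `x^± = τ ± φ`; the sign is `s`. -/
def mode (s : ℤˣ) (m : ℤ) (y : Bdy) : ℂ :=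
  Complex.exp (Complex.I * (m : ℂ) * ((y 0 : ℂ) + ((s : ℤ) : ℂ) * (y 1 : ℂ)))

/-- `l^±_m = e^{imx^±} ∂_±`, where `∂_± = ½ (∂_τ ± ∂_φ)`. -/
def lGen (s : ℤˣ) (m : ℤ) : Param :=
  (fun y => ![(1 / 2) * mode s m y, (1 / 2) * ((s : ℤ) : ℂ) * mode s m y], 0)

/-- `p^±_m = e^{imx^±}`. -/
def pGen (s : ℤˣ) (m : ℤ) : Param := (0, mode s m)

/-- `q = τ`. -/
def qGen : Param := (0, fun y => (y 0 : ℂ))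

/-- `l̃^±_m = l^±_m + i m p^±_m`. -/
def lTilde (s : ℤˣ) (m : ℤ) : Param := lGen s m + (Complex.I * (m : ℂ)) • pGen s m

/-! ### Charges and their brackets -/

/-- The surface charge with leading data `a = (Y, ψ)` on the circle `τ = τ₀` at infinity:
`1/(16πGl) ∫₀^{2π} dφ [l² (ψ ∂_τ φ - φ ∂_τ ψ) + 2 Y^A Ξ_{τA}]`. -/
def surfaceCharge (l G τ₀ : ℝ) (a : Param) (p : PhasePoint l) : ℂ :=
  (1 / (16 * Real.pi * G * l) : ℝ) * ∫ φ in (0 : ℝ)..(2 * Real.pi),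
    ((l : ℂ) ^ 2 * (a.2 ![τ₀, φ] * (pd 0 p.conf ![τ₀, φ] : ℝ)
        - pd 0 a.2 ![τ₀, φ] * (p.conf ![τ₀, φ] : ℝ))
      + 2 * ∑ A, a.1 ![τ₀, φ] A * (p.Xi ![τ₀, φ] 0 A : ℝ))

/-- `i [Q_a, Q_b] = w` at the metric `p`, where the Poisson bracket of surface charges is the
Barnich-Brandt variation `[Q_a, Q_b] = δ̸Q_{ξ₁}[𝓛_{ξ₂} g, g]` on the circle `τ = τ₀` at infinity,
for whichever asymptotic symmetry vector fields `ξ₁`, `ξ₂` with leading data `a`, `b`. -/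
def HasIBracket (l G τ₀ : ℝ) (p : PhasePoint l) (a b : Param) (w : ℂ) : Prop :=
  ∀ ξ₁ ξ₂ : Pt → Fin 3 → ℂ, IsGenerator p a ξ₁ → IsGenerator p b ξ₂ →
    Tendsto (fun r => Complex.I * bbCircle p.g G τ₀ ξ₁ (lieMetric p.g ξ₂) r) atTop (𝓝 w)

/-! ### The background -/

theorem pd_zero {n : ℕ} {E : Type*} [NormedAddCommGroup E] [NormedSpace ℝ E] (i : Fin n) :
    pd i (fun _ => (0 : E)) = fun _ => 0 := by
  funext x; simp [pd]

theorem LittleO.of_zero {E : Type*} [NormedAddCommGroup E] [NormedSpace ℝ E] (k : ℕ) :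
    ∀ n : ℤ, LittleO k (fun _ => (0 : E)) n := by
  have h0 : ∀ n : ℤ, LittleO 0 (fun _ => (0 : E)) n := by
    intro n
    rw [LittleO]
    intro K _ ε hε
    refine ⟨0, fun x _ hx => ?_⟩
    simp only [norm_zero]
    positivity
  induction k with
  | zero => exact h0
  | succ k ih =>
    intro n
    rw [LittleO]
    refine ⟨h0 n, ?_, ?_, ?_⟩ <;> rw [pd_zero] <;> exact ih _

theorem BigO.of_zero {E : Type*} [NormedAddCommGroup E] [NormedSpace ℝ E] (k : ℕ) :
    ∀ n : ℤ, BigO k (fun _ => (0 : E)) n := by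
  have h0 : ∀ n : ℤ, BigO 0 (fun _ => (0 : E)) n := by
    intro n
    rw [BigO]
    intro K _
    exact ⟨0, 0, fun x _ _ => by simp⟩
  induction k with
  | zero => exact h0
  | succ k ih =>
    intro n
    rw [BigO]
    refine ⟨h0 n, ?_, ?_, ?_⟩ <;> rw [pd_zero] <;> exact ih _

/-- The massless non-rotating BTZ metric `-r² dτ² + l²/r² dr² + r² dφ²`. -/
def btzMetric (l : ℝ) (x : Pt) : Matrix (Fin 3) (Fin 3) ℝ :=
  Matrix.diagonal ![-(x 1 ^ (2 : ℤ)), l ^ 2 * x 1 ^ (-2 : ℤ), x 1 ^ (2 : ℤ)]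

/-- The massless non-rotating BTZ metric, the background at which all charges vanish. -/
def background (l : ℝ) (hl : 0 < l) : PhasePoint l where
  g := btzMetric l
  R₀ := 1
  conf := fun _ => 0
  Crr := fun _ => 0
  C := fun _ => 0
  R₀_pos := one_pos
  smooth_g := by
    intro a b x hx
    have hx0 : x 1 ≠ 0 := by
      have : (1 : ℝ) < x 1 := hx
      positivity
    have h1 : ContDiffAt ℝ ∞ (fun x : Pt => x 1) x := by fun_prop
    have hz : ContDiffAt ℝ ∞ (fun x : Pt => x 1 ^ (-2 : ℤ)) x := by
      have : (fun x : Pt => x 1 ^ (-2 : ℤ)) = fun x : Pt => (x 1 ^ 2)⁻¹ := by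
        funext y; rw [zpow_neg]; norm_cast
      rw [this]
      exact (h1.pow 2).inv (pow_ne_zero 2 hx0)
    have hp : ContDiffAt ℝ ∞ (fun x : Pt => x 1 ^ (2 : ℤ)) x := by
      have : (fun x : Pt => x 1 ^ (2 : ℤ)) = fun x : Pt => x 1 ^ 2 := by
        funext y; norm_cast
      rw [this]
      exact h1.pow 2
    refine ContDiffAt.contDiffWithinAt ?_
    fin_cases a <;> fin_cases b <;>
      simp only [btzMetric, Matrix.diagonal, Matrix.of_apply] <;>
      first
        | exact hp.neg
        | exact contDiffAt_const.mul hz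
        | exact hp
        | exact contDiffAt_const
  symm_g := fun x _ => Matrix.isSymm_diagonal _
  lorentz_g := by
    intro x hx
    have hx0 : (0 : ℝ) < x 1 := lt_trans one_pos hx
    rw [btzMetric, Matrix.det_diagonal, Fin.prod_univ_three]
    have h1 : (0 : ℝ) < x 1 ^ (2 : ℤ) := by positivity
    have h2 : (0 : ℝ) < l ^ 2 * x 1 ^ (-2 : ℤ) := by positivity
    have h3 := mul_pos (mul_pos h1 h2) h1
    simp only [Matrix.cons_val]
    linarith
  periodic_g := by
    intro x _
    simp [btzMetric]
  smooth_conf := contDiff_const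
  smooth_Crr := contDiff_const
  smooth_C := fun _ _ => contDiff_const
  symm_C := fun _ => Matrix.isSymm_zero
  periodic_conf := fun _ => rfl
  periodic_Crr := fun _ => rfl
  periodic_C := fun _ => rfl
  expand_rr := by
    convert LittleO.of_zero (E := ℝ) 2 (-4) using 2 with x
    simp [btzMetric]
  expand_rA := by
    intro A
    convert BigO.of_zero (E := ℝ) 2 (-3) using 2 with x
    fin_cases A <;> simp [btzMetric, bIdx, Matrix.diagonal]
  expand_AB := by
    intro A B
    convert LittleO.of_zero (E := ℝ) 2 0 using 2 with x
    fin_cases A <;> fin_cases B <;> simp [btzMetric, bIdx, flat, Matrix.diagonal]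
  rho_eq_zero := by simp

end AdSCharges

end

open AdSCharges

noncomputable section

namespace AdSCharges

section

open Asymptotics

/-! Every quantity in the theorem is built from the metric, a variation and a vector field by
finitely many sums, products, inverses and derivatives, and only the leading order in 1/r and the
two orders below it ever matter. The analysis can therefore be separated from the algebra. Series c0
+ c1/r + c2/r² form a commutative ring `Trunc`, and `HasExp k n f t` says that f = r^n t +
o(r^(n-2)), stably under k differentiations. This relation is closed under `HasExp.add`,
`HasExp.mul`, `HasExp.inv` and `HasExp.pd`, so each tensor at infinity is obtained by a finite
computation in `Trunc`. The coefficients may depend on r, because g_rA is only bounded by r^(-3) and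
r³ g_rA need not converge.

Charges. In the superpotential the two leading coefficients cancel (`JetData.bbTerm_sub`), and the
third one, multiplied by √(-g) ~ l e^{2φ} r, has a finite limit. The linearized constraint δρ = 0
eliminates δC_rr, and the factor e^{2φ} cancels, so the limit is linear in (δφ, δΞ) with
coefficients that do not depend on the metric (`jet_coeff`, `tendsto_bbCircle`). Such a one-form is
the differential of the charge (`PhasePath.hasDerivAt_surfaceCharge`). The subleading coefficient X
of ξ^r and the mixed components of g and h never reach this order.

Symmetries. Along ξ the leading metric changes by a rescaling, δφ = Y·∂φ + ½ div Y - ½ψ. The 1/r²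
term of ξ^A is exactly what cancels the r^(-1) part of the mixed components (`bigO_lie_rA`), and δρ
is Y·∂ρ + ψρ plus a multiple of the wave operator applied to ψ, hence zero (`linearizedRho_lie`).

Brackets. On shell, the ττ and rA components of the field equations give a wave equation for φ and
the conservation of the traceless tensor Ξ (`OnShell.wave_conf`, `OnShell.conserved`). With these,
the variation of the charge of a along b is the charge of the commutator, plus a term independent of
the metric, plus a total φ-derivative that integrates to zero (`bracket_density`,
`chargeVariation_lie`). The symmetric part of the metric-independent term is again a total
derivative (`central_density`), whence antisymmetry.

Modes. It remains to insert u l_m + α p_m and integrate exponentials over the circle. The central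
term comes from the inhomogeneous part ½ div Y - ½ψ of δφ and from the second derivative of ψ in δΞ.
The first source vanishes precisely for ψ = div Y, that is, for the parameters of the charges with a
tilde; the second one then yields the Virasoro term. -/

/-! ### The filter at infinity -/

/-- The filter of neighbourhoods of `r = ∞`, uniform in the boundary coordinates. -/
def far : Filter Pt := comap (fun x : Pt => x 1) atTop

/-- The filter of neighbourhoods of `r = ∞` over a set of boundary points. -/
def farOn (K : Set Bdy) : Filter Pt := far ⊓ 𝓟 (proj ⁻¹' K)

theorem eventually_far {p : Pt → Prop} :
    (∀ᶠ x in far, p x) ↔ ∃ R : ℝ, ∀ x : Pt, R < x 1 → p x := by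
  have h := ((atTop_basis_Ioi (α := ℝ)).comap (fun x : Pt => x 1)).eventually_iff (q := p)
  simpa [far] using h

theorem eventually_farOn {K : Set Bdy} {p : Pt → Prop} :
    (∀ᶠ x in farOn K, p x) ↔ ∃ R : ℝ, ∀ x : Pt, proj x ∈ K → R < x 1 → p x := by
  rw [farOn, eventually_inf_principal, eventually_far]
  exact ⟨fun ⟨R, h⟩ => ⟨R, fun x hx hr => h x hr hx⟩, fun ⟨R, h⟩ => ⟨R, fun x hr hx => h x hx hr⟩⟩

theorem farOn_le (K : Set Bdy) : farOn K ≤ far := inf_le_left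

/-- The regions r > R are open. This is what allows an identity valid for large r to be
differentiated. -/
theorem eventually_far_nhds {p : Pt → Prop} (h : ∀ᶠ x in far, p x) :
    ∀ᶠ x in far, ∀ᶠ y in 𝓝 x, p y := by
  obtain ⟨R, hR⟩ := eventually_far.1 h
  refine eventually_far.2 ⟨R, fun x hx => ?_⟩
  have : IsOpen {y : Pt | R < y 1} := isOpen_lt continuous_const (continuous_apply 1)
  filter_upwards [this.mem_nhds hx] with y hy using hR y hy

theorem eventually_far_gt (R : ℝ) : ∀ᶠ x in far, R < x 1 :=
  eventually_far.2 ⟨R, fun _ h => h⟩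

theorem eventually_far_pos : ∀ᶠ x in far, 0 < x 1 := eventually_far_gt 0

/-- The function is smooth for large `r`. -/
def FarSmooth {E : Type*} [NormedAddCommGroup E] [NormedSpace ℝ E] (f : Pt → E) : Prop :=
  ∀ᶠ x in far, ContDiffAt ℝ ∞ f x

/-! ### Smoothness near infinity and the calculus of coordinate derivatives -/

section General

variable {E : Type*} [NormedAddCommGroup E] [NormedSpace ℝ E] {f g : Pt → E}

theorem FarSmooth.differentiable (h : FarSmooth f) : ∀ᶠ x in far, DifferentiableAt ℝ f x := by
  filter_upwards [h] with x hx using hx.differentiableAt (by simp)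

theorem FarSmooth.congr (h : FarSmooth f) (hfg : f =ᶠ[far] g) : FarSmooth g := by
  filter_upwards [h, eventually_far_nhds hfg] with x hx hy
  exact hx.congr_of_eventuallyEq (hy.mono fun _ h => h.symm)

theorem FarSmooth.add (hf : FarSmooth f) (hg : FarSmooth g) : FarSmooth (fun x => f x + g x) := by
  filter_upwards [hf, hg] with x h1 h2 using h1.add h2

theorem FarSmooth.neg (hf : FarSmooth f) : FarSmooth (fun x => -f x) := by
  filter_upwards [hf] with x h1 using h1.neg

theorem FarSmooth.sub (hf : FarSmooth f) (hg : FarSmooth g) : FarSmooth (fun x => f x - g x) := by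
  filter_upwards [hf, hg] with x h1 h2 using h1.sub h2

theorem FarSmooth.smul {u : Pt → ℝ} (hu : FarSmooth u) (hf : FarSmooth f) :
    FarSmooth (fun x => u x • f x) := by
  filter_upwards [hf, hu] with x h1 h2 using h2.smul h1

theorem farSmooth_const (c : E) : FarSmooth (fun _ => c) :=
  Eventually.of_forall fun _ => contDiffAt_const

theorem farSmooth_zpow (n : ℤ) : FarSmooth (fun x : Pt => (x 1) ^ n) := by
  filter_upwards [eventually_far_pos] with x hx
  have h1 : ContDiffAt ℝ ∞ (fun x : Pt => x 1) x := by fun_prop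
  cases n with
  | ofNat m => simpa using h1.pow m
  | negSucc m =>
    simp only [zpow_negSucc]
    exact (h1.pow (m + 1)).inv (pow_ne_zero _ hx.ne')

theorem contDiff_proj : ContDiff ℝ ∞ proj := by
  rw [contDiff_pi]; intro A; unfold proj; fun_prop

theorem farSmooth_proj {a : Bdy → E} (ha : ContDiff ℝ ∞ a) : FarSmooth (fun x => a (proj x)) :=
  Eventually.of_forall fun _ => (ha.comp contDiff_proj).contDiffAt

theorem ContDiffAt.pd {n : ℕ} {f : (Fin n → ℝ) → E} {x : Fin n → ℝ} (i : Fin n)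
    (h : ContDiffAt ℝ ∞ f x) : ContDiffAt ℝ ∞ (pd i f) x := by
  have := h.fderiv_right (m := ∞) (by simp)
  exact this.clm_apply contDiffAt_const

theorem contDiff_pd {n : ℕ} {f : (Fin n → ℝ) → E} (i : Fin n)
    (h : ContDiff ℝ ∞ f) : ContDiff ℝ ∞ (pd i f) :=
  contDiff_iff_contDiffAt.2 fun _ => ContDiffAt.pd i h.contDiffAt

theorem FarSmooth.pd (h : FarSmooth f) (i : Fin 3) : FarSmooth (pd i f) := by
  filter_upwards [h] with x hx using ContDiffAt.pd i hx

theorem farSmooth_of_contDiffOn {R : ℝ} (h : ContDiffOn ℝ ∞ f {x | R < x 1}) : FarSmooth f := by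
  refine eventually_far.2 ⟨R, fun x hx => h.contDiffAt ?_⟩
  exact (isOpen_lt continuous_const (continuous_apply 1)).mem_nhds hx

theorem pd_congr {n : ℕ} {f g : (Fin n → ℝ) → E} {x : Fin n → ℝ} (i : Fin n)
    (h : f =ᶠ[𝓝 x] g) : pd i f x = pd i g x := by
  simp only [pd, h.fderiv_eq]

theorem pd_congr_far (i : Fin 3) (h : f =ᶠ[far] g) : pd i f =ᶠ[far] pd i g := by
  filter_upwards [eventually_far_nhds h] with x hx using pd_congr i hx

theorem pd_add {n : ℕ} {f g : (Fin n → ℝ) → E} {x : Fin n → ℝ} (i : Fin n)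
    (hf : DifferentiableAt ℝ f x) (hg : DifferentiableAt ℝ g x) :
    pd i (fun y => f y + g y) x = pd i f x + pd i g x := by
  simp [pd, fderiv_fun_add hf hg]

theorem pd_sub {n : ℕ} {f g : (Fin n → ℝ) → E} {x : Fin n → ℝ} (i : Fin n)
    (hf : DifferentiableAt ℝ f x) (hg : DifferentiableAt ℝ g x) :
    pd i (fun y => f y - g y) x = pd i f x - pd i g x := by
  simp [pd, fderiv_fun_sub hf hg]

theorem pd_neg {n : ℕ} {f : (Fin n → ℝ) → E} {x : Fin n → ℝ} (i : Fin n) :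
    pd i (fun y => -f y) x = -pd i f x := by
  simp [pd, fderiv_fun_neg]

theorem pd_smul {n : ℕ} {u : (Fin n → ℝ) → ℝ} {f : (Fin n → ℝ) → E} {x : Fin n → ℝ} (i : Fin n)
    (hu : DifferentiableAt ℝ u x) (hf : DifferentiableAt ℝ f x) :
    pd i (fun y => u y • f y) x = pd i u x • f x + u x • pd i f x := by
  simp [pd, fderiv_fun_smul hu hf, add_comm]

theorem pd_const {n : ℕ} {x : Fin n → ℝ} (i : Fin n) (c : E) : pd i (fun _ => c) x = 0 := by
  simp [pd]

theorem pd_mul {n : ℕ} {𝕜 : Type*} [RCLike 𝕜] {f g : (Fin n → ℝ) → 𝕜} {x : Fin n → ℝ} (i : Fin n)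
    (hf : DifferentiableAt ℝ f x) (hg : DifferentiableAt ℝ g x) :
    pd i (fun y => f y * g y) x = pd i f x * g x + f x * pd i g x := by
  simp [pd, fderiv_fun_mul hf hg]; ring

theorem pd_inv {n : ℕ} {𝕜 : Type*} [RCLike 𝕜] {f : (Fin n → ℝ) → 𝕜} {x : Fin n → ℝ} (i : Fin n)
    (hf : DifferentiableAt ℝ f x) (h0 : f x ≠ 0) :
    pd i (fun y => (f y)⁻¹) x = -(pd i f x * ((f x)⁻¹ * (f x)⁻¹)) := by
  have h := (hasFDerivAt_inv' (𝕜 := ℝ) h0).comp x hf.hasFDerivAt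
  have : pd i (fun y => (f y)⁻¹) x
      = ((-(ContinuousLinearMap.mulLeftRight ℝ 𝕜) (f x)⁻¹ (f x)⁻¹).comp (fderiv ℝ f x))
        (Pi.single i 1) := by
    rw [pd, ← h.fderiv]; rfl
  rw [this]; simp [pd]; ring

theorem pd_ofReal {n : ℕ} {f : (Fin n → ℝ) → ℝ} {x : Fin n → ℝ} (i : Fin n)
    (hf : DifferentiableAt ℝ f x) : pd i (fun y => (f y : ℂ)) x = (pd i f x : ℝ) := by
  have h := Complex.ofRealCLM.hasFDerivAt.comp x hf.hasFDerivAt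
  have : pd i (fun y => (f y : ℂ)) x = (Complex.ofRealCLM.comp (fderiv ℝ f x)) (Pi.single i 1) := by
    rw [pd, ← h.fderiv]; rfl
  rw [this]; simp [pd]

theorem pd_zpow (i : Fin 3) (n : ℤ) {x : Pt} (hx : 0 < x 1) :
    pd i (fun y : Pt => (y 1) ^ n) x = if i = 1 then (n : ℝ) * (x 1) ^ (n - 1) else 0 := by
  have h1 : HasFDerivAt (fun y : Pt => y 1) (ContinuousLinearMap.proj (R := ℝ) (φ := fun _ : Fin 3 => ℝ) 1) x :=
    hasFDerivAt_apply 1 x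
  have h2 := (hasDerivAt_zpow n (x 1) (Or.inl hx.ne')).comp_hasFDerivAt x h1
  have : pd i (fun y : Pt => (y 1) ^ n) x
      = (((n : ℝ) * (x 1) ^ (n - 1)) • (ContinuousLinearMap.proj (R := ℝ) (φ := fun _ : Fin 3 => ℝ) 1))
        (Pi.single i 1) := by
    rw [pd, ← h2.fderiv]; rfl
  rw [this]
  by_cases h : i = 1
  · subst h; simp
  · have : (1 : Fin 3) ≠ i := fun h' => h h'.symm
    simp [h, this]

theorem proj_single_bIdx (A : Fin 2) : proj (Pi.single (bIdx A) 1) = Pi.single A 1 := by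
  funext B; fin_cases A <;> fin_cases B <;> simp [proj, bIdx]

theorem proj_single_one : proj (Pi.single 1 1) = 0 := by
  funext B; fin_cases B <;> simp [proj, bIdx]

theorem fderiv_comp_proj {a : Bdy → E} (ha : Differentiable ℝ a) (x v : Pt) :
    fderiv ℝ (fun y => a (proj y)) x v = fderiv ℝ a (proj x) (proj v) := by
  let P : Pt →L[ℝ] Bdy := ContinuousLinearMap.pi fun A => ContinuousLinearMap.proj (bIdx A)
  have h : HasFDerivAt (fun y => a (proj y)) ((fderiv ℝ a (proj x)).comp P) x :=
    HasFDerivAt.comp x (g := a) (f := P) (ha (proj x)).hasFDerivAt P.hasFDerivAt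
  rw [h.fderiv]; rfl

theorem pd_proj {a : Bdy → E} (ha : Differentiable ℝ a) (A : Fin 2) (x : Pt) :
    pd (bIdx A) (fun y => a (proj y)) x = pd A a (proj x) := by
  rw [pd, fderiv_comp_proj ha, proj_single_bIdx]; rfl

theorem pd_proj_zero {a : Bdy → E} (ha : Differentiable ℝ a) (x : Pt) :
    pd 0 (fun y => a (proj y)) x = pd 0 a (proj x) := pd_proj ha 0 x

theorem pd_proj_two {a : Bdy → E} (ha : Differentiable ℝ a) (x : Pt) :
    pd 2 (fun y => a (proj y)) x = pd 1 a (proj x) := pd_proj ha 1 x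

theorem pd_proj_one {a : Bdy → E} (ha : Differentiable ℝ a) (x : Pt) :
    pd 1 (fun y => a (proj y)) x = 0 := by
  rw [pd, fderiv_comp_proj ha, proj_single_one]; simp

/-! ### Orders -/

/-- Bridge to the asymptotics library: r^n is positive for large r, so bounding by r^n or by its
norm is the same. -/
theorem bigO_zero_iff {n : ℤ} : BigO 0 f n ↔
    ∀ K : Set Bdy, IsCompact K → f =O[farOn K] fun x => (x 1) ^ n := by
  have hpos : ∀ K, ∀ᶠ x in farOn K, 0 < x 1 := fun K => farOn_le K eventually_far_pos
  rw [BigO]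
  refine forall₂_congr fun K _ => ⟨?_, fun h => ?_⟩
  · rintro ⟨c, R, h⟩
    refine IsBigO.of_bound c ?_
    filter_upwards [eventually_farOn.2 ⟨R, h⟩, hpos K] with x hx h0
    rwa [Real.norm_of_nonneg (zpow_pos h0 n).le]
  · obtain ⟨c, hc⟩ := h.bound
    refine ⟨c, eventually_farOn.1 ?_⟩
    filter_upwards [hc, hpos K] with x hx h0
    rwa [Real.norm_of_nonneg (zpow_pos h0 n).le] at hx

theorem littleO_zero_iff {n : ℤ} : LittleO 0 f n ↔
    ∀ K : Set Bdy, IsCompact K → f =o[farOn K] fun x => (x 1) ^ n := by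
  have hpos : ∀ K, ∀ᶠ x in farOn K, 0 < x 1 := fun K => farOn_le K eventually_far_pos
  rw [LittleO]
  refine forall₂_congr fun K _ => ⟨fun h => ?_, fun h ε hε => ?_⟩
  · refine IsLittleO.of_bound fun ε hε => ?_
    filter_upwards [eventually_farOn.2 (h ε hε), hpos K] with x hx h0
    rwa [Real.norm_of_nonneg (zpow_pos h0 n).le]
  · refine eventually_farOn.1 ?_
    filter_upwards [h.bound hε, hpos K] with x hx h0
    rwa [Real.norm_of_nonneg (zpow_pos h0 n).le] at hx

theorem isBigO_zpow {n m : ℤ} (h : n ≤ m) :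
    (fun x : Pt => (x 1) ^ n) =O[far] fun x => (x 1) ^ m := by
  refine IsBigO.of_bound 1 ?_
  filter_upwards [eventually_far_gt 1] with x hx
  have h0 : 0 < x 1 := lt_trans one_pos hx
  rw [Real.norm_of_nonneg (zpow_pos h0 n).le, Real.norm_of_nonneg (zpow_pos h0 m).le, one_mul]
  exact zpow_le_zpow_right₀ hx.le h

theorem isLittleO_zpow {n m : ℤ} (h : n < m) :
    (fun x : Pt => (x 1) ^ n) =o[far] fun x => (x 1) ^ m := by
  refine IsLittleO.of_bound fun ε hε => ?_
  -- The bound r > 1 makes powers monotone in the exponent; the bound r ≥ 1/ε gives r^(m-1) ≤ ε r^m.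
  filter_upwards [eventually_far_gt (max 1 ε⁻¹)] with x hx
  have h1 : 1 < x 1 := lt_of_le_of_lt (le_max_left _ _) hx
  have h0 : 0 < x 1 := lt_trans one_pos h1
  rw [Real.norm_of_nonneg (zpow_pos h0 n).le, Real.norm_of_nonneg (zpow_pos h0 m).le]
  have h2 : ε⁻¹ ≤ x 1 := ((le_max_right _ _).trans_lt hx).le
  have h3 : (x 1) ^ n ≤ (x 1) ^ (m - 1) := zpow_le_zpow_right₀ h1.le (by omega)
  have h4 : (x 1) ^ m = (x 1) ^ (m - 1) * x 1 := by
    rw [← zpow_add_one₀ h0.ne']; congr 1; ring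
  rw [h4]
  have h5 : 1 ≤ ε * x 1 := by
    have := mul_le_mul_of_nonneg_left h2 hε.le
    rwa [mul_inv_cancel₀ hε.ne'] at this
  have h6 := zpow_pos h0 (m - 1)
  nlinarith

theorem BigO.zero_of {k : ℕ} {n : ℤ} (h : BigO k f n) : BigO 0 f n := by
  cases k with
  | zero => exact h
  | succ k => rw [BigO] at h; exact h.1

theorem BigO.of_succ {k : ℕ} : ∀ {f : Pt → E} {n : ℤ}, BigO (k + 1) f n → BigO k f n := by
  induction k with
  | zero => intro f n h; exact h.zero_of
  | succ k ih =>
    intro f n h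
    rw [BigO] at h ⊢
    exact ⟨h.1, ih h.2.1, ih h.2.2.1, ih h.2.2.2⟩

theorem BigO.congr {k : ℕ} : ∀ {f g : Pt → E} {n : ℤ}, BigO k f n → f =ᶠ[far] g → BigO k g n := by
  have h0 : ∀ {f g : Pt → E} {n : ℤ}, BigO 0 f n → f =ᶠ[far] g → BigO 0 g n := by
    intro f g n h hfg
    rw [bigO_zero_iff] at h ⊢
    exact fun K hK => (h K hK).congr' (hfg.filter_mono (farOn_le K)) EventuallyEq.rfl
  induction k with
  | zero => exact h0
  | succ k ih =>
    intro f g n h hfg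
    rw [BigO] at h ⊢
    exact ⟨h0 h.1 hfg, ih h.2.1 (pd_congr_far _ hfg), ih h.2.2.1 (pd_congr_far _ hfg),
      ih h.2.2.2 (pd_congr_far _ hfg)⟩

theorem LittleO.congr {k : ℕ} :
    ∀ {f g : Pt → E} {n : ℤ}, LittleO k f n → f =ᶠ[far] g → LittleO k g n := by
  have h0 : ∀ {f g : Pt → E} {n : ℤ}, LittleO 0 f n → f =ᶠ[far] g → LittleO 0 g n := by
    intro f g n h hfg
    rw [littleO_zero_iff] at h ⊢
    exact fun K hK => (h K hK).congr' (hfg.filter_mono (farOn_le K)) EventuallyEq.rfl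
  induction k with
  | zero => exact h0
  | succ k ih =>
    intro f g n h hfg
    rw [LittleO] at h ⊢
    exact ⟨h0 h.1 hfg, ih h.2.1 (pd_congr_far _ hfg), ih h.2.2.1 (pd_congr_far _ hfg),
      ih h.2.2.2 (pd_congr_far _ hfg)⟩

/-- Smoothness is needed because `pd` is additive only at points of differentiability. As in all
these inductions on k, the functions are quantified inside, since the step passes to their
derivatives. -/
theorem BigO.add {k : ℕ} : ∀ {f g : Pt → E} {n : ℤ}, FarSmooth f → FarSmooth g →
    BigO k f n → BigO k g n → BigO k (fun x => f x + g x) n := by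
  have h0 : ∀ {f g : Pt → E} {n : ℤ}, BigO 0 f n → BigO 0 g n → BigO 0 (fun x => f x + g x) n := by
    intro f g n h h'
    rw [bigO_zero_iff] at h h' ⊢
    exact fun K hK => (h K hK).add (h' K hK)
  induction k with
  | zero => exact fun _ _ => h0
  | succ k ih =>
    intro f g n sf sg h h'
    have key : ∀ i, (fun x => pd i f x + pd i g x) =ᶠ[far] pd i (fun x => f x + g x) := by
      intro i
      filter_upwards [sf.differentiable, sg.differentiable] with x h1 h2 using (pd_add i h1 h2).symm
    rw [BigO] at h h' ⊢
    exact ⟨h0 h.1 h'.1, (ih (sf.pd 0) (sg.pd 0) h.2.1 h'.2.1).congr (key 0),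
      (ih (sf.pd 1) (sg.pd 1) h.2.2.1 h'.2.2.1).congr (key 1),
      (ih (sf.pd 2) (sg.pd 2) h.2.2.2 h'.2.2.2).congr (key 2)⟩

theorem FarSmooth.mul {𝕜 : Type*} [RCLike 𝕜] {f g : Pt → 𝕜} (hf : FarSmooth f) (hg : FarSmooth g) :
    FarSmooth (fun x => f x * g x) := by
  filter_upwards [hf, hg] with x h1 h2 using h1.mul h2

theorem FarSmooth.inv {𝕜 : Type*} [RCLike 𝕜] {f : Pt → 𝕜} (hf : FarSmooth f)
    (h0 : ∀ᶠ x in far, f x ≠ 0) : FarSmooth (fun x => (f x)⁻¹) := by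
  filter_upwards [hf, h0] with x h1 h2 using h1.inv h2

theorem FarSmooth.ofReal {f : Pt → ℝ} (hf : FarSmooth f) : FarSmooth (fun x => (f x : ℂ)) := by
  filter_upwards [hf] with x h1
  exact Complex.ofRealCLM.contDiff.contDiffAt.comp x h1

theorem BigO.smul {k : ℕ} : ∀ {u : Pt → ℝ} {f : Pt → E} {n m : ℤ}, FarSmooth u → FarSmooth f →
    BigO k u n → BigO k f m → BigO k (fun x => u x • f x) (n + m) := by
  have h0 : ∀ {u : Pt → ℝ} {f : Pt → E} {n m : ℤ},
      BigO 0 u n → BigO 0 f m → BigO 0 (fun x => u x • f x) (n + m) := by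
    intro u f n m h h'
    rw [bigO_zero_iff] at h h' ⊢
    intro K hK
    refine ((h K hK).smul (h' K hK)).congr' EventuallyEq.rfl ?_
    filter_upwards [farOn_le K eventually_far_pos] with x hx
    rw [smul_eq_mul, zpow_add₀ hx.ne']
  induction k with
  | zero => exact fun _ _ => h0
  | succ k ih =>
    intro u f n m su sf h h'
    have hu := h.of_succ
    have hf := h'.of_succ
    have key : ∀ i, (fun x => pd i u x • f x + u x • pd i f x) =ᶠ[far] pd i (fun x => u x • f x) := by
      intro i
      filter_upwards [su.differentiable, sf.differentiable] with x h1 h2 using (pd_smul i h1 h2).symm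
    rw [BigO] at h h' ⊢
    refine ⟨h0 h.1 h'.1, ?_, ?_, ?_⟩
    · exact (BigO.add ((su.pd 0).smul sf) (su.smul (sf.pd 0)) (ih (su.pd 0) sf h.2.1 hf)
        (ih su (sf.pd 0) hu h'.2.1)).congr (key 0)
    · refine (BigO.add ((su.pd 1).smul sf) (su.smul (sf.pd 1)) ?_ ?_).congr (key 1)
      · have := ih (su.pd 1) sf h.2.2.1 hf
        rwa [show n - 1 + m = n + m - 1 by ring] at this
      · have := ih su (sf.pd 1) hu h'.2.2.1
        rwa [show n + (m - 1) = n + m - 1 by ring] at this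
    · exact (BigO.add ((su.pd 2).smul sf) (su.smul (sf.pd 2)) (ih (su.pd 2) sf h.2.2.2 hf)
        (ih su (sf.pd 2) hu h'.2.2.2)).congr (key 2)

theorem bigO_zpow {k : ℕ} : ∀ (c : ℝ) (n : ℤ), BigO k (fun x : Pt => c * (x 1) ^ n) n := by
  have h0 : ∀ (c : ℝ) (n : ℤ), BigO 0 (fun x : Pt => c * (x 1) ^ n) n := by
    intro c n
    rw [bigO_zero_iff]
    exact fun K _ => (isBigO_refl _ _).const_mul_left c
  induction k with
  | zero => exact h0
  | succ k ih =>
    intro c n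
    have key : ∀ i, pd i (fun x : Pt => c * (x 1) ^ n) =ᶠ[far]
        fun x => if i = 1 then c * n * (x 1) ^ (n - 1) else 0 := by
      intro i
      filter_upwards [eventually_far_pos, (farSmooth_zpow n).differentiable] with x hx hd
      rw [pd_mul i (differentiableAt_const c) hd, pd_zpow i n hx, pd_const]
      split_ifs <;> ring
    rw [BigO]
    exact ⟨h0 c n, (BigO.of_zero k n).congr (key 0).symm, (ih (c * n) (n - 1)).congr (key 1).symm,
      (BigO.of_zero k n).congr (key 2).symm⟩

/-- A boundary function is bounded over compact sets, is killed by ∂_r, and its other two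
derivatives are again boundary functions. -/
theorem bigO_proj {k : ℕ} : ∀ {a : Bdy → E}, ContDiff ℝ ∞ a → BigO k (fun x => a (proj x)) 0 := by
  have h0 : ∀ {a : Bdy → E}, ContDiff ℝ ∞ a → BigO 0 (fun x => a (proj x)) 0 := by
    intro a ha
    rw [BigO]
    intro K hK
    obtain ⟨c, hc⟩ := hK.exists_bound_of_continuousOn ha.continuous.continuousOn
    exact ⟨c, 0, fun x hx _ => by simpa using hc _ hx⟩
  induction k with
  | zero => exact h0
  | succ k ih =>
    intro a ha
    have hd := ha.differentiable (by simp)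
    rw [BigO]
    refine ⟨h0 ha, ?_, ?_, ?_⟩
    · rw [funext (pd_proj_zero hd)]; exact ih (contDiff_pd 0 ha)
    · rw [funext (pd_proj_one hd)]; exact BigO.of_zero k _
    · rw [funext (pd_proj_two hd)]; exact ih (contDiff_pd 1 ha)

end General

end

section

open Asymptotics

/-! ### Truncated power series in `1 / r` -/

/-- Power series `c0 + c1 ε + c2 ε²` truncated modulo `ε³`. -/
@[ext] structure Trunc (R : Type*) where
  c0 : R
  c1 : R
  c2 : R

namespace Trunc

section Ring

variable {R : Type*} [CommRing R]

instance : Zero (Trunc R) := ⟨⟨0, 0, 0⟩⟩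
instance : One (Trunc R) := ⟨⟨1, 0, 0⟩⟩
instance : Add (Trunc R) := ⟨fun s t => ⟨s.c0 + t.c0, s.c1 + t.c1, s.c2 + t.c2⟩⟩
instance : Neg (Trunc R) := ⟨fun s => ⟨-s.c0, -s.c1, -s.c2⟩⟩
instance : Sub (Trunc R) := ⟨fun s t => ⟨s.c0 - t.c0, s.c1 - t.c1, s.c2 - t.c2⟩⟩
instance : Mul (Trunc R) :=
  ⟨fun s t => ⟨s.c0 * t.c0, s.c0 * t.c1 + s.c1 * t.c0, s.c0 * t.c2 + s.c1 * t.c1 + s.c2 * t.c0⟩⟩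
instance : SMul ℕ (Trunc R) := ⟨fun n s => ⟨n • s.c0, n • s.c1, n • s.c2⟩⟩
instance : SMul ℤ (Trunc R) := ⟨fun n s => ⟨n • s.c0, n • s.c1, n • s.c2⟩⟩

@[simp] theorem zero_c0 : (0 : Trunc R).c0 = 0 := rfl
@[simp] theorem zero_c1 : (0 : Trunc R).c1 = 0 := rfl
@[simp] theorem zero_c2 : (0 : Trunc R).c2 = 0 := rfl
@[simp] theorem one_c0 : (1 : Trunc R).c0 = 1 := rfl
@[simp] theorem one_c1 : (1 : Trunc R).c1 = 0 := rfl
@[simp] theorem one_c2 : (1 : Trunc R).c2 = 0 := rfl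
@[simp] theorem add_c0 (s t : Trunc R) : (s + t).c0 = s.c0 + t.c0 := rfl
@[simp] theorem add_c1 (s t : Trunc R) : (s + t).c1 = s.c1 + t.c1 := rfl
@[simp] theorem add_c2 (s t : Trunc R) : (s + t).c2 = s.c2 + t.c2 := rfl
@[simp] theorem sub_c0 (s t : Trunc R) : (s - t).c0 = s.c0 - t.c0 := rfl
@[simp] theorem sub_c1 (s t : Trunc R) : (s - t).c1 = s.c1 - t.c1 := rfl
@[simp] theorem sub_c2 (s t : Trunc R) : (s - t).c2 = s.c2 - t.c2 := rfl
@[simp] theorem neg_c0 (s : Trunc R) : (-s).c0 = -s.c0 := rfl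
@[simp] theorem neg_c1 (s : Trunc R) : (-s).c1 = -s.c1 := rfl
@[simp] theorem neg_c2 (s : Trunc R) : (-s).c2 = -s.c2 := rfl
@[simp] theorem mul_c0 (s t : Trunc R) : (s * t).c0 = s.c0 * t.c0 := rfl
@[simp] theorem mul_c1 (s t : Trunc R) : (s * t).c1 = s.c0 * t.c1 + s.c1 * t.c0 := rfl
@[simp] theorem mul_c2 (s t : Trunc R) :
    (s * t).c2 = s.c0 * t.c2 + s.c1 * t.c1 + s.c2 * t.c0 := rfl
theorem nsmul_def (n : ℕ) (s : Trunc R) : n • s = ⟨n • s.c0, n • s.c1, n • s.c2⟩ := rfl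
theorem zsmul_def (n : ℤ) (s : Trunc R) : n • s = ⟨n • s.c0, n • s.c1, n • s.c2⟩ := rfl

instance : CommRing (Trunc R) where
  add_assoc s t u := by ext <;> simp [add_assoc]
  zero_add s := by ext <;> simp
  add_zero s := by ext <;> simp
  add_comm s t := by ext <;> simp [add_comm]
  neg_add_cancel s := by ext <;> simp
  sub_eq_add_neg s t := by ext <;> simp [sub_eq_add_neg]
  mul_assoc s t u := by ext <;> simp <;> ring
  one_mul s := by ext <;> simp
  mul_one s := by ext <;> simp
  mul_comm s t := by ext <;> simp <;> ring
  left_distrib s t u := by ext <;> simp <;> ring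
  right_distrib s t u := by ext <;> simp <;> ring
  zero_mul s := by ext <;> simp
  mul_zero s := by ext <;> simp
  nsmul n s := n • s
  nsmul_zero s := by ext <;> simp [nsmul_def]
  nsmul_succ n s := by ext <;> simp [nsmul_def, add_mul]
  zsmul n s := n • s
  zsmul_zero' s := by ext <;> simp [zsmul_def]
  zsmul_succ' n s := by ext <;> simp [zsmul_def, add_mul]
  zsmul_neg' n s := by ext <;> simp [zsmul_def, add_mul]

theorem mk_add_mk (a b c a' b' c' : R) :
    (⟨a, b, c⟩ + ⟨a', b', c'⟩ : Trunc R) = ⟨a + a', b + b', c + c'⟩ := rfl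
theorem mk_sub_mk (a b c a' b' c' : R) :
    (⟨a, b, c⟩ - ⟨a', b', c'⟩ : Trunc R) = ⟨a - a', b - b', c - c'⟩ := rfl
theorem neg_mk (a b c : R) : (-⟨a, b, c⟩ : Trunc R) = ⟨-a, -b, -c⟩ := rfl
theorem mk_mul_mk (a b c a' b' c' : R) : (⟨a, b, c⟩ * ⟨a', b', c'⟩ : Trunc R)
    = ⟨a * a', a * b' + b * a', a * c' + b * b' + c * a'⟩ := rfl
theorem mk_eq_zero (a b c : R) : (⟨a, b, c⟩ : Trunc R) = 0 ↔ a = 0 ∧ b = 0 ∧ c = 0 :=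
  Trunc.ext_iff

/-- Constants. -/
def const (a : R) : Trunc R := ⟨a, 0, 0⟩

/-- Multiplication by `ε`. -/
def shift (s : Trunc R) : Trunc R := ⟨0, s.c0, s.c1⟩

end Ring

/-- Coefficientwise application of a map. -/
def map {R S : Type*} (φ : R → S) (s : Trunc R) : Trunc S := ⟨φ s.c0, φ s.c1, φ s.c2⟩

section Field

variable {𝕜 : Type*} [RCLike 𝕜]

/-- The inverse of a series with invertible leading coefficient. -/
def inv (s : Trunc 𝕜) : Trunc 𝕜 :=
  ⟨s.c0⁻¹, -s.c1 * (s.c0⁻¹ * s.c0⁻¹),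
    s.c1 * s.c1 * (s.c0⁻¹ * s.c0⁻¹ * s.c0⁻¹) - s.c2 * (s.c0⁻¹ * s.c0⁻¹)⟩

/-- The coefficientwise derivative. -/
def pdT (i : Fin 3) (t : Pt → Trunc 𝕜) (x : Pt) : Trunc 𝕜 :=
  ⟨pd i (fun y => (t y).c0) x, pd i (fun y => (t y).c1) x, pd i (fun y => (t y).c2) x⟩

/-- The coefficients of `∂_r (r^n t)`, as multiples of `r^(n-1)`. -/
def pdr (n : ℤ) (t : Pt → Trunc 𝕜) (x : Pt) : Trunc 𝕜 :=
  ⟨n * (t x).c0 + (x 1 : ℝ) • pd 1 (fun y => (t y).c0) x,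
    (n - 1) * (t x).c1 + (x 1 : ℝ) • pd 1 (fun y => (t y).c1) x,
    (n - 2) * (t x).c2 + (x 1 : ℝ) • pd 1 (fun y => (t y).c2) x⟩

/-- The function `r^n (c0 + c1 / r + c2 / r²)`. -/
def model (n : ℤ) (t : Pt → Trunc 𝕜) (x : Pt) : 𝕜 :=
  (x 1) ^ n • (t x).c0 + (x 1) ^ (n - 1) • (t x).c1 + (x 1) ^ (n - 2) • (t x).c2

end Field

end Trunc

open AdSCharges.Trunc

/-! ### Functions with an expansion to second order in `1 / r` -/

/-- All coefficients have the property `P`. -/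
def EachCoeff {R : Type*} (P : (Pt → R) → Prop) (t : Pt → Trunc R) : Prop :=
  P (fun x => (t x).c0) ∧ P (fun x => (t x).c1) ∧ P (fun x => (t x).c2)

theorem EachCoeff.congr {R : Type*} {P : (Pt → R) → Prop} {s t : Pt → Trunc R}
    (hP : ∀ a b : Pt → R, a =ᶠ[far] b → P a → P b) (h : EachCoeff P s) (hst : s =ᶠ[far] t) :
    EachCoeff P t :=
  ⟨hP _ _ (hst.mono fun _ h => by simp only [h]) h.1,
    hP _ _ (hst.mono fun _ h => by simp only [h]) h.2.1,
    hP _ _ (hst.mono fun _ h => by simp only [h]) h.2.2⟩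

variable {𝕜 : Type*} [RCLike 𝕜]

/-- `f = r^n (c0 + c1 / r + c2 / r²) + o(r^(n-2))` with smooth bounded coefficients. -/
structure HasExp₀ (n : ℤ) (f : Pt → 𝕜) (t : Pt → Trunc 𝕜) : Prop where
  smooth : FarSmooth f
  smooth_coeff : EachCoeff FarSmooth t
  bdd_coeff : EachCoeff (fun a => BigO 0 a 0) t
  rem : LittleO 0 (fun x => f x - model n t x) (n - 2)

/-- `HasExp₀`, where the expansion may be differentiated `k` times. -/
def HasExp : ℕ → ℤ → (Pt → 𝕜) → (Pt → Trunc 𝕜) → Prop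
  | 0, n, f, t => HasExp₀ n f t
  | k + 1, n, f, t => HasExp₀ n f t ∧ HasExp k n (pd 0 f) (pdT 0 t) ∧
      HasExp k (n - 1) (pd 1 f) (pdr n t) ∧ HasExp k n (pd 2 f) (pdT 2 t)

section

variable {n m : ℤ} {k : ℕ} {f g : Pt → 𝕜} {s t : Pt → Trunc 𝕜}

theorem HasExp.zero_of (h : HasExp k n f t) : HasExp₀ n f t := by
  cases k with
  | zero => exact h
  | succ k => exact h.1

theorem HasExp.smooth (h : HasExp k n f t) : FarSmooth f := h.zero_of.smooth

theorem HasExp.of_succ : ∀ {n : ℤ} {f : Pt → 𝕜} {t : Pt → Trunc 𝕜},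
    HasExp (k + 1) n f t → HasExp k n f t := by
  induction k with
  | zero => exact fun h => h.1
  | succ k ih => exact fun h => ⟨h.1, ih h.2.1, ih h.2.2.1, ih h.2.2.2⟩

theorem HasExp.pd_zero (h : HasExp (k + 1) n f t) : HasExp k n (pd 0 f) (pdT 0 t) := h.2.1

theorem HasExp.pd_one (h : HasExp (k + 1) n f t) : HasExp k (n - 1) (pd 1 f) (pdr n t) := h.2.2.1

theorem HasExp.pd_two (h : HasExp (k + 1) n f t) : HasExp k n (pd 2 f) (pdT 2 t) := h.2.2.2

theorem pdT_congr (i : Fin 3) (h : s =ᶠ[far] t) : pdT i s =ᶠ[far] pdT i t := by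
  filter_upwards [eventually_far_nhds h] with x hx
  ext <;> exact pd_congr i (hx.mono fun y hy => by simp only [hy])

theorem pdr_congr (n : ℤ) (h : s =ᶠ[far] t) : pdr n s =ᶠ[far] pdr n t := by
  filter_upwards [h, pdT_congr 1 h] with x hx hy
  have h0 := congrArg Trunc.c0 hy
  have h1 := congrArg Trunc.c1 hy
  have h2 := congrArg Trunc.c2 hy
  simp only [pdT] at h0 h1 h2
  simp only [pdr, hx, h0, h1, h2]

theorem HasExp.congr : ∀ {n : ℤ} {f g : Pt → 𝕜} {s t : Pt → Trunc 𝕜},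
    HasExp k n f s → f =ᶠ[far] g → s =ᶠ[far] t → HasExp k n g t := by
  have h0 : ∀ {n : ℤ} {f g : Pt → 𝕜} {s t : Pt → Trunc 𝕜},
      HasExp₀ n f s → f =ᶠ[far] g → s =ᶠ[far] t → HasExp₀ n g t := by
    intro n f g s t h hfg hst
    refine ⟨h.smooth.congr hfg, h.smooth_coeff.congr (fun _ _ h h' => h'.congr h) hst,
      h.bdd_coeff.congr (fun _ _ h h' => h'.congr h) hst, h.rem.congr ?_⟩
    filter_upwards [hfg, hst] with x h1 h2
    simp only [model, h1, h2]
  induction k with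
  | zero => exact h0
  | succ k ih =>
    exact fun h hfg hst => ⟨h0 h.1 hfg hst, ih h.2.1 (pd_congr_far 0 hfg) (pdT_congr 0 hst),
      ih h.2.2.1 (pd_congr_far 1 hfg) (pdr_congr _ hst),
      ih h.2.2.2 (pd_congr_far 2 hfg) (pdT_congr 2 hst)⟩

theorem HasExp.congr_coeff (h : HasExp k n f s) (hst : s =ᶠ[far] t) : HasExp k n f t :=
  h.congr EventuallyEq.rfl hst

theorem HasExp.cast (h : HasExp k n f s) (hn : n = m) : HasExp k m f s := hn ▸ h

/-! #### Sums -/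

theorem pdT_add (i : Fin 3) (hs : EachCoeff FarSmooth s) (ht : EachCoeff FarSmooth t) :
    (fun x => pdT i s x + pdT i t x) =ᶠ[far] pdT i (fun x => s x + t x) := by
  obtain ⟨a0, a1, a2⟩ := hs
  obtain ⟨b0, b1, b2⟩ := ht
  filter_upwards [a0.differentiable, a1.differentiable, a2.differentiable, b0.differentiable,
    b1.differentiable, b2.differentiable] with x d0 d1 d2 e0 e1 e2
  ext <;> simp only [pdT, add_c0, add_c1, add_c2]
  exacts [(pd_add i d0 e0).symm, (pd_add i d1 e1).symm, (pd_add i d2 e2).symm]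

theorem pdr_add (n : ℤ) (hs : EachCoeff FarSmooth s) (ht : EachCoeff FarSmooth t) :
    (fun x => pdr n s x + pdr n t x) =ᶠ[far] pdr n (fun x => s x + t x) := by
  filter_upwards [pdT_add 1 hs ht] with x hx
  have h0 := congrArg Trunc.c0 hx
  have h1 := congrArg Trunc.c1 hx
  have h2 := congrArg Trunc.c2 hx
  simp only [pdT, add_c0, add_c1, add_c2] at h0 h1 h2
  ext <;> simp only [pdr, add_c0, add_c1, add_c2, ← h0, ← h1, ← h2, smul_add] <;> ring

theorem pdT_mul (i : Fin 3) (hs : EachCoeff FarSmooth s) (ht : EachCoeff FarSmooth t) :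
    (fun x => pdT i s x * t x + s x * pdT i t x) =ᶠ[far] pdT i (fun x => s x * t x) := by
  obtain ⟨a0, a1, a2⟩ := hs
  obtain ⟨b0, b1, b2⟩ := ht
  filter_upwards [a0.differentiable, a1.differentiable, a2.differentiable, b0.differentiable,
    b1.differentiable, b2.differentiable] with x d0 d1 d2 e0 e1 e2
  ext <;> simp only [pdT, add_c0, add_c1, add_c2, mul_c0, mul_c1, mul_c2]
  · rw [pd_mul i d0 e0]
  · rw [pd_add i (d0.fun_mul e1) (d1.fun_mul e0), pd_mul i d0 e1, pd_mul i d1 e0]; ring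
  · rw [pd_add i ((d0.fun_mul e2).fun_add (d1.fun_mul e1)) (d2.fun_mul e0),
      pd_add i (d0.fun_mul e2) (d1.fun_mul e1), pd_mul i d0 e2, pd_mul i d1 e1, pd_mul i d2 e0]
    ring

theorem pdr_mul (n m : ℤ) (hs : EachCoeff FarSmooth s) (ht : EachCoeff FarSmooth t) :
    (fun x => pdr n s x * t x + s x * pdr m t x) =ᶠ[far] pdr (n + m) (fun x => s x * t x) := by
  filter_upwards [pdT_mul 1 hs ht] with x hx
  have h0 := congrArg Trunc.c0 hx
  have h1 := congrArg Trunc.c1 hx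
  have h2 := congrArg Trunc.c2 hx
  simp only [pdT, add_c0, add_c1, add_c2, mul_c0, mul_c1, mul_c2] at h0 h1 h2
  ext <;> simp only [pdr, add_c0, add_c1, add_c2, mul_c0, mul_c1, mul_c2, ← h0, ← h1, ← h2,
    RCLike.real_smul_eq_coe_mul, Int.cast_add] <;> ring

theorem HasExp.add : ∀ {n : ℤ} {f g : Pt → 𝕜} {s t : Pt → Trunc 𝕜}, HasExp k n f s →
    HasExp k n g t → HasExp k n (fun x => f x + g x) (fun x => s x + t x) := by
  have h0 : ∀ {n : ℤ} {f g : Pt → 𝕜} {s t : Pt → Trunc 𝕜}, HasExp₀ n f s →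
      HasExp₀ n g t → HasExp₀ n (fun x => f x + g x) (fun x => s x + t x) := by
    intro n f g s t h h'
    have hr := h.rem
    have hr' := h'.rem
    obtain ⟨a0, a1, a2⟩ := h.smooth_coeff
    obtain ⟨b0, b1, b2⟩ := h'.smooth_coeff
    obtain ⟨p0, p1, p2⟩ := h.bdd_coeff
    obtain ⟨q0, q1, q2⟩ := h'.bdd_coeff
    refine ⟨h.smooth.add h'.smooth, ⟨a0.add b0, a1.add b1, a2.add b2⟩,
      ⟨p0.add a0 b0 q0, p1.add a1 b1 q1, p2.add a2 b2 q2⟩, ?_⟩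
    rw [littleO_zero_iff] at hr hr' ⊢
    intro K hK
    refine ((hr K hK).add (hr' K hK)).congr_left fun x => ?_
    simp only [model, add_c0, add_c1, add_c2, smul_add]
    ring
  induction k with
  | zero => exact h0
  | succ k ih =>
    intro n f g s t h h'
    have sf := h.1.smooth.differentiable
    have sg := h'.1.smooth.differentiable
    have key : ∀ i, (fun x => pd i f x + pd i g x) =ᶠ[far] pd i (fun x => f x + g x) := by
      intro i
      filter_upwards [sf, sg] with x h1 h2 using (pd_add i h1 h2).symm
    have keyT := fun i => pdT_add i h.1.smooth_coeff h'.1.smooth_coeff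
    have keyr := pdr_add n h.1.smooth_coeff h'.1.smooth_coeff
    exact ⟨h0 h.1 h'.1, (ih h.2.1 h'.2.1).congr (key 0) (keyT 0),
      (ih h.2.2.1 h'.2.2.1).congr (key 1) keyr, (ih h.2.2.2 h'.2.2.2).congr (key 2) (keyT 2)⟩

/-! #### Products -/

/-- The coefficients are bounded, and r^(n-1), r^(n-2) are dominated by r^n. -/
theorem HasExp₀.isBigO (h : HasExp₀ n f t) {K : Set Bdy} (hK : IsCompact K) :
    (f =O[farOn K] fun x => (x 1) ^ n) ∧ model n t =O[farOn K] fun x => (x 1) ^ n := by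
  have hb := h.bdd_coeff
  have hr := h.rem
  obtain ⟨p0, p1, p2⟩ := hb
  rw [bigO_zero_iff] at p0 p1 p2
  rw [littleO_zero_iff] at hr
  have term : ∀ {a : Pt → 𝕜} {j : ℤ}, j ≤ n → (a =O[farOn K] fun x => (x 1) ^ (0 : ℤ)) →
      (fun x => (x 1) ^ j • a x) =O[farOn K] fun x => (x 1) ^ n := by
    intro a j hj ha
    have h1 := ((isBigO_zpow hj).mono (farOn_le K)).smul ha
    simpa using h1
  have hm : model n t =O[farOn K] fun x => (x 1) ^ n :=
    ((term le_rfl (p0 K hK)).add (term (by omega) (p1 K hK))).add (term (by omega) (p2 K hK))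
  refine ⟨?_, hm⟩
  have := ((hr K hK).isBigO.trans ((isBigO_zpow (by omega)).mono (farOn_le K))).add hm
  exact this.congr_left fun x => by ring

/-- With F and G the models of f and g, fg - FG = f(g - G) + (f - F)G is small by the remainder
estimates. FG differs from the model of the truncated product by terms of relative orders r^(-3) and
r^(-4). -/
theorem HasExp₀.mul (h : HasExp₀ n f s) (h' : HasExp₀ m g t) :
    HasExp₀ (n + m) (fun x => f x * g x) (fun x => s x * t x) := by
  have hr := h.rem
  have hr' := h'.rem
  obtain ⟨a0, a1, a2⟩ := h.smooth_coeff
  obtain ⟨b0, b1, b2⟩ := h'.smooth_coeff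
  obtain ⟨p0, p1, p2⟩ := h.bdd_coeff
  obtain ⟨q0, q1, q2⟩ := h'.bdd_coeff
  have bmul : ∀ {a b : Pt → 𝕜}, BigO 0 a 0 → BigO 0 b 0 → BigO 0 (fun x => a x * b x) 0 := by
    intro a b ha hb
    rw [bigO_zero_iff] at ha hb ⊢
    exact fun K hK => ((ha K hK).mul (hb K hK)).congr_right fun x => by simp
  refine ⟨h.smooth.mul h'.smooth,
    ⟨a0.mul b0, (a0.mul b1).add (a1.mul b0), ((a0.mul b2).add (a1.mul b1)).add (a2.mul b0)⟩,
    ⟨bmul p0 q0, BigO.add (a0.mul b1) (a1.mul b0) (bmul p0 q1) (bmul p1 q0),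
      BigO.add ((a0.mul b2).add (a1.mul b1)) (a2.mul b0)
        (BigO.add (a0.mul b2) (a1.mul b1) (bmul p0 q2) (bmul p1 q1)) (bmul p2 q0)⟩, ?_⟩
  -- The coefficients of ε³ and ε⁴, which the multiplication in `Trunc` discards.
  have c1 := BigO.add (a1.mul b2) (a2.mul b1) (bmul p1 q2) (bmul p2 q1)
  have c2 := bmul p2 q2
  rw [littleO_zero_iff] at hr hr' ⊢
  rw [bigO_zero_iff] at c1 c2
  intro K hK
  have pos := farOn_le K eventually_far_pos
  have e1 : (fun x => f x * (g x - model m t x)) =o[farOn K] fun x => (x 1) ^ (n + m - 2) := by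
    refine ((h.isBigO hK).1.mul_isLittleO (hr' K hK)).congr' EventuallyEq.rfl ?_
    filter_upwards [pos] with x hx
    rw [← zpow_add₀ hx.ne']; congr 1; ring
  have e2 : (fun x => (f x - model n s x) * model m t x) =o[farOn K]
      fun x => (x 1) ^ (n + m - 2) := by
    refine ((hr K hK).mul_isBigO (h'.isBigO hK).2).congr' EventuallyEq.rfl ?_
    filter_upwards [pos] with x hx
    rw [← zpow_add₀ hx.ne']; congr 1; ring
  have term : ∀ {a : Pt → 𝕜} {j : ℤ}, j < n + m - 2 → (a =O[farOn K] fun x => (x 1) ^ (0 : ℤ)) →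
      (fun x => (x 1) ^ j • a x) =o[farOn K] fun x => (x 1) ^ (n + m - 2) := by
    intro a j hj ha
    have h1 := ((isLittleO_zpow hj).mono (farOn_le K)).smul_isBigO ha
    simpa using h1
  have e3 := term (j := n + m - 3) (by omega) (c1 K hK)
  have e4 := term (j := n + m - 4) (by omega) (c2 K hK)
  refine (((e1.add e2).add e3).add e4).congr' ?_ EventuallyEq.rfl
  filter_upwards [pos] with x hx
  have hx' := hx.ne'
  have w : ∀ j : ℤ, (x 1) ^ (n + m - j) = (x 1) ^ n * (x 1) ^ m * ((x 1)⁻¹) ^ j := by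
    intro j; rw [zpow_sub₀ hx', zpow_add₀ hx', inv_zpow]; rfl
  have w1 : ∀ (p j : ℤ), (x 1) ^ (p - j) = (x 1) ^ p * ((x 1)⁻¹) ^ j := by
    intro p j; rw [zpow_sub₀ hx', inv_zpow]; rfl
  have w0 : (x 1) ^ (n + m) = (x 1) ^ n * (x 1) ^ m := zpow_add₀ hx' _ _
  simp only [model, mul_c0, mul_c1, mul_c2, w, w0, w1, RCLike.real_smul_eq_coe_mul, RCLike.ofReal_mul,
    RCLike.ofReal_zpow, RCLike.ofReal_inv, zpow_one]
  have z2 : ∀ z : 𝕜, z ^ (2 : ℤ) = z * z := fun z => by rw [zpow_ofNat]; ring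
  have z3 : ∀ z : 𝕜, z ^ (3 : ℤ) = z * z * z := fun z => by rw [zpow_ofNat]; ring
  have z4 : ∀ z : 𝕜, z ^ (4 : ℤ) = z * z * z * z := fun z => by rw [zpow_ofNat]; ring
  simp only [z2, z3, z4]
  ring

theorem HasExp.mul : ∀ {n m : ℤ} {f g : Pt → 𝕜} {s t : Pt → Trunc 𝕜}, HasExp k n f s →
    HasExp k m g t → HasExp k (n + m) (fun x => f x * g x) (fun x => s x * t x) := by
  induction k with
  | zero => exact HasExp₀.mul
  | succ k ih =>
    intro n m f g s t h h'
    have sf := h.1.smooth.differentiable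
    have sg := h'.1.smooth.differentiable
    have key : ∀ i, (fun x => pd i f x * g x + f x * pd i g x) =ᶠ[far]
        pd i (fun x => f x * g x) := by
      intro i
      filter_upwards [sf, sg] with x h1 h2 using (pd_mul i h1 h2).symm
    have keyT := fun i => pdT_mul i h.1.smooth_coeff h'.1.smooth_coeff
    have keyr := pdr_mul n m h.1.smooth_coeff h'.1.smooth_coeff
    have hs := h.of_succ
    have hs' := h'.of_succ
    refine ⟨h.1.mul h'.1, ((ih h.2.1 hs').add (ih hs h'.2.1)).congr (key 0) (keyT 0), ?_,
      ((ih h.2.2.2 hs').add (ih hs h'.2.2.2)).congr (key 2) (keyT 2)⟩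
    exact (((ih h.2.2.1 hs').cast (by ring)).add ((ih hs h'.2.2.1).cast (by ring))).congr
      (key 1) keyr

end

end

section

open Asymptotics AdSCharges.Trunc

/-! ### Expansions that may be differentiated: remainders, change of weight, inverses -/

section

variable {𝕜 : Type*} [RCLike 𝕜] {n m : ℤ} {k : ℕ} {f g : Pt → 𝕜} {s t : Pt → Trunc 𝕜}

theorem bigO_const (c : 𝕜) : BigO k (fun _ => c) 0 :=
  bigO_proj (a := fun _ => c) contDiff_const

theorem BigO.mul : ∀ {n m : ℤ} {f g : Pt → 𝕜}, FarSmooth f → FarSmooth g → BigO k f n → BigO k g m →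
    BigO k (fun x => f x * g x) (n + m) := by
  have h0 : ∀ {n m : ℤ} {f g : Pt → 𝕜}, BigO 0 f n → BigO 0 g m →
      BigO 0 (fun x => f x * g x) (n + m) := by
    intro n m f g h h'
    rw [bigO_zero_iff] at h h' ⊢
    intro K hK
    refine ((h K hK).mul (h' K hK)).congr' EventuallyEq.rfl ?_
    filter_upwards [farOn_le K eventually_far_pos] with x hx
    rw [zpow_add₀ hx.ne']
  induction k with
  | zero => exact fun _ _ => h0
  | succ k ih =>
    intro n m f g su sf h h'
    have hu := h.of_succ
    have hf := h'.of_succ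
    have key : ∀ i, (fun x => pd i f x * g x + f x * pd i g x) =ᶠ[far] pd i (fun x => f x * g x) := by
      intro i
      filter_upwards [su.differentiable, sf.differentiable] with x h1 h2 using (pd_mul i h1 h2).symm
    rw [BigO] at h h' ⊢
    refine ⟨h0 h.1 h'.1, ?_, ?_, ?_⟩
    · exact (BigO.add ((su.pd 0).mul sf) (su.mul (sf.pd 0)) (ih (su.pd 0) sf h.2.1 hf)
        (ih su (sf.pd 0) hu h'.2.1)).congr (key 0)
    · refine (BigO.add ((su.pd 1).mul sf) (su.mul (sf.pd 1)) ?_ ?_).congr (key 1)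
      · have := ih (su.pd 1) sf h.2.2.1 hf
        rwa [show n - 1 + m = n + m - 1 by ring] at this
      · have := ih su (sf.pd 1) hu h'.2.2.1
        rwa [show n + (m - 1) = n + m - 1 by ring] at this
    · exact (BigO.add ((su.pd 2).mul sf) (su.mul (sf.pd 2)) (ih (su.pd 2) sf h.2.2.2 hf)
        (ih su (sf.pd 2) hu h'.2.2.2)).congr (key 2)

theorem farSmooth_r : FarSmooth (fun x : Pt => x 1) := by
  simpa using farSmooth_zpow 1

theorem EachCoeff.pdT (h : EachCoeff FarSmooth t) (i : Fin 3) : EachCoeff FarSmooth (pdT i t) :=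
  ⟨h.1.pd i, h.2.1.pd i, h.2.2.pd i⟩

theorem EachCoeff.pdr (h : EachCoeff FarSmooth t) (n : ℤ) : EachCoeff FarSmooth (pdr n t) :=
  ⟨((farSmooth_const _).mul h.1).add (farSmooth_r.smul (h.1.pd 1)),
    ((farSmooth_const _).mul h.2.1).add (farSmooth_r.smul (h.2.1.pd 1)),
    ((farSmooth_const _).mul h.2.2).add (farSmooth_r.smul (h.2.2.pd 1))⟩

theorem pd_model_of_ne {i : Fin 3} (hi : i ≠ 1) (h : EachCoeff FarSmooth t) (n : ℤ) :
    pd i (model n t) =ᶠ[far] model n (pdT i t) := by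
  filter_upwards [eventually_far_pos, h.1.differentiable, h.2.1.differentiable,
    h.2.2.differentiable, (farSmooth_zpow n).differentiable, (farSmooth_zpow (n - 1)).differentiable,
    (farSmooth_zpow (n - 2)).differentiable] with x hx d0 d1 d2 e0 e1 e2
  unfold model
  rw [pd_add i ((e0.fun_smul d0).fun_add (e1.fun_smul d1)) (e2.fun_smul d2),
    pd_add i (e0.fun_smul d0) (e1.fun_smul d1), pd_smul i e0 d0, pd_smul i e1 d1, pd_smul i e2 d2,
    pd_zpow i _ hx, pd_zpow i _ hx, pd_zpow i _ hx]
  simp [hi, pdT]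

/-- ∂_r(r^j c) = r^(j-1)(j c + r ∂_r c). The operator r ∂_r preserves boundedness, which is why
`pdr` carries the factor r instead of a bare radial derivative. -/
theorem pd_model_one (h : EachCoeff FarSmooth t) (n : ℤ) :
    pd 1 (model n t) =ᶠ[far] model (n - 1) (pdr n t) := by
  filter_upwards [eventually_far_pos, h.1.differentiable, h.2.1.differentiable,
    h.2.2.differentiable, (farSmooth_zpow n).differentiable, (farSmooth_zpow (n - 1)).differentiable,
    (farSmooth_zpow (n - 2)).differentiable] with x hx d0 d1 d2 e0 e1 e2
  unfold model
  rw [pd_add 1 ((e0.fun_smul d0).fun_add (e1.fun_smul d1)) (e2.fun_smul d2),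
    pd_add 1 (e0.fun_smul d0) (e1.fun_smul d1), pd_smul 1 e0 d0, pd_smul 1 e1 d1, pd_smul 1 e2 d2,
    pd_zpow 1 _ hx, pd_zpow 1 _ hx, pd_zpow 1 _ hx]
  have w : ∀ j : ℤ, (x 1) ^ j = (x 1) ^ (j - 1) * x 1 := fun j => by
    rw [← zpow_add_one₀ hx.ne']; congr 1; ring
  have w0 := w n
  have w1 := w (n - 1)
  have w2 := w (n - 2)
  rw [show n - 1 - 2 = n - 2 - 1 by ring]
  simp only [if_true, pdr, RCLike.real_smul_eq_coe_mul]
  have c0 : (((x 1) ^ n : ℝ) : 𝕜) = (((x 1) ^ (n - 1) : ℝ) : 𝕜) * ((x 1 : ℝ) : 𝕜) := by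
    rw [← RCLike.ofReal_mul, ← w0]
  have c1 : (((x 1) ^ (n - 1) : ℝ) : 𝕜) = (((x 1) ^ (n - 1 - 1) : ℝ) : 𝕜) * ((x 1 : ℝ) : 𝕜) := by
    rw [← RCLike.ofReal_mul, ← w1]
  have c2 : (((x 1) ^ (n - 2) : ℝ) : 𝕜) = (((x 1) ^ (n - 2 - 1) : ℝ) : 𝕜) * ((x 1 : ℝ) : 𝕜) := by
    rw [← RCLike.ofReal_mul, ← w2]
  rw [c0, c2]
  generalize hA : (((x 1) ^ (n - 1) : ℝ) : 𝕜) = A at *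
  generalize hB : (((x 1) ^ (n - 1 - 1) : ℝ) : 𝕜) = B at *
  push_cast
  simp only [← RCLike.ofReal_zpow, hA, hB]
  rw [c1]
  ring

theorem farSmooth_model (h : EachCoeff FarSmooth t) (n : ℤ) : FarSmooth (model n t) :=
  (((farSmooth_zpow n).smul h.1).add ((farSmooth_zpow _).smul h.2.1)).add
    ((farSmooth_zpow _).smul h.2.2)

/-- `HasExp` asks for an expansion of each derivative separately. Since differentiation maps models
to models, one differentiable estimate of the remainder provides all of them; `HasExp.littleO` is
the way back. -/
theorem HasExp.of_littleO : ∀ {n : ℤ} {f : Pt → 𝕜} {t : Pt → Trunc 𝕜}, FarSmooth f →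
    EachCoeff FarSmooth t → EachCoeff (fun a => BigO k a 0) t →
    LittleO k (fun x => f x - model n t x) (n - 2) → HasExp k n f t := by
  induction k with
  | zero => exact fun h1 h2 h3 h4 => ⟨h1, h2, h3, h4⟩
  | succ k ih =>
    intro n f t sf st bt h
    have sm := farSmooth_model st n
    have key : ∀ i, pd i (fun x => f x - model n t x) =ᶠ[far]
        fun x => pd i f x - pd i (model n t) x := by
      intro i
      filter_upwards [sf.differentiable, sm.differentiable] with x h1 h2 using pd_sub i h1 h2
    -- Boundedness of the coefficients of `pdr`: ∂_r lowers the order by one and the factor r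
    -- restores it.
    have b1 : ∀ {a : Pt → 𝕜} (z : ℤ), FarSmooth a → BigO (k + 1) a 0 →
        BigO k (fun x => (z : 𝕜) * a x + (x 1 : ℝ) • pd 1 a x) 0 := by
      intro a z sa ha
      have h1 := BigO.mul (farSmooth_const (z : 𝕜)) sa (bigO_const (k := k) (z : 𝕜)) ha.of_succ
      have h2 : BigO k (fun x : Pt => x 1) 1 := by simpa using bigO_zpow (k := k) 1 1
      rw [BigO] at ha
      have h3 := BigO.smul farSmooth_r (sa.pd 1) h2 ha.2.2.1
      exact BigO.add ((farSmooth_const _).mul sa) (farSmooth_r.smul (sa.pd 1)) (by simpa using h1)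
        (by simpa using h3)
    have b2 : ∀ {a : Pt → 𝕜}, BigO (k + 1) a 0 → BigO k (pd 0 a) 0 ∧ BigO k (pd 2 a) 0 := by
      intro a ha
      rw [BigO] at ha
      exact ⟨ha.2.1, ha.2.2.2⟩
    rw [LittleO] at h
    refine ⟨⟨sf, st, ⟨bt.1.zero_of, bt.2.1.zero_of, bt.2.2.zero_of⟩, h.1⟩, ?_, ?_, ?_⟩
    · refine ih (sf.pd 0) (st.pdT 0) ⟨(b2 bt.1).1, (b2 bt.2.1).1, (b2 bt.2.2).1⟩ (h.2.1.congr ?_)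
      filter_upwards [key 0, pd_model_of_ne (by decide : (0 : Fin 3) ≠ 1) st n] with x h1 h2
      rw [h1, h2]
    · refine ih (sf.pd 1) (st.pdr n) ⟨b1 n st.1 bt.1, ?_, ?_⟩ ?_
      · simpa [Trunc.pdr] using b1 (n - 1) st.2.1 bt.2.1
      · simpa [Trunc.pdr] using b1 (n - 2) st.2.2 bt.2.2
      · have := h.2.2.1
        rw [show n - 2 - 1 = n - 1 - 2 by ring] at this
        refine this.congr ?_
        filter_upwards [key 1, pd_model_one st n] with x h1 h2
        rw [h1, h2]
    · refine ih (sf.pd 2) (st.pdT 2) ⟨(b2 bt.1).2, (b2 bt.2.1).2, (b2 bt.2.2).2⟩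
        (h.2.2.2.congr ?_)
      filter_upwards [key 2, pd_model_of_ne (by decide : (2 : Fin 3) ≠ 1) st n] with x h1 h2
      rw [h1, h2]

theorem HasExp.littleO : ∀ {n : ℤ} {f : Pt → 𝕜} {t : Pt → Trunc 𝕜}, HasExp k n f t →
    LittleO k (fun x => f x - model n t x) (n - 2) := by
  induction k with
  | zero => exact fun h => HasExp₀.rem h
  | succ k ih =>
    intro n f t h
    have sf := h.1.smooth
    have st := h.1.smooth_coeff
    have sm := farSmooth_model st n
    have key : ∀ i, (fun x => pd i f x - pd i (model n t) x) =ᶠ[far]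
        pd i (fun x => f x - model n t x) := by
      intro i
      filter_upwards [sf.differentiable, sm.differentiable] with x h1 h2 using (pd_sub i h1 h2).symm
    rw [LittleO]
    refine ⟨h.1.rem, (ih h.2.1).congr ?_, ?_, (ih h.2.2.2).congr ?_⟩
    · filter_upwards [key 0, pd_model_of_ne (by decide : (0 : Fin 3) ≠ 1) st n] with x h1 h2
      rw [← h1, h2]
    · have := ih h.2.2.1
      rw [show n - 1 - 2 = n - 2 - 1 by ring] at this
      refine this.congr ?_
      filter_upwards [key 1, pd_model_one st n] with x h1 h2
      rw [← h1, h2]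
    · filter_upwards [key 2, pd_model_of_ne (by decide : (2 : Fin 3) ≠ 1) st n] with x h1 h2
      rw [← h1, h2]

/-- Only r^(n-2) c2 is left of the model, and c2 is bounded. The vanishing of c0 and c1 passes to
derivatives because `pdT` and `pdr` act on each coefficient separately. -/
theorem HasExp.bigO : ∀ {n : ℤ} {f : Pt → 𝕜} {t : Pt → Trunc 𝕜}, HasExp k n f t →
    (∀ᶠ x in far, (t x).c0 = 0 ∧ (t x).c1 = 0) → BigO k f (n - 2) := by
  have h0 : ∀ {n : ℤ} {f : Pt → 𝕜} {t : Pt → Trunc 𝕜}, HasExp₀ n f t →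
      (∀ᶠ x in far, (t x).c0 = 0 ∧ (t x).c1 = 0) → BigO 0 f (n - 2) := by
    intro n f t h hz
    have hr := h.rem
    have hb := h.bdd_coeff.2.2
    rw [littleO_zero_iff] at hr
    rw [bigO_zero_iff] at hb ⊢
    intro K hK
    have h1 := ((isBigO_refl (fun x : Pt => (x 1) ^ (n - 2)) (farOn K)).smul (hb K hK))
    have h2 := (hr K hK).isBigO.add (g := fun x : Pt => (x 1) ^ (n - 2)) (by simpa using h1)
    refine h2.congr' ?_ EventuallyEq.rfl
    filter_upwards [farOn_le K hz] with x hx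
    simp [model, hx.1, hx.2]
  induction k with
  | zero => exact h0
  | succ k ih =>
    intro n f t h hz
    have hzT : ∀ i, ∀ᶠ x in far, (pdT i t x).c0 = 0 ∧ (pdT i t x).c1 = 0 := by
      intro i
      filter_upwards [pdT_congr (s := t) (t := fun x => ⟨0, 0, (t x).c2⟩) i
        (hz.mono fun x hx => by ext <;> simp [hx.1, hx.2])] with x hx
      rw [hx]; simp [pdT, pd_const]
    have hzr : ∀ᶠ x in far, (pdr n t x).c0 = 0 ∧ (pdr n t x).c1 = 0 := by
      filter_upwards [pdr_congr (s := t) (t := fun x => ⟨0, 0, (t x).c2⟩) n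
        (hz.mono fun x hx => by ext <;> simp [hx.1, hx.2])] with x hx
      rw [hx]; simp [pdr, pd_const]
    rw [BigO]
    refine ⟨h0 h.1 hz, ih h.2.1 (hzT 0), ?_, ih h.2.2.2 (hzT 2)⟩
    have := ih h.2.2.1 hzr
    rwa [show n - 1 - 2 = n - 2 - 1 by ring] at this

/-! #### Further operations -/

theorem HasExp.coeff {a : Pt → 𝕜} (ha : FarSmooth a) (hb : BigO k a 0) :
    HasExp k 0 a (fun x => const (a x)) := by
  have z : FarSmooth (fun _ : Pt => (0 : 𝕜)) := farSmooth_const 0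
  have zb : BigO k (fun _ : Pt => (0 : 𝕜)) 0 := BigO.of_zero k 0
  refine HasExp.of_littleO ha ⟨ha, z, z⟩ ⟨hb, zb, zb⟩ ?_
  convert LittleO.of_zero (E := 𝕜) k (0 - 2) using 2
  simp [model, const]

theorem HasExp.const (c : 𝕜) : HasExp k 0 (fun _ => c) (fun _ => const c) :=
  HasExp.coeff (farSmooth_const c) (bigO_const c)

theorem HasExp.zero (n : ℤ) : HasExp k n (fun _ => (0 : 𝕜)) (fun _ => 0) := by
  have z : FarSmooth (fun _ : Pt => (0 : 𝕜)) := farSmooth_const 0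
  have zb : BigO k (fun _ : Pt => (0 : 𝕜)) 0 := BigO.of_zero k 0
  refine HasExp.of_littleO z ⟨z, z, z⟩ ⟨zb, zb, zb⟩ ?_
  convert LittleO.of_zero (E := 𝕜) k (n - 2) using 2
  simp [model]

theorem HasExp.const_mul (c : 𝕜) (h : HasExp k n f t) :
    HasExp k n (fun x => c * f x) (fun x => Trunc.const c * t x) :=
  ((HasExp.const c).mul h).cast (zero_add n)

theorem HasExp.neg (h : HasExp k n f t) : HasExp k n (fun x => -f x) (fun x => -t x) := by
  refine (h.const_mul (-1)).congr (.of_forall fun x => by simp) (.of_forall fun x => ?_)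
  ext <;> simp [Trunc.const]

theorem HasExp.sub (h : HasExp k n f s) (h' : HasExp k n g t) :
    HasExp k n (fun x => f x - g x) (fun x => s x - t x) := by
  simpa only [sub_eq_add_neg] using h.add h'.neg

theorem HasExp.sum {ι : Type*} (S : Finset ι) {F : ι → Pt → 𝕜} {u : ι → Pt → Trunc 𝕜}
    (h : ∀ i ∈ S, HasExp k n (F i) (u i)) :
    HasExp k n (fun x => ∑ i ∈ S, F i x) (fun x => ∑ i ∈ S, u i x) := by
  classical
  induction S using Finset.induction_on with
  | empty => simpa using HasExp.zero n
  | insert a S ha ih =>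
    simp only [Finset.sum_insert ha]
    exact (h a (Finset.mem_insert_self a S)).add
      (ih fun i hi => h i (Finset.mem_insert_of_mem hi))

/-- The same function read at a higher weight: the term r^(n-2) c2 becomes part of the remainder.
This makes it possible to add functions of different weights. -/
theorem HasExp.shift : ∀ {n : ℤ} {f : Pt → 𝕜} {t : Pt → Trunc 𝕜}, HasExp k n f t →
    HasExp k (n + 1) f (fun x => (t x).shift) := by
  have h0 : ∀ {n : ℤ} {f : Pt → 𝕜} {t : Pt → Trunc 𝕜}, HasExp₀ n f t →
      HasExp₀ (n + 1) f (fun x => (t x).shift) := by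
    intro n f t h
    have hr := h.rem
    have hb := h.bdd_coeff
    refine ⟨h.smooth, ⟨farSmooth_const 0, h.smooth_coeff.1, h.smooth_coeff.2.1⟩,
      ⟨BigO.of_zero _ _, hb.1, hb.2.1⟩, ?_⟩
    have hc := hb.2.2
    rw [littleO_zero_iff] at hr ⊢
    rw [bigO_zero_iff] at hc
    intro K hK
    have l : (fun x : Pt => (x 1) ^ (n - 2)) =o[farOn K] fun x => (x 1) ^ (n + 1 - 2) :=
      (isLittleO_zpow (by omega)).mono (farOn_le K)
    have h1 := (hr K hK).trans l
    have h2 := l.smul_isBigO (hc K hK)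
    refine (h1.add (g := fun x : Pt => (x 1) ^ (n + 1 - 2)) (by simpa using h2)).congr_left
      fun x => ?_
    simp only [model, Trunc.shift, smul_zero, show n + 1 - 1 = n by ring,
      show n + 1 - 2 = n - 1 by ring]
    ring
  induction k with
  | zero => exact h0
  | succ k ih =>
    intro n f t h
    refine ⟨h0 h.1, (ih h.2.1).congr_coeff (.of_forall fun x => ?_), ?_,
      (ih h.2.2.2).congr_coeff (.of_forall fun x => ?_)⟩
    · ext <;> simp [Trunc.shift, pdT, pd_const]
    · refine ((ih h.2.2.1).cast (by ring)).congr_coeff (.of_forall fun x => ?_)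
      ext
      · simp [Trunc.shift, pdr, pd_const]
      · simp [Trunc.shift, pdr]
      · simp only [Trunc.shift, pdr]; push_cast; ring
    · ext <;> simp [Trunc.shift, pdT, pd_const]

/-- Let M be the model of the formal inverse. The product rule gives f M = 1 + o(r^(-2)); hence |f
M| ≥ 1/2 eventually, so 1/f is O(r^(-n)), and 1/f - M = -(f M - 1)/f is o(r^(-n-2)). -/
theorem HasExp₀.inv (h : HasExp₀ n f t) (hf : ∀ᶠ x in far, f x ≠ 0) (ht : ∀ᶠ x in far, (t x).c0 ≠ 0)
    (hb : BigO 0 (fun x => (t x).c0⁻¹) 0) :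
    HasExp₀ (-n) (fun x => (f x)⁻¹) (fun x => (t x).inv) := by
  have st := h.smooth_coeff
  have bt := h.bdd_coeff
  have s0 := st.1.inv ht
  have bmul : ∀ {a b : Pt → 𝕜}, BigO 0 a 0 → BigO 0 b 0 → BigO 0 (fun x => a x * b x) 0 := by
    intro a b ha hb
    rw [bigO_zero_iff] at ha hb ⊢
    exact fun K hK => ((ha K hK).mul (hb K hK)).congr_right fun x => by simp
  have bneg : ∀ {a : Pt → 𝕜}, BigO 0 a 0 → BigO 0 (fun x => -a x) 0 := by
    intro a ha
    rw [bigO_zero_iff] at ha ⊢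
    exact fun K hK => (ha K hK).neg_left
  have si : EachCoeff FarSmooth (fun x => (t x).inv) :=
    ⟨s0, st.2.1.neg.mul (s0.mul s0),
      ((st.2.1.mul st.2.1).mul ((s0.mul s0).mul s0)).sub (st.2.2.mul (s0.mul s0))⟩
  have bi : EachCoeff (fun a => BigO 0 a 0) (fun x => (t x).inv) := by
    refine ⟨hb, bmul (bneg bt.2.1) (bmul hb hb), ?_⟩
    have h1 := bmul (bmul bt.2.1 bt.2.1) (bmul (bmul hb hb) hb)
    have h2 := bmul bt.2.2 (bmul hb hb)
    refine bigO_zero_iff.2 fun K hK => ?_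
    rw [bigO_zero_iff] at h1 h2
    exact (h1 K hK).sub (h2 K hK)
  refine ⟨h.smooth.inv hf, si, bi, ?_⟩
  -- A model is its own expansion with zero remainder, so the product rule applies to f times the
  -- model.
  have hM : HasExp₀ (-n) (model (-n) (fun x => (t x).inv)) (fun x => (t x).inv) := by
    refine ⟨farSmooth_model si _, si, bi, ?_⟩
    simpa using LittleO.of_zero (E := 𝕜) 0 (-n - 2)
  have hp := h.mul hM
  have hr := hp.rem
  rw [littleO_zero_iff] at hr ⊢
  intro K hK
  set M := model (-n) (fun x => (t x).inv)
  have e1 : (fun x => f x * M x - 1) =o[farOn K] fun x => (x 1) ^ (-2 : ℤ) := by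
    have := hr K hK
    rw [add_neg_cancel] at this
    refine this.congr' ?_ EventuallyEq.rfl
    filter_upwards [farOn_le K ht] with x hx
    have : t x * (t x).inv = 1 := by
      ext <;> simp [Trunc.inv] <;> field_simp <;> ring
    simp [model, this]
  have e2 : ∀ᶠ x in farOn K, ‖f x * M x - 1‖ ≤ 1 / 2 := by
    filter_upwards [e1.bound (by norm_num : (0 : ℝ) < 1 / 2), farOn_le K (eventually_far_gt 1)]
      with x hx h1
    refine hx.trans ?_
    have hpos : 0 < x 1 := lt_trans one_pos h1
    rw [Real.norm_of_nonneg (zpow_pos hpos _).le]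
    have : (x 1) ^ (-2 : ℤ) ≤ 1 := by
      rw [zpow_neg, zpow_ofNat]
      exact inv_le_one_of_one_le₀ (one_le_pow₀ h1.le)
    linarith
  have e3 : (fun x => (f x)⁻¹) =O[farOn K] fun x => (x 1) ^ (-n) := by
    refine IsBigO.trans ?_ (hM.isBigO hK).1
    refine IsBigO.of_bound 2 ?_
    filter_upwards [e2, farOn_le K hf] with x hx h0
    have h1 : 1 / 2 ≤ ‖f x * M x‖ := by
      have := norm_sub_norm_le (1 : 𝕜) (f x * M x)
      rw [norm_sub_rev, norm_one] at this
      linarith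
    rw [norm_mul] at h1
    rw [norm_inv, inv_le_iff_one_le_mul₀ (norm_pos_iff.2 h0)]
    linarith
  have e4 := (e3.mul_isLittleO e1).neg_left
  refine e4.congr' ?_ ?_
  · filter_upwards [farOn_le K hf] with x hx
    rw [mul_sub, inv_mul_cancel_left₀ hx]
    simp [M]
  · filter_upwards [farOn_le K eventually_far_pos] with x hx
    rw [← zpow_add₀ hx.ne']; rfl

theorem mul_inv_of_ne {s : Trunc 𝕜} (h : s.c0 ≠ 0) : s * s.inv = 1 := by
  ext <;> simp [Trunc.inv] <;> field_simp <;> ring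

/-- The coefficients of the derivatives need no computation: `pdT` and `pdr` obey the Leibniz rule,
so differentiating t · t⁻¹ = 1 in `Trunc` determines the derivative of the inverse. -/
theorem HasExp.inv : ∀ {n : ℤ} {f : Pt → 𝕜} {t : Pt → Trunc 𝕜}, HasExp k n f t →
    (∀ᶠ x in far, f x ≠ 0) → (∀ᶠ x in far, (t x).c0 ≠ 0) → BigO 0 (fun x => (t x).c0⁻¹) 0 →
    HasExp k (-n) (fun x => (f x)⁻¹) (fun x => (t x).inv) := by
  induction k with
  | zero => exact fun h h1 h2 h3 => HasExp₀.inv h h1 h2 h3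
  | succ k ih =>
    intro n f t h hf ht hb
    have hi := ih h.of_succ hf ht hb
    have hb0 := h.1.inv hf ht hb
    have hq := hi.mul hi
    have key : ∀ i, (fun x => -(pd i f x * ((f x)⁻¹ * (f x)⁻¹))) =ᶠ[far]
        pd i (fun x => (f x)⁻¹) := by
      intro i
      filter_upwards [h.smooth.differentiable, hf] with x h1 h2 using (pd_inv i h1 h2).symm
    have one : ∀ᶠ x in far, t x * (t x).inv = 1 := ht.mono fun x hx => mul_inv_of_ne hx
    -- Here b is the inverse of a, and p, q are their derivatives.
    have alg : ∀ {a b p q : Trunc 𝕜}, a * b = 1 → p * b + a * q = 0 → -(p * (b * b)) = q := by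
      intro a b p q h1 h2
      linear_combination (-b) * h2 + q * h1
    have keyT : ∀ i, (fun x => -(pdT i t x * ((t x).inv * (t x).inv))) =ᶠ[far]
        pdT i (fun x => (t x).inv) := by
      intro i
      filter_upwards [pdT_mul i h.1.smooth_coeff hb0.smooth_coeff, pdT_congr i one, one]
        with x h1 h2 h3
      refine alg h3 ?_
      rw [h1, h2]
      ext <;> simp [pdT, pd_const]
    have keyr : (fun x => -(pdr n t x * ((t x).inv * (t x).inv))) =ᶠ[far]
        pdr (-n) (fun x => (t x).inv) := by
      filter_upwards [pdr_mul n (-n) h.1.smooth_coeff hb0.smooth_coeff, pdr_congr (n + -n) one, one]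
        with x h1 h2 h3
      refine alg h3 ?_
      rw [h1, h2]
      ext <;> simp [pdr, pd_const]
    exact ⟨hb0, ((h.2.1.mul hq).neg.cast (by ring)).congr (key 0) (keyT 0),
      ((h.2.2.1.mul hq).neg.cast (by ring)).congr (key 1) keyr,
      ((h.2.2.2.mul hq).neg.cast (by ring)).congr (key 2) (keyT 2)⟩

end

/-- The metric is real, but the modes of the symmetries and the variations they induce are complex.
-/
theorem HasExp.ofReal {k : ℕ} : ∀ {n : ℤ} {f : Pt → ℝ} {t : Pt → Trunc ℝ}, HasExp k n f t →
    HasExp k n (fun x => (f x : ℂ)) (fun x => (t x).map Complex.ofReal) := by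
  have b : ∀ {a : Pt → ℝ} {n : ℤ}, BigO 0 a n → BigO 0 (fun x => (a x : ℂ)) n := by
    intro a n ha
    rw [bigO_zero_iff] at ha ⊢
    exact fun K hK => (isBigO_norm_left.1 (by simpa using (ha K hK).norm_left))
  have h0 : ∀ {n : ℤ} {f : Pt → ℝ} {t : Pt → Trunc ℝ}, HasExp₀ n f t →
      HasExp₀ n (fun x => (f x : ℂ)) (fun x => (t x).map Complex.ofReal) := by
    intro n f t h
    have hr := h.rem
    have st := h.smooth_coeff
    have bt := h.bdd_coeff
    refine ⟨h.smooth.ofReal, ⟨st.1.ofReal, st.2.1.ofReal, st.2.2.ofReal⟩,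
      ⟨b bt.1, b bt.2.1, b bt.2.2⟩, ?_⟩
    rw [littleO_zero_iff] at hr ⊢
    intro K hK
    refine isLittleO_norm_left.1 ((hr K hK).norm_left.congr_left fun x => ?_)
    rw [← Complex.norm_real]
    simp [model, Trunc.map]
  induction k with
  | zero => exact h0
  | succ k ih =>
    intro n f t h
    have st := h.1.smooth_coeff
    have key : ∀ i, (fun x => ((pd i f x : ℝ) : ℂ)) =ᶠ[far] pd i (fun x => (f x : ℂ)) := by
      intro i
      filter_upwards [h.1.smooth.differentiable] with x h1 using (pd_ofReal i h1).symm
    have keyT : ∀ i, (fun x => (pdT i t x).map Complex.ofReal) =ᶠ[far]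
        pdT i (fun x => (t x).map Complex.ofReal) := by
      intro i
      filter_upwards [st.1.differentiable, st.2.1.differentiable, st.2.2.differentiable]
        with x h0 h1 h2
      ext <;> simp only [Trunc.map, pdT]
      exacts [(pd_ofReal i h0).symm, (pd_ofReal i h1).symm, (pd_ofReal i h2).symm]
    have keyr : (fun x => (pdr n t x).map Complex.ofReal) =ᶠ[far]
        pdr n (fun x => (t x).map Complex.ofReal) := by
      filter_upwards [keyT 1] with x hx
      have h0 := congrArg Trunc.c0 hx
      have h1 := congrArg Trunc.c1 hx
      have h2 := congrArg Trunc.c2 hx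
      simp only [pdT, Trunc.map] at h0 h1 h2
      ext <;> simp [pdr, Trunc.map, ← h0, ← h1, ← h2]
    exact ⟨h0 h.1, (ih h.2.1).congr (key 0) (keyT 0), (ih h.2.2.1).congr (key 1) keyr,
      (ih h.2.2.2).congr (key 2) (keyT 2)⟩

end

section

open Asymptotics AdSCharges.Trunc

/-! ### Expansion of the metric and its inverse -/

/-- `Trunc.shift`, applied as often as needed to pass from the weight `n` to the weight `N`. -/
def Trunc.raise {R : Type*} [CommRing R] (n N : ℤ) (s : Trunc R) : Trunc R :=
  Trunc.shift^[(N - n).toNat] s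

theorem HasExp.raise {𝕜 : Type*} [RCLike 𝕜] {n N : ℤ} {k : ℕ} {f : Pt → 𝕜} {t : Pt → Trunc 𝕜}
    (h : HasExp k n f t) (hn : n ≤ N) : HasExp k N f (fun x => Trunc.raise n N (t x)) := by
  have key : ∀ d : ℕ, HasExp k (n + d) f (fun x => Trunc.shift^[d] (t x)) := by
    intro d
    induction d with
    | zero => simpa using h
    | succ d ih =>
      refine (ih.shift.cast (by push_cast; ring)).congr_coeff (.of_forall fun x => ?_)
      exact (Function.iterate_succ_apply' _ _ _).symm
  exact (key (N - n).toNat).cast (by omega)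

theorem HasExp.up_two {𝕜 : Type*} [RCLike 𝕜] {n N : ℤ} {k : ℕ} {f : Pt → 𝕜} {t : Pt → Trunc 𝕜}
    (h : HasExp k n f t) (hn : n + 2 = N) : HasExp k N f (fun x => ⟨0, 0, (t x).c0⟩) :=
  (h.shift.shift.cast (by omega)).congr_coeff (.of_forall fun _ => rfl)

/-- Multiplication with adjustment of the weight. -/
theorem HasExp.mul_raise {𝕜 : Type*} [RCLike 𝕜] {n m N : ℤ} {k : ℕ} {f g : Pt → 𝕜}
    {s t : Pt → Trunc 𝕜} (h : HasExp k n f s) (h' : HasExp k m g t) (hn : n + m ≤ N) :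
    HasExp k N (fun x => f x * g x) (fun x => Trunc.raise (n + m) N (s x * t x)) :=
  (h.mul h').raise hn

section Metric

variable {l : ℝ} (p : PhasePoint l)

/-- The conformal factor `e^{2φ}`. -/
def PhasePoint.fac (y : Bdy) : ℝ := Real.exp (2 * p.conf y)

theorem PhasePoint.fac_pos (y : Bdy) : 0 < p.fac y := Real.exp_pos _

theorem PhasePoint.smooth_fac : ContDiff ℝ ∞ p.fac :=
  Real.contDiff_exp.comp (contDiff_const.mul p.smooth_conf)

theorem PhasePoint.exp_neg (y : Bdy) : Real.exp (-2 * p.conf y) = (p.fac y)⁻¹ := by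
  rw [PhasePoint.fac, ← Real.exp_neg]; congr 1; ring

theorem PhasePoint.pd_fac (A : Fin 2) (y : Bdy) : pd A p.fac y = 2 * p.fac y * pd A p.conf y := by
  have h1 : HasFDerivAt p.conf (fderiv ℝ p.conf y) y :=
    ((p.smooth_conf.differentiable (by simp)) y).hasFDerivAt
  have h2 := (h1.const_mul 2).exp
  have : pd A p.fac y = (Real.exp (2 * p.conf y) • (2 : ℝ) • fderiv ℝ p.conf y) (Pi.single A 1) := by
    rw [pd, ← h2.fderiv]; rfl
  rw [this, PhasePoint.fac]; simp [pd]; ring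

/-- The mixed components of the metric, multiplied by `r³`. -/
def PhasePoint.nu (A : Fin 2) (x : Pt) : ℝ := (x 1) ^ (3 : ℤ) * p.g x 1 (bIdx A)

theorem PhasePoint.farSmooth_g (a b : Fin 3) : FarSmooth (fun x => p.g x a b) :=
  farSmooth_of_contDiffOn (p.smooth_g a b)

theorem PhasePoint.farSmooth_nu (A : Fin 2) : FarSmooth (p.nu A) :=
  (farSmooth_zpow 3).mul (p.farSmooth_g _ _)

theorem PhasePoint.bigO_nu (A : Fin 2) : BigO 2 (p.nu A) 0 := by
  have h := BigO.mul (farSmooth_zpow 3) (p.farSmooth_g 1 (bIdx A))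
    (by simpa using bigO_zpow (k := 2) 1 3) (p.expand_rA A)
  exact h

theorem PhasePoint.far_mem : ∀ᶠ x in far, p.R₀ < x 1 := eventually_far_gt _

theorem PhasePoint.symm (a b : Fin 3) : ∀ᶠ x in far, p.g x a b = p.g x b a := by
  filter_upwards [p.far_mem] with x hx
  exact (p.symm_g x hx).apply b a

/-- The coefficients of the metric. -/
def PhasePoint.gT (a b : Fin 3) (x : Pt) : Trunc ℝ :=
  !![⟨-p.fac (proj x), 0, p.C (proj x) 0 0⟩, ⟨0, 0, p.nu 0 x⟩, ⟨0, 0, p.C (proj x) 0 1⟩;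
    ⟨0, 0, p.nu 0 x⟩, ⟨l ^ 2, 0, p.Crr (proj x)⟩, ⟨0, 0, p.nu 1 x⟩;
    ⟨0, 0, p.C (proj x) 0 1⟩, ⟨0, 0, p.nu 1 x⟩, ⟨p.fac (proj x), 0, p.C (proj x) 1 1⟩] a b

theorem PhasePoint.exp_g_rr : HasExp 2 (-2) (fun x => p.g x 1 1) (p.gT 1 1) := by
  refine HasExp.of_littleO (p.farSmooth_g 1 1)
    ⟨farSmooth_const _, farSmooth_const _, farSmooth_proj p.smooth_Crr⟩
    ⟨bigO_const _, bigO_const _, bigO_proj p.smooth_Crr⟩ ?_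
  refine p.expand_rr.congr (.of_forall fun x => ?_)
  simp [model, gT]; ring

/-- Only a bound on g_rA is assumed, so r³ g_rA itself is taken as the last coefficient and the
remainder is exactly zero. -/
theorem PhasePoint.exp_g_rA (A : Fin 2) :
    HasExp 2 (-1) (fun x => p.g x 1 (bIdx A)) (fun x => ⟨0, 0, p.nu A x⟩) := by
  refine HasExp.of_littleO (p.farSmooth_g 1 _)
    ⟨farSmooth_const _, farSmooth_const _, p.farSmooth_nu A⟩
    ⟨bigO_const _, bigO_const _, p.bigO_nu A⟩ ?_
  refine (LittleO.of_zero (E := ℝ) 2 (-1 - 2)).congr ?_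
  filter_upwards [eventually_far_pos] with x hx
  simp only [model, nu, smul_eq_mul, mul_zero, zero_add, ← mul_assoc]
  rw [← zpow_add₀ hx.ne']
  norm_num

theorem PhasePoint.exp_g_AB (A B : Fin 2) :
    HasExp 2 2 (fun x => p.g x (bIdx A) (bIdx B))
      (fun x => ⟨p.fac (proj x) * flat A B, 0, p.C (proj x) A B⟩) := by
  refine HasExp.of_littleO (p.farSmooth_g _ _)
    ⟨(farSmooth_proj p.smooth_fac).mul (farSmooth_const _), farSmooth_const _,
      farSmooth_proj (p.smooth_C A B)⟩
    ⟨?_, bigO_const _, bigO_proj (p.smooth_C A B)⟩ ?_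
  · exact bigO_proj (a := fun y => p.fac y * flat A B) (p.smooth_fac.mul contDiff_const)
  refine (p.expand_AB A B).congr (.of_forall fun x => ?_)
  simp [model, fac]; ring

/-- The weight of a tensor index: `1` for lower `τ`, `φ` and `-1` for lower `r`. -/
def wt : Fin 3 → ℤ := ![1, -1, 1]

/-- The parity of an index. -/
def par : Fin 3 → ℤ := ![1, 0, 1]

/-- The naive weight of g_rA is 0, while the first possible term is r^(-3). Lowering the weight by
the parity of the number of boundary indices keeps that term inside the truncation, and c1 vanishes
for all components. -/
theorem PhasePoint.exp_g (a b : Fin 3) :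
    HasExp 2 (wt a + wt b - (par a + par b) % 2) (fun x => p.g x a b) (p.gT a b) := by
  have s10 := p.symm 1 0
  have s12 := p.symm 1 2
  have s02 := p.symm 0 2
  fin_cases a <;> fin_cases b
  · refine (p.exp_g_AB 0 0).congr_coeff (.of_forall fun x => ?_)
    ext <;> simp [gT, flat]
  · refine (p.exp_g_rA 0).congr s10 (.of_forall fun x => ?_)
    ext <;> simp [gT]
  · refine (p.exp_g_AB 0 1).congr_coeff (.of_forall fun x => ?_)
    ext <;> simp [gT, flat]
  · refine (p.exp_g_rA 0).congr_coeff (.of_forall fun x => ?_)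
    ext <;> simp [gT]
  · exact p.exp_g_rr
  · refine (p.exp_g_rA 1).congr_coeff (.of_forall fun x => ?_)
    ext <;> simp [gT]
  · refine (p.exp_g_AB 0 1).congr s02 (.of_forall fun x => ?_)
    ext <;> simp [gT, flat]
  · refine (p.exp_g_rA 1).congr s12 (.of_forall fun x => ?_)
    ext <;> simp [gT]
  · refine (p.exp_g_AB 1 1).congr_coeff (.of_forall fun x => ?_)
    ext <;> simp [gT, flat]

/-- Terms containing two mixed components have weight 0 and zero leading coefficient, so they are
invisible at order r^0. The square of g_τφ is invisible as well, and only the product of the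
diagonal entries contributes. -/
theorem PhasePoint.exp_det :
    HasExp 2 2 (fun x => (p.g x).det) (fun x => ⟨-(l ^ 2 * p.fac (proj x) ^ 2), 0,
      l ^ 2 * p.fac (proj x) * (p.C (proj x) 0 0 - p.C (proj x) 1 1)
        - p.Crr (proj x) * p.fac (proj x) ^ 2⟩) := by
  have g00 := p.exp_g 0 0
  have g11 := p.exp_g 1 1
  have g22 := p.exp_g 2 2
  have g01 := p.exp_g 0 1
  have g12 := p.exp_g 1 2
  have g02 := p.exp_g 0 2
  have h1 := ((g00.mul g22).sub ((g02.mul g02).cast rfl)).mul g11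
  have h2 := ((g00.mul (g12.mul g12)).add ((g22.mul (g01.mul g01)).cast rfl)).up_two (N := 2) rfl
  have h3 := (g02.mul (g01.mul g12)).up_two (N := 2) rfl
  have h4 := ((h1.cast (m := 2) rfl).sub h2).add (h3.const_mul 2)
  refine h4.congr ?_ (.of_forall fun x => ?_)
  · filter_upwards [p.symm 1 0, p.symm 1 2, p.symm 0 2] with x s10 s12 s02
    rw [Matrix.det_fin_three, s10, s12.symm, s02.symm]
    ring
  · ext <;> simp [gT, Trunc.const] <;> ring

theorem PhasePoint.det_ne_zero : ∀ᶠ x in far, (p.g x).det ≠ 0 := by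
  filter_upwards [p.far_mem] with x hx using (p.lorentz_g x hx).ne

theorem PhasePoint.exp_det_inv (hl : l ≠ 0) :
    HasExp 2 (-2) (fun x => ((p.g x).det)⁻¹) (fun x => ⟨-(l ^ 2 * p.fac (proj x) ^ 2)⁻¹, 0,
      -(l ^ 2 * p.fac (proj x) * (p.C (proj x) 0 0 - p.C (proj x) 1 1)
        - p.Crr (proj x) * p.fac (proj x) ^ 2) * (l ^ 2 * p.fac (proj x) ^ 2)⁻¹ ^ 2⟩) := by
  have h0 : ∀ y, -(l ^ 2 * p.fac y ^ 2) ≠ 0 := fun y => by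
    have := p.fac_pos y
    exact neg_ne_zero.2 (by positivity)
  refine (p.exp_det.inv p.det_ne_zero (.of_forall fun x => h0 _) ?_).congr_coeff
    (.of_forall fun x => ?_)
  · refine bigO_proj (a := fun y => (-(l ^ 2 * p.fac y ^ 2))⁻¹) ?_
    exact ((contDiff_const.mul (p.smooth_fac.pow 2)).neg).inv h0
  · have := h0 (proj x)
    ext <;> simp [Trunc.inv] <;> ring

/-- The coefficients of the inverse metric. -/
def PhasePoint.giT (a b : Fin 3) (x : Pt) : Trunc ℝ :=
  !![⟨-(p.fac (proj x))⁻¹, 0, -((p.fac (proj x))⁻¹ ^ 2 * p.C (proj x) 0 0)⟩,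
      ⟨0, 0, (p.fac (proj x))⁻¹ * p.nu 0 x * (l ^ 2)⁻¹⟩,
      ⟨0, 0, (p.fac (proj x))⁻¹ ^ 2 * p.C (proj x) 0 1⟩;
    ⟨0, 0, (p.fac (proj x))⁻¹ * p.nu 0 x * (l ^ 2)⁻¹⟩,
      ⟨(l ^ 2)⁻¹, 0, -(p.Crr (proj x) * (l ^ 2)⁻¹ ^ 2)⟩,
      ⟨0, 0, -((p.fac (proj x))⁻¹ * p.nu 1 x * (l ^ 2)⁻¹)⟩;
    ⟨0, 0, (p.fac (proj x))⁻¹ ^ 2 * p.C (proj x) 0 1⟩,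
      ⟨0, 0, -((p.fac (proj x))⁻¹ * p.nu 1 x * (l ^ 2)⁻¹)⟩,
      ⟨(p.fac (proj x))⁻¹, 0, -((p.fac (proj x))⁻¹ ^ 2 * p.C (proj x) 1 1)⟩] a b

theorem PhasePoint.inv_eq (a b : Fin 3) (x : Pt) :
    (p.g x)⁻¹ a b = ((p.g x).det)⁻¹ * (p.g x).adjugate a b := by
  rw [Matrix.inv_def]; simp

theorem PhasePoint.inv_symm (a b : Fin 3) : ∀ᶠ x in far, (p.g x)⁻¹ a b = (p.g x)⁻¹ b a := by
  filter_upwards [p.far_mem] with x hx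
  have := (p.symm_g x hx).inv
  exact this.apply b a

/-- Cramer's rule, entry by entry; products of two mixed components again fall below the truncation
in the diagonal cofactors and in the τφ cofactor. -/
theorem PhasePoint.exp_gi (hl : l ≠ 0) (a b : Fin 3) :
    HasExp 2 (-wt a - wt b - (par a + par b) % 2) (fun x => (p.g x)⁻¹ a b) (p.giT a b) := by
  have g00 := p.exp_g 0 0
  have g11 := p.exp_g 1 1
  have g22 := p.exp_g 2 2
  have g01 := p.exp_g 0 1
  have g12 := p.exp_g 1 2
  have g02 := p.exp_g 0 2
  have hd := p.exp_det_inv hl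
  have hf : ∀ y, p.fac y ≠ 0 := fun y => (p.fac_pos y).ne'
  have sym : ∀ᶠ x in far, p.g x 1 0 = p.g x 0 1 ∧ p.g x 2 1 = p.g x 1 2 ∧ p.g x 2 0 = p.g x 0 2 := by
    filter_upwards [p.symm 1 0, p.symm 2 1, p.symm 2 0] with x h1 h2 h3 using ⟨h1, h2, h3⟩
  have e00 : HasExp 2 (-2) (fun x => (p.g x)⁻¹ 0 0) (p.giT 0 0) := by
    refine ((hd.mul (((g11.mul g22).cast (m := 0) rfl).sub
      ((g12.mul g12).up_two (N := 0) rfl))).cast (m := -2) rfl).congr ?_ (.of_forall fun x => ?_)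
    · filter_upwards [sym] with x hx
      rw [p.inv_eq, Matrix.adjugate_fin_three]
      simp [hx]
    · have := hf (proj x)
      ext <;> simp [gT, giT] <;> field_simp <;> ring
  have e22 : HasExp 2 (-2) (fun x => (p.g x)⁻¹ 2 2) (p.giT 2 2) := by
    refine ((hd.mul (((g00.mul g11).cast (m := 0) rfl).sub
      ((g01.mul g01).up_two (N := 0) rfl))).cast (m := -2) rfl).congr ?_ (.of_forall fun x => ?_)
    · filter_upwards [sym] with x hx
      rw [p.inv_eq, Matrix.adjugate_fin_three]
      simp [hx]
    · have := hf (proj x)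
      ext <;> simp [gT, giT] <;> field_simp <;> ring
  have e11 : HasExp 2 2 (fun x => (p.g x)⁻¹ 1 1) (p.giT 1 1) := by
    refine ((hd.mul ((g00.mul g22).sub ((g02.mul g02).cast rfl))).cast (m := 2) rfl).congr ?_
      (.of_forall fun x => ?_)
    · filter_upwards [sym] with x hx
      rw [p.inv_eq, Matrix.adjugate_fin_three]
      simp [hx]
    · have := hf (proj x)
      ext <;> simp [gT, giT] <;> field_simp <;> ring
  have e02 : HasExp 2 (-2) (fun x => (p.g x)⁻¹ 0 2) (p.giT 0 2) := by
    refine ((hd.mul (((g01.mul g12).up_two (N := 0) rfl).sub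
      ((g02.mul g11).cast (m := 0) rfl))).cast (m := -2) rfl).congr ?_ (.of_forall fun x => ?_)
    · filter_upwards [sym] with x hx
      rw [p.inv_eq, Matrix.adjugate_fin_three]
      simp [hx]
    · have := hf (proj x)
      ext <;> simp [gT, giT] <;> field_simp
  have e01 : HasExp 2 (-1) (fun x => (p.g x)⁻¹ 0 1) (p.giT 0 1) := by
    refine ((hd.mul ((g02.mul g12).sub ((g01.mul g22).cast rfl))).cast (m := -1) rfl).congr ?_
      (.of_forall fun x => ?_)
    · filter_upwards [sym] with x hx
      rw [p.inv_eq, Matrix.adjugate_fin_three]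
      simp only [hx]; simp; left; ring
    · have := hf (proj x)
      ext <;> simp [gT, giT] <;> field_simp
  have e12 : HasExp 2 (-1) (fun x => (p.g x)⁻¹ 1 2) (p.giT 1 2) := by
    refine ((hd.mul ((g02.mul g01).sub ((g00.mul g12).cast rfl))).cast (m := -1) rfl).congr ?_
      (.of_forall fun x => ?_)
    · filter_upwards [sym] with x hx
      rw [p.inv_eq, Matrix.adjugate_fin_three]
      simp only [hx]; simp; left; ring
    · have := hf (proj x)
      ext <;> simp [gT, giT] <;> field_simp
  fin_cases a <;> fin_cases b
  · exact e00
  · exact e01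
  · exact e02
  · exact e01.congr (p.inv_symm 0 1) (.of_forall fun x => rfl)
  · exact e11
  · exact e12
  · exact e02.congr (p.inv_symm 0 2) (.of_forall fun x => rfl)
  · exact e12.congr (p.inv_symm 1 2) (.of_forall fun x => rfl)
  · exact e22

end Metric

end

section

open Asymptotics AdSCharges.Trunc

/-! ### Expansion of the Christoffel symbols -/

/-- The change of the weight under `∂_c`. -/
def dw : Fin 3 → ℤ := ![0, -1, 0]

/-- The coefficients of the derivative `∂_c`. -/
def Trunc.dT {𝕜 : Type*} [RCLike 𝕜] (c : Fin 3) (n : ℤ) (t : Pt → Trunc 𝕜) : Pt → Trunc 𝕜 :=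
  if c = 1 then pdr n t else pdT c t

theorem HasExp.pd {𝕜 : Type*} [RCLike 𝕜] {n : ℤ} {k : ℕ} {f : Pt → 𝕜} {t : Pt → Trunc 𝕜}
    (h : HasExp (k + 1) n f t) (c : Fin 3) : HasExp k (n + dw c) (pd c f) (dT c n t) := by
  fin_cases c
  · exact h.pd_zero.cast (by simp [dw])
  · exact h.pd_one.cast (by simp [dw]; rfl)
  · exact h.pd_two.cast (by simp [dw])

/-- The weight of `g_ab`. -/
def nG (a b : Fin 3) : ℤ := wt a + wt b - (par a + par b) % 2

/-- The weight of `∂_a g_bc`. -/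
def n3 (a b c : Fin 3) : ℤ := wt a + wt b + wt c - (par a + par b + par c) % 2

/-- The weight of `Γ^a_bc`. -/
def nChr (a b c : Fin 3) : ℤ := -wt a + wt b + wt c - (par a + par b + par c) % 2

section

variable {l : ℝ} (p : PhasePoint l)

/-- The coefficients of `∂_c g_ab`. -/
def PhasePoint.dgT (c a b : Fin 3) (x : Pt) : Trunc ℝ :=
  Trunc.raise (nG a b + dw c) (n3 c a b) (dT c (nG a b) (p.gT a b) x)

theorem PhasePoint.exp_dg (c a b : Fin 3) :
    HasExp 1 (n3 c a b) (pd c (fun x => p.g x a b)) (p.dgT c a b) :=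
  ((p.exp_g a b).pd c).raise (by revert a b c; decide)

/-- The coefficients of `Γ^a_bc`. -/
def PhasePoint.chrT (a b c : Fin 3) (x : Pt) : Trunc ℝ :=
  const (1 / 2) * ∑ e, Trunc.raise (-wt a - wt e - (par a + par e) % 2 + n3 b e c) (nChr a b c)
    (p.giT a e x * (p.dgT b e c x + p.dgT c e b x - p.dgT e b c x))

theorem PhasePoint.exp_chr_aux (hl : l ≠ 0) (a b c : Fin 3) :
    HasExp 1 (nChr a b c) (christoffel p.g a b c) (p.chrT a b c) := by
  refine HasExp.const_mul _ (HasExp.sum _ fun e _ => ?_)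
  refine (p.exp_gi hl a e).of_succ.mul_raise
    (((p.exp_dg b e c).add ((p.exp_dg c e b).cast ?_)).sub ((p.exp_dg e b c).cast ?_)) ?_
  all_goals revert a b c e; decide

theorem PhasePoint.differentiable_fac : Differentiable ℝ p.fac :=
  p.smooth_fac.differentiable (by simp)

theorem PhasePoint.differentiable_C (A B : Fin 2) : Differentiable ℝ (fun y => p.C y A B) :=
  (p.smooth_C A B).differentiable (by simp)

theorem PhasePoint.differentiable_Crr : Differentiable ℝ p.Crr :=
  p.smooth_Crr.differentiable (by simp)

/-- `r ∂_r` of the rescaled mixed components of the metric. -/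
def PhasePoint.dnu (A : Fin 2) (x : Pt) : ℝ := x 1 * pd 1 (p.nu A) x

/-- The table of the coefficients of `∂_c g_ab`. -/
def PhasePoint.dgTab (c a b : Fin 3) (x : Pt) : Trunc ℝ :=
  ![!![⟨-(2 * p.fac (proj x) * pd 0 p.conf (proj x)), 0, pd 0 (fun y => p.C y 0 0) (proj x)⟩, 0,
        ⟨0, 0, pd 0 (fun y => p.C y 0 1) (proj x)⟩;
      0, ⟨0, 0, pd 0 p.Crr (proj x)⟩, 0;
      ⟨0, 0, pd 0 (fun y => p.C y 0 1) (proj x)⟩, 0,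
        ⟨2 * p.fac (proj x) * pd 0 p.conf (proj x), 0, pd 0 (fun y => p.C y 1 1) (proj x)⟩],
    !![⟨-(2 * p.fac (proj x)), 0, 0⟩, ⟨0, 0, p.dnu 0 x - 3 * p.nu 0 x⟩, 0;
      ⟨0, 0, p.dnu 0 x - 3 * p.nu 0 x⟩, ⟨-(2 * l ^ 2), 0, -(4 * p.Crr (proj x))⟩,
        ⟨0, 0, p.dnu 1 x - 3 * p.nu 1 x⟩;
      0, ⟨0, 0, p.dnu 1 x - 3 * p.nu 1 x⟩, ⟨2 * p.fac (proj x), 0, 0⟩],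
    !![⟨-(2 * p.fac (proj x) * pd 1 p.conf (proj x)), 0, pd 1 (fun y => p.C y 0 0) (proj x)⟩, 0,
        ⟨0, 0, pd 1 (fun y => p.C y 0 1) (proj x)⟩;
      0, ⟨0, 0, pd 1 p.Crr (proj x)⟩, 0;
      ⟨0, 0, pd 1 (fun y => p.C y 0 1) (proj x)⟩, 0,
        ⟨2 * p.fac (proj x) * pd 1 p.conf (proj x), 0, pd 1 (fun y => p.C y 1 1) (proj x)⟩]] c a b

/-- The zero entries include ∂_A g_rB, which `Trunc.raise` pushes beyond the truncation. Of the
mixed components only the radial derivative survives. -/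
theorem PhasePoint.dgT_eq (c a b : Fin 3) (x : Pt) : p.dgT c a b x = p.dgTab c a b x := by
  have hf := p.differentiable_fac
  have hr := p.differentiable_Crr
  have h00 := p.differentiable_C 0 0
  have h01 := p.differentiable_C 0 1
  have h11 := p.differentiable_C 1 1
  fin_cases c <;> fin_cases a <;> fin_cases b <;>
    ext <;>
    simp [dgT, dgTab, Trunc.raise, nG, n3, dw, wt, par, dT, pdT, pdr, gT, Trunc.shift, dnu,
      pd_proj_zero hf, pd_proj_one hf, pd_proj_two hf, pd_proj_zero hr, pd_proj_one hr,
      pd_proj_two hr, pd_proj_zero h00, pd_proj_one h00, pd_proj_two h00, pd_proj_zero h01,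
      pd_proj_one h01, pd_proj_two h01, pd_proj_zero h11, pd_proj_one h11, pd_proj_two h11,
      pd_const, pd_neg, PhasePoint.pd_fac] <;> try ring

end

end

section

open Asymptotics AdSCharges.Trunc

section

variable {l : ℝ} (p : PhasePoint l)

/-- The table of the coefficients of `Γ^a_bc`. -/
def PhasePoint.chrTab (a b c : Fin 3) (x : Pt) : Trunc ℝ :=
  ![!![⟨pd 0 p.conf (proj x), 0, (p.chrT 0 0 0 x).c2⟩,
        ⟨1, 0, (p.fac (proj x))⁻¹ * p.C (proj x) 0 0⟩,
        ⟨pd 1 p.conf (proj x), 0, (p.chrT 0 0 2 x).c2⟩;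
      ⟨1, 0, (p.fac (proj x))⁻¹ * p.C (proj x) 0 0⟩,
        ⟨0, 0, -((p.fac (proj x))⁻¹ * (p.dnu 0 x - 2 * p.nu 0 x - 1 / 2 * pd 0 p.Crr (proj x)))⟩,
        ⟨0, 0, (p.fac (proj x))⁻¹ * p.C (proj x) 0 1⟩;
      ⟨pd 1 p.conf (proj x), 0, (p.chrT 0 0 2 x).c2⟩,
        ⟨0, 0, (p.fac (proj x))⁻¹ * p.C (proj x) 0 1⟩,
        ⟨pd 0 p.conf (proj x), 0, (p.chrT 0 2 2 x).c2⟩],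
    !![⟨p.fac (proj x) * (l ^ 2)⁻¹, 0, -(p.fac (proj x) * (l ^ 2)⁻¹ ^ 2 * p.Crr (proj x))⟩,
        ⟨0, 0, (l ^ 2)⁻¹ * (1 / 2 * pd 0 p.Crr (proj x) - p.nu 0 x)⟩, 0;
      ⟨0, 0, (l ^ 2)⁻¹ * (1 / 2 * pd 0 p.Crr (proj x) - p.nu 0 x)⟩,
        ⟨-1, 0, -(p.Crr (proj x) * (l ^ 2)⁻¹)⟩,
        ⟨0, 0, (l ^ 2)⁻¹ * (1 / 2 * pd 1 p.Crr (proj x) - p.nu 1 x)⟩;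
      0, ⟨0, 0, (l ^ 2)⁻¹ * (1 / 2 * pd 1 p.Crr (proj x) - p.nu 1 x)⟩,
        ⟨-(p.fac (proj x) * (l ^ 2)⁻¹), 0, p.fac (proj x) * (l ^ 2)⁻¹ ^ 2 * p.Crr (proj x)⟩],
    !![⟨pd 1 p.conf (proj x), 0, (p.chrT 2 0 0 x).c2⟩,
        ⟨0, 0, -((p.fac (proj x))⁻¹ * p.C (proj x) 0 1)⟩,
        ⟨pd 0 p.conf (proj x), 0, (p.chrT 2 0 2 x).c2⟩;
      ⟨0, 0, -((p.fac (proj x))⁻¹ * p.C (proj x) 0 1)⟩,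
        ⟨0, 0, (p.fac (proj x))⁻¹ * (p.dnu 1 x - 2 * p.nu 1 x - 1 / 2 * pd 1 p.Crr (proj x))⟩,
        ⟨1, 0, -((p.fac (proj x))⁻¹ * p.C (proj x) 1 1)⟩;
      ⟨pd 0 p.conf (proj x), 0, (p.chrT 2 0 2 x).c2⟩,
        ⟨1, 0, -((p.fac (proj x))⁻¹ * p.C (proj x) 1 1)⟩,
        ⟨pd 1 p.conf (proj x), 0, (p.chrT 2 2 2 x).c2⟩]] a b c

-- The second-order coefficients of Γ^A_BC are left unevaluated in the table: they cancel from the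
-- Ricci components used later or lie below the order needed there.
set_option maxHeartbeats 2000000 in
theorem PhasePoint.chrT_eq (hl : l ≠ 0) (a b c : Fin 3) (x : Pt) :
    p.chrT a b c x = p.chrTab a b c x := by
  have hf : p.fac (proj x) ≠ 0 := (p.fac_pos _).ne'
  fin_cases a <;> fin_cases b <;> fin_cases c <;>
    simp only [chrTab, chrT, PhasePoint.dgT_eq, Fin.sum_univ_three, dgTab] <;>
    simp [nChr, n3, wt, par, Trunc.raise, giT, Trunc.shift, const, mk_add_mk, mk_sub_mk, neg_mk,
      mk_mul_mk, mk_eq_zero] <;>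
    (try constructorm* _ ∧ _) <;> (try field_simp) <;> (try ring)

theorem PhasePoint.exp_chr (hl : l ≠ 0) (a b c : Fin 3) :
    HasExp 1 (nChr a b c) (christoffel p.g a b c) (p.chrTab a b c) :=
  (p.exp_chr_aux hl a b c).congr_coeff (.of_forall (p.chrT_eq hl a b c))

end

end

section

open Asymptotics AdSCharges.Trunc

/-! ### Expansion of Einstein's equations -/

section

variable {l : ℝ} (p : PhasePoint l)

/-- The coefficients of the Ricci tensor. -/
def PhasePoint.ricT (b c : Fin 3) (x : Pt) : Trunc ℝ :=
  ∑ a, (Trunc.raise (nChr a b c + dw a) (nG b c) (dT a (nChr a b c) (p.chrTab a b c) x)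
    - Trunc.raise (nChr a b a + dw c) (nG b c) (dT c (nChr a b a) (p.chrTab a b a) x)
    + ∑ e, (Trunc.raise (nChr a a e + nChr e b c) (nG b c) (p.chrTab a a e x * p.chrTab e b c x)
      - Trunc.raise (nChr a c e + nChr e b a) (nG b c) (p.chrTab a c e x * p.chrTab e b a x)))

theorem PhasePoint.exp_ricci (hl : l ≠ 0) (b c : Fin 3) :
    HasExp 0 (nG b c) (ricci p.g b c) (p.ricT b c) := by
  have h := fun a b c => (p.exp_chr hl a b c)
  have h' := fun a b c => (p.exp_chr hl a b c).of_succ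
  refine HasExp.sum _ fun a _ => HasExp.add (HasExp.sub ?_ ?_) (HasExp.sum _ fun e _ => HasExp.sub ?_ ?_)
  · exact ((h a b c).pd a).raise (by revert a b c; decide)
  · exact ((h a b a).pd c).raise (by revert a b c; decide)
  · exact (h' a a e).mul_raise (h' e b c) (by revert a b c e; decide)
  · exact (h' a c e).mul_raise (h' e b a) (by revert a b c e; decide)

/-- Over a single boundary point, r^(n-2) a(y) is o(r^(n-2)), which forces a(y) = 0. This is how
bulk equations turn into boundary equations. -/
theorem HasExp.coeff_eq_zero {n : ℤ} {f : Pt → ℝ} {a : Bdy → ℝ} {t : Pt → Trunc ℝ}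
    (h : HasExp 0 n f t) (ht : ∀ᶠ x in far, t x = ⟨0, 0, a (AdSCharges.proj x)⟩)
    (hf : f =ᶠ[far] fun _ => 0) (y : Bdy) : a y = 0 := by
  have h1 := (h.congr hf ht).littleO
  rw [littleO_zero_iff] at h1
  have h2 := h1 {y} isCompact_singleton
  by_contra hy
  have h3 := h2.bound (show 0 < ‖a y‖ / 2 by positivity)
  obtain ⟨R, hR⟩ := eventually_farOn.1 h3
  -- A point over y with positive radius beyond the threshold for the tolerance ‖a y‖ / 2.
  let x : Pt := ![y 0, max R 0 + 1, y 1]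
  have hx : AdSCharges.proj x = y := by
    funext A; fin_cases A <;> simp [AdSCharges.proj, bIdx, x]
  have hr : 0 < x 1 := by
    have := le_max_right R 0
    simp [x]; linarith
  have h4 := hR x (by simp [hx]) (by
    have := le_max_left R 0
    simp [x]; linarith)
  have hz := zpow_pos hr (n - 2)
  simp only [model, hx, smul_eq_mul, mul_zero, zero_add, zero_sub, norm_neg, norm_mul,
    Real.norm_of_nonneg hz.le] at h4
  have h5 : 0 < ‖a y‖ := norm_pos_iff.2 hy
  nlinarith [mul_pos hz h5]

/-- In three dimensions the trace of the field equations gives scalar curvature -6/l², so the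
equations become R_ab = -(2/l²) g_ab. -/
theorem OnShell.ricci_eq {p : PhasePoint l} (hp : OnShell p) (b c : Fin 3) :
    (fun x => ricci p.g b c x + 2 / l ^ 2 * p.g x b c) =ᶠ[far] fun _ => 0 := by
  filter_upwards [p.far_mem] with x hx
  have h := hp x hx
  have hu : IsUnit (p.g x).det := isUnit_iff_ne_zero.2 (p.lorentz_g x hx).ne
  have htr : ∑ a, ∑ b, (p.g x)⁻¹ a b * p.g x a b = 3 := by
    have h1 : ((p.g x)⁻¹ * p.g x).trace = 3 := by
      rw [Matrix.nonsing_inv_mul _ hu]; simp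
    rw [← h1, Matrix.trace]
    refine Finset.sum_congr rfl fun a _ => ?_
    rw [Matrix.diag_apply, Matrix.mul_apply]
    exact Finset.sum_congr rfl fun b _ => by rw [(p.symm_g x hx).apply]
  have hs : scalarCurv p.g x - 1 / 2 * scalarCurv p.g x * 3 - 1 / l ^ 2 * 3 = 0 := by
    have h2 : ∑ a, ∑ b, (p.g x)⁻¹ a b * (ricci p.g a b x - (1 / 2) * scalarCurv p.g x * p.g x a b
        - (1 / l ^ 2) * p.g x a b) = 0 := by
      simp only [h, mul_zero, Finset.sum_const_zero]
    rw [← h2, ← htr, scalarCurv]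
    simp only [Finset.mul_sum, ← Finset.sum_sub_distrib]
    refine Finset.sum_congr rfl fun a _ => Finset.sum_congr rfl fun b _ => ?_
    ring
  linear_combination h b c - p.g x b c * hs

theorem PhasePoint.smooth_pd_conf (A : Fin 2) : ContDiff ℝ ∞ (pd A p.conf) :=
  contDiff_pd A p.smooth_conf

theorem PhasePoint.smooth_fac_inv : ContDiff ℝ ∞ (fun y => (p.fac y)⁻¹) :=
  p.smooth_fac.inv fun y => (p.fac_pos y).ne'

theorem PhasePoint.pd_fac_inv_mul (A B D : Fin 2) (y : Bdy) :
    pd A (fun y => (p.fac y)⁻¹ * p.C y B D) y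
      = (p.fac y)⁻¹ * (pd A (fun y => p.C y B D) y - 2 * pd A p.conf y * p.C y B D) := by
  have hf : p.fac y ≠ 0 := (p.fac_pos y).ne'
  rw [pd_mul A ((p.smooth_fac_inv.differentiable (by simp)) y) (p.differentiable_C B D y),
    pd_inv A (p.differentiable_fac y) hf, p.pd_fac]
  field_simp
  ring

theorem Trunc.dT_zero (n : ℤ) (t : Pt → Trunc ℝ) : dT 0 n t = pdT 0 t := rfl

theorem Trunc.dT_one (n : ℤ) (t : Pt → Trunc ℝ) : dT 1 n t = pdr n t := rfl

theorem Trunc.dT_two (n : ℤ) (t : Pt → Trunc ℝ) : dT 2 n t = pdT 2 t := rfl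

/-- The r² terms cancel against the cosmological term. What survives at order r^0 is the wave
operator on φ and a multiple of ρ. -/
theorem PhasePoint.ricT_zero_zero (hl : l ≠ 0) (x : Pt) :
    p.ricT 0 0 x + const (2 / l ^ 2) * p.gT 0 0 x = ⟨0, 0, -pd 0 (pd 0 p.conf) (proj x)
      + pd 1 (pd 1 p.conf) (proj x) - p.fac (proj x) * (l ^ 2)⁻¹
        * ((p.fac (proj x))⁻¹ * (-p.C (proj x) 0 0 + p.C (proj x) 1 1)
          + (l ^ 2)⁻¹ * p.Crr (proj x))⟩ := by
  have hf : p.fac (proj x) ≠ 0 := (p.fac_pos _).ne'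
  -- An opaque name keeps the simplifier from rewriting this constant before the precomputed
  -- derivatives have been matched.
  obtain ⟨li, hli⟩ : ∃ li, li = (l ^ 2)⁻¹ := ⟨_, rfl⟩
  have d0 : Differentiable ℝ (pd 0 p.conf) := (p.smooth_pd_conf 0).differentiable (by simp)
  have d1 : Differentiable ℝ (pd 1 p.conf) := (p.smooth_pd_conf 1).differentiable (by simp)
  have e1 : Differentiable ℝ (fun y => p.fac y * li) := p.differentiable_fac.mul_const _
  have e2 : Differentiable ℝ (fun y => p.fac y * li ^ 2 * p.Crr y) :=
    (p.differentiable_fac.mul_const _).mul p.differentiable_Crr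
  have e1' := pd_proj_one e1 x
  have e2' := pd_proj_one e2 x
  simp only [ricT, Fin.sum_univ_three, div_eq_mul_inv, gT, Trunc.dT_zero, Trunc.dT_one,
    Trunc.dT_two, pdT, pdr, chrTab, ← hli]
  ext <;>
  simp [nChr, nG, dw, wt, par, Trunc.raise, Trunc.shift, const,
    pd_proj_zero d0, pd_proj_two d1, pd_const, pd_neg, e1', e2'] <;>
  (try subst hli) <;> (try field_simp) <;> (try ring)

/-- At order r^(-3) all contributions of g_rA and of its radial derivative cancel, so these
components yield equations between C, C_rr and φ alone. -/
theorem PhasePoint.ricT_one (hl : l ≠ 0) {x : Pt} (hν : ∀ A, DifferentiableAt ℝ (p.nu A) x) :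
    p.ricT 1 0 x + const (2 / l ^ 2) * p.gT 1 0 x = ⟨0, 0, (l ^ 2)⁻¹ / 2 * pd 0 p.Crr (proj x)
      + (p.fac (proj x))⁻¹ * (pd 0 (fun y => p.C y 1 1) (proj x)
        - pd 1 (fun y => p.C y 0 1) (proj x) - pd 0 p.conf (proj x)
          * (-p.C (proj x) 0 0 + p.C (proj x) 1 1))⟩ ∧
    p.ricT 1 2 x + const (2 / l ^ 2) * p.gT 1 2 x = ⟨0, 0, (l ^ 2)⁻¹ / 2 * pd 1 p.Crr (proj x)
      + (p.fac (proj x))⁻¹ * (-pd 1 (fun y => p.C y 0 0) (proj x)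
        + pd 0 (fun y => p.C y 0 1) (proj x) - pd 1 p.conf (proj x)
          * (-p.C (proj x) 0 0 + p.C (proj x) 1 1))⟩ := by
  have hf : p.fac (proj x) ≠ 0 := (p.fac_pos _).ne'
  obtain ⟨li, hli⟩ : ∃ li, li = (l ^ 2)⁻¹ := ⟨_, rfl⟩
  have dC : ∀ A B, Differentiable ℝ (fun y => (p.fac y)⁻¹ * p.C y A B) := fun A B =>
    (p.smooth_fac_inv.mul (p.smooth_C A B)).differentiable (by simp)
  have hC := fun A B D => p.pd_fac_inv_mul A B D (proj x)
  have dr : Differentiable ℝ (fun y => p.Crr y * li) := p.differentiable_Crr.mul_const _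
  have hr : ∀ A, pd A (fun y => p.Crr y * li) (proj x) = pd A p.Crr (proj x) * li := fun A => by
    rw [pd_mul A (p.differentiable_Crr _) (differentiableAt_const _), pd_const]; ring
  have hR : ∀ A, pd 1 (fun y => li * (1 / 2 * pd A p.Crr (proj y) - p.nu A y)) x
      = -(li * pd 1 (p.nu A) x) := by
    intro A
    have dR : Differentiable ℝ (pd A p.Crr) :=
      (contDiff_pd A p.smooth_Crr).differentiable (by simp)
    have h1 : DifferentiableAt ℝ (fun y => pd A p.Crr (proj y)) x :=
      (dR _).comp x ((contDiff_proj.differentiable (by simp)) x)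
    rw [pd_mul 1 (differentiableAt_const _) ((h1.const_mul _).fun_sub (hν A)), pd_const,
      pd_sub 1 (h1.const_mul _) (hν A), pd_mul 1 (differentiableAt_const _) h1, pd_const,
      pd_proj_one dR]
    ring
  have hR0 := hR 0
  have hR1 := hR 1
  have c00 := pd_proj_zero (dC 0 0) x
  have c01 := pd_proj_zero (dC 0 1) x
  have c11 := pd_proj_zero (dC 1 1) x
  have c00' := pd_proj_two (dC 0 0) x
  have c01' := pd_proj_two (dC 0 1) x
  have c11' := pd_proj_two (dC 1 1) x
  have r0 := pd_proj_zero dr x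
  have r2 := pd_proj_two dr x
  rw [hr] at r0 r2
  rw [hC] at c00 c01 c11 c00' c01' c11'
  constructor <;>
  simp only [ricT, Fin.sum_univ_three, div_eq_mul_inv, gT, Trunc.dT_zero, Trunc.dT_one,
    Trunc.dT_two, pdT, pdr, chrTab, ← hli] <;>
  simp only [div_eq_mul_inv] at hR0 hR1 <;>
  ext <;>
  simp [nChr, nG, dw, wt, par, Trunc.raise, const, pd_const, pd_neg] <;>
  simp at hR0 hR1 <;>
  (try simp only [hR0, hR1, c01, c11, c00', c01', r0, r2, dnu]) <;>
  (try subst hli) <;> (try field_simp) <;> (try ring)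

theorem PhasePoint.rho_eq (y : Bdy) :
    (p.fac y)⁻¹ * (-p.C y 0 0 + p.C y 1 1) + (l ^ 2)⁻¹ * p.Crr y = 0 := by
  have h := p.rho_eq_zero y
  simp only [Fin.sum_univ_two, p.exp_neg, flat] at h
  simp at h
  rw [← h]; ring

/-- The derivative of the constraint ρ = 0, in the form that eliminates ∂C_rr from the rA equations.
-/
theorem PhasePoint.pd_rho_eq (A : Fin 2) (y : Bdy) :
    (p.fac y)⁻¹ * (-pd A (fun y => p.C y 0 0) y + pd A (fun y => p.C y 1 1) y)
      - 2 * pd A p.conf y * ((p.fac y)⁻¹ * (-p.C y 0 0 + p.C y 1 1))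
      + (l ^ 2)⁻¹ * pd A p.Crr y = 0 := by
  have h0 : pd A (fun y => (p.fac y)⁻¹ * p.C y 1 1 - (p.fac y)⁻¹ * p.C y 0 0
      + (l ^ 2)⁻¹ * p.Crr y) y = 0 := by
    have : (fun y => (p.fac y)⁻¹ * p.C y 1 1 - (p.fac y)⁻¹ * p.C y 0 0 + (l ^ 2)⁻¹ * p.Crr y)
        = fun _ => 0 := by
      funext z; rw [← p.rho_eq z]; ring
    rw [this, pd_const]
  have dC : ∀ A B, DifferentiableAt ℝ (fun y => (p.fac y)⁻¹ * p.C y A B) y := fun A B =>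
    (p.smooth_fac_inv.mul (p.smooth_C A B)).differentiable (by simp) y
  have dr := p.differentiable_Crr y
  rw [pd_add A ((dC 1 1).fun_sub (dC 0 0)) (dr.const_mul _), pd_sub A (dC 1 1) (dC 0 0),
    p.pd_fac_inv_mul, p.pd_fac_inv_mul, pd_mul A (differentiableAt_const _) dr, pd_const] at h0
  rw [← h0]; ring

variable {p}

theorem OnShell.wave_conf (hl : l ≠ 0) (hp : OnShell p) (y : Bdy) :
    pd 1 (pd 1 p.conf) y = pd 0 (pd 0 p.conf) y := by
  have h := ((p.exp_ricci hl 0 0).add ((p.exp_g 0 0).of_succ.of_succ.const_mul (2 / l ^ 2)))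
  have h1 := h.coeff_eq_zero (a := fun y => -pd 0 (pd 0 p.conf) y
      + pd 1 (pd 1 p.conf) y - p.fac y * (l ^ 2)⁻¹
        * ((p.fac y)⁻¹ * (-p.C y 0 0 + p.C y 1 1) + (l ^ 2)⁻¹ * p.Crr y))
    (.of_forall fun x => p.ricT_zero_zero hl x) (hp.ricci_eq 0 0) y
  rw [p.rho_eq y] at h1
  linarith

theorem OnShell.conserved (hl : l ≠ 0) (hp : OnShell p) (y : Bdy) :
    pd 0 (fun y => p.C y 0 0) y + pd 0 (fun y => p.C y 1 1) y
      = 2 * pd 1 (fun y => p.C y 0 1) y ∧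
    pd 1 (fun y => p.C y 0 0) y + pd 1 (fun y => p.C y 1 1) y
      = 2 * pd 0 (fun y => p.C y 0 1) y := by
  have hν : ∀ᶠ x in far, ∀ A, DifferentiableAt ℝ (p.nu A) x := by
    filter_upwards [(p.farSmooth_nu 0).differentiable, (p.farSmooth_nu 1).differentiable]
      with x h0 h1 A
    fin_cases A
    exacts [h0, h1]
  have h0 := ((p.exp_ricci hl 1 0).add ((p.exp_g 1 0).of_succ.of_succ.const_mul (2 / l ^ 2)))
  have h2 := ((p.exp_ricci hl 1 2).add ((p.exp_g 1 2).of_succ.of_succ.const_mul (2 / l ^ 2)))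
  have h0' := h0.coeff_eq_zero (a := fun y => (l ^ 2)⁻¹ / 2 * pd 0 p.Crr y
      + (p.fac y)⁻¹ * (pd 0 (fun y => p.C y 1 1) y
        - pd 1 (fun y => p.C y 0 1) y - pd 0 p.conf y * (-p.C y 0 0 + p.C y 1 1)))
    (hν.mono fun x hx => (p.ricT_one hl hx).1) (hp.ricci_eq 1 0) y
  have h2' := h2.coeff_eq_zero (a := fun y => (l ^ 2)⁻¹ / 2 * pd 1 p.Crr y
      + (p.fac y)⁻¹ * (-pd 1 (fun y => p.C y 0 0) y
        + pd 0 (fun y => p.C y 0 1) y - pd 1 p.conf y * (-p.C y 0 0 + p.C y 1 1)))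
    (hν.mono fun x hx => (p.ricT_one hl hx).2) (hp.ricci_eq 1 2) y
  have r0 := p.pd_rho_eq 0 y
  have r1 := p.pd_rho_eq 1 y
  have hf : (p.fac y)⁻¹ ≠ 0 := inv_ne_zero (p.fac_pos y).ne'
  constructor
  · refine mul_left_cancel₀ hf ?_
    -- Subtracting ∂_τ ρ from twice the rτ equation removes both C_rr and ∂φ; only the divergence of
    -- Ξ remains.
    linear_combination 2 * h0' - r0
  · refine mul_left_cancel₀ hf ?_
    linear_combination -2 * h2' + r1

end

end

section

open Asymptotics AdSCharges.Trunc

/-! ### Expansion of the superpotential: general structure -/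

/-- The coefficients of all fields that enter the superpotential. -/
structure FieldCoeffs where
  G : Fin 3 → Fin 3 → Trunc ℂ
  Gi : Fin 3 → Fin 3 → Trunc ℂ
  Γ : Fin 3 → Fin 3 → Fin 3 → Trunc ℂ
  ξ : Fin 3 → Trunc ℂ
  dξ : Fin 3 → Fin 3 → Trunc ℂ
  h : Fin 3 → Fin 3 → Trunc ℂ
  dh : Fin 3 → Fin 3 → Fin 3 → Trunc ℂ

namespace FieldCoeffs

variable (D : FieldCoeffs)

/-- The definitions of this namespace copy the bulk formulas, with truncated series in place of
functions. -/
def covV (c a : Fin 3) : Trunc ℂ := D.dξ c a + ∑ e, D.Γ a c e * D.ξ e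

def covH (c a b : Fin 3) : Trunc ℂ :=
  D.dh c a b - ∑ e, (D.Γ e c a * D.h e b + D.Γ e c b * D.h a e)

def covVUp (m a : Fin 3) : Trunc ℂ := ∑ c, D.Gi m c * D.covV c a

def covVLow (c a : Fin 3) : Trunc ℂ := ∑ e, D.G a e * D.covV c e

def covVMix (m a : Fin 3) : Trunc ℂ := ∑ c, D.Gi m c * D.covVLow c a

def trH : Trunc ℂ := ∑ a, ∑ b, D.Gi a b * D.h a b

def covTrUp (m : Fin 3) : Trunc ℂ := ∑ c, ∑ a, ∑ b, D.Gi m c * D.Gi a b * D.covH c a b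

def hUp (a b : Fin 3) : Trunc ℂ := ∑ c, ∑ d, D.Gi a c * D.Gi b d * D.h c d

def covHUp (c a b : Fin 3) : Trunc ℂ := ∑ d, ∑ e, D.Gi a d * D.Gi b e * D.covH c d e

def covHUpUp (m a b : Fin 3) : Trunc ℂ := ∑ c, D.Gi m c * D.covHUp c a b

def bbTerm (μ ν : Fin 3) : Trunc ℂ :=
  D.ξ ν * D.covTrUp μ
    - D.ξ ν * ∑ σ, D.covHUp σ μ σ
    + ∑ σ, (∑ e, D.G σ e * D.ξ e) * D.covHUpUp ν μ σ
    + const (1 / 2) * D.trH * D.covVUp ν μ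
    + const (1 / 2) * ∑ σ, D.hUp ν σ * (D.covVMix μ σ - D.covV σ μ)

end FieldCoeffs

/-- The fields `g`, `ξ`, `h` have the coefficients `D`. -/
structure HasFieldCoeffs (g : Pt → Matrix (Fin 3) (Fin 3) ℝ) (ξ : Pt → Fin 3 → ℂ)
    (h : Pt → Matrix (Fin 3) (Fin 3) ℂ) (D : Pt → FieldCoeffs) : Prop where
  exp_G : ∀ a b, HasExp 0 (wt a + wt b) (fun x => (g x a b : ℂ)) (fun x => (D x).G a b)
  exp_Gi : ∀ a b, HasExp 0 (-wt a - wt b) (fun x => ((g x)⁻¹ a b : ℂ)) (fun x => (D x).Gi a b)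
  exp_Γ : ∀ a b c, HasExp 0 (-wt a + wt b + wt c) (fun x => (christoffel g a b c x : ℂ))
    (fun x => (D x).Γ a b c)
  exp_ξ : ∀ a, HasExp 0 (1 - wt a) (fun x => ξ x a) (fun x => (D x).ξ a)
  exp_dξ : ∀ c a, HasExp 0 (1 - wt a + wt c) (pd c (fun x => ξ x a)) (fun x => (D x).dξ c a)
  exp_h : ∀ a b, HasExp 0 (wt a + wt b) (fun x => h x a b) (fun x => (D x).h a b)
  exp_dh : ∀ c a b, HasExp 0 (wt c + wt a + wt b) (pd c (fun x => h x a b)) (fun x => (D x).dh c a b)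

namespace HasFieldCoeffs

variable {g : Pt → Matrix (Fin 3) (Fin 3) ℝ} {ξ : Pt → Fin 3 → ℂ}
    {h : Pt → Matrix (Fin 3) (Fin 3) ℂ} {D : Pt → FieldCoeffs}

/-- Without the parity correction weights are additive and contracted indices cancel, so all terms
of a tensor expression have the same weight and the expansion follows the shape of the definition.
-/
theorem covV (H : HasFieldCoeffs g ξ h D) (c a : Fin 3) :
    HasExp 0 (1 - wt a + wt c) (AdSCharges.covV g ξ c a) (fun x => (D x).covV c a) :=
  (H.exp_dξ c a).add (HasExp.sum _ fun e _ => ((H.exp_Γ a c e).mul (H.exp_ξ e)).cast (by ring))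

theorem covH (H : HasFieldCoeffs g ξ h D) (c a b : Fin 3) :
    HasExp 0 (wt c + wt a + wt b) (AdSCharges.covH g h c a b) (fun x => (D x).covH c a b) :=
  (H.exp_dh c a b).sub (HasExp.sum _ fun e _ => (((H.exp_Γ e c a).mul (H.exp_h e b)).cast (by ring)).add
    (((H.exp_Γ e c b).mul (H.exp_h a e)).cast (by ring)))

theorem covVUp (H : HasFieldCoeffs g ξ h D) (m a : Fin 3) :
    HasExp 0 (1 - wt m - wt a) (AdSCharges.covVUp g ξ m a) (fun x => (D x).covVUp m a) :=
  HasExp.sum _ fun c _ => ((H.exp_Gi m c).mul (H.covV c a)).cast (by ring)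

theorem covVLow (H : HasFieldCoeffs g ξ h D) (c a : Fin 3) :
    HasExp 0 (1 + wt c + wt a) (AdSCharges.covVLow g ξ c a) (fun x => (D x).covVLow c a) :=
  HasExp.sum _ fun e _ => ((H.exp_G a e).mul (H.covV c e)).cast (by ring)

theorem covVMix (H : HasFieldCoeffs g ξ h D) (m a : Fin 3) :
    HasExp 0 (1 - wt m + wt a) (AdSCharges.covVMix g ξ m a) (fun x => (D x).covVMix m a) :=
  HasExp.sum _ fun c _ => ((H.exp_Gi m c).mul (H.covVLow c a)).cast (by ring)

theorem trH (H : HasFieldCoeffs g ξ h D) :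
    HasExp 0 0 (AdSCharges.trH g h) (fun x => (D x).trH) :=
  HasExp.sum _ fun a _ => HasExp.sum _ fun b _ => ((H.exp_Gi a b).mul (H.exp_h a b)).cast (by ring)

theorem covTrUp (H : HasFieldCoeffs g ξ h D) (m : Fin 3) :
    HasExp 0 (-wt m) (AdSCharges.covTrUp g h m) (fun x => (D x).covTrUp m) :=
  HasExp.sum _ fun c _ => HasExp.sum _ fun a _ => HasExp.sum _ fun b _ =>
    (((H.exp_Gi m c).mul (H.exp_Gi a b)).mul (H.covH c a b)).cast (by ring)

theorem hUp (H : HasFieldCoeffs g ξ h D) (a b : Fin 3) :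
    HasExp 0 (-wt a - wt b) (AdSCharges.hUp g h a b) (fun x => (D x).hUp a b) :=
  HasExp.sum _ fun c _ => HasExp.sum _ fun d _ =>
    (((H.exp_Gi a c).mul (H.exp_Gi b d)).mul (H.exp_h c d)).cast (by ring)

theorem covHUp (H : HasFieldCoeffs g ξ h D) (c a b : Fin 3) :
    HasExp 0 (wt c - wt a - wt b) (AdSCharges.covHUp g h c a b) (fun x => (D x).covHUp c a b) :=
  HasExp.sum _ fun d _ => HasExp.sum _ fun e _ =>
    (((H.exp_Gi a d).mul (H.exp_Gi b e)).mul (H.covH c d e)).cast (by ring)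

theorem covHUpUp (H : HasFieldCoeffs g ξ h D) (m a b : Fin 3) :
    HasExp 0 (-wt m - wt a - wt b) (AdSCharges.covHUpUp g h m a b)
      (fun x => (D x).covHUpUp m a b) :=
  HasExp.sum _ fun c _ => ((H.exp_Gi m c).mul (H.covHUp c a b)).cast (by ring)

theorem bbTerm (H : HasFieldCoeffs g ξ h D) (μ ν : Fin 3) :
    HasExp 0 (1 - wt μ - wt ν) (AdSCharges.bbTerm g ξ h μ ν) (fun x => (D x).bbTerm μ ν) := by
  refine ((((HasExp.sub ?_ ?_).add ?_).add ?_).add ?_)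
  · exact ((H.exp_ξ ν).mul (H.covTrUp μ)).cast (by ring)
  · exact ((H.exp_ξ ν).mul (HasExp.sum (n := -wt μ) _ fun σ _ => (H.covHUp σ μ σ).cast (by ring))).cast
      (by ring)
  · exact HasExp.sum _ fun σ _ => ((HasExp.sum (n := 1 + wt σ) _ fun e _ =>
      ((H.exp_G σ e).mul (H.exp_ξ e)).cast (by ring)).mul (H.covHUpUp ν μ σ)).cast (by ring)
  · exact ((H.trH.const_mul _).mul (H.covVUp ν μ)).cast (by ring)
  · exact (HasExp.sum _ fun σ _ => ((H.hUp ν σ).mul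
      ((H.covVMix μ σ).sub ((H.covV σ μ).cast (by ring)))).cast (by ring)).const_mul _

end HasFieldCoeffs

end

section

open Asymptotics AdSCharges.Trunc

/-! ### Expansion of the superpotential: evaluation -/

/-- The boundary data that determine the superpotential at infinity: the metric
`f = e^{2φ}`, `p = ∂φ`, `C`, `Crr`, its variation `om`, `E`, `Err`, and the vector field
`Y`, `ps = ψ`, `Z`, with derivatives. -/
structure JetData where
  (C00 C01 C11 Crr E00 E01 E11 Err Y0 Y1 Z0 Z1 d0Y0 d0Y1 d1Y0 d1Y1 f l om om0 om1 p0 p1 ps ps0 ps1 : ℂ)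

/-- The coefficients, in terms of the boundary data. -/
def JetData.coeffs (j : JetData) : FieldCoeffs where
  G := ![![⟨-(j.f), 0, j.C00⟩, 0, ⟨0, 0, j.C01⟩],
      ![0, ⟨j.l ^ 2, 0, j.Crr⟩, 0],
      ![⟨0, 0, j.C01⟩, 0, ⟨j.f, 0, j.C11⟩]]
  Gi := ![![⟨-(j.f⁻¹), 0, -(j.C00 * j.f⁻¹ ^ 2)⟩, 0, ⟨0, 0, j.C01 * j.f⁻¹ ^ 2⟩],
      ![0, ⟨j.l⁻¹ ^ 2, 0, -(j.Crr * j.l⁻¹ ^ 4)⟩, 0],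
      ![⟨0, 0, j.C01 * j.f⁻¹ ^ 2⟩, 0, ⟨j.f⁻¹, 0, -(j.C11 * j.f⁻¹ ^ 2)⟩]]
  Γ := ![![![⟨0, j.p0, 0⟩, ⟨1, 0, j.C00 * j.f⁻¹⟩, ⟨0, j.p1, 0⟩],
      ![⟨1, 0, j.C00 * j.f⁻¹⟩, 0, ⟨0, 0, j.C01 * j.f⁻¹⟩],
      ![⟨0, j.p1, 0⟩, ⟨0, 0, j.C01 * j.f⁻¹⟩, ⟨0, j.p0, 0⟩]],
    ![![⟨j.f * j.l⁻¹ ^ 2, 0, -(j.Crr * j.f * j.l⁻¹ ^ 4)⟩, 0, 0],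
      ![0, ⟨-(1), 0, -(j.Crr * j.l⁻¹ ^ 2)⟩, 0],
      ![0, 0, ⟨-(j.f * j.l⁻¹ ^ 2), 0, j.Crr * j.f * j.l⁻¹ ^ 4⟩]],
    ![![⟨0, j.p1, 0⟩, ⟨0, 0, -(j.C01 * j.f⁻¹)⟩, ⟨0, j.p0, 0⟩],
      ![⟨0, 0, -(j.C01 * j.f⁻¹)⟩, 0, ⟨1, 0, -(j.C11 * j.f⁻¹)⟩],
      ![⟨0, j.p0, 0⟩, ⟨1, 0, -(j.C11 * j.f⁻¹)⟩, ⟨0, j.p1, 0⟩]]]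
  ξ := ![⟨j.Y0, 0, j.Z0⟩, ⟨0, -(1 / 2 * j.ps), 0⟩, ⟨j.Y1, 0, j.Z1⟩]
  dξ := ![![⟨0, j.d0Y0, 0⟩, ⟨0, 0, -(1 / 2 * j.ps0)⟩, ⟨0, j.d0Y1, 0⟩],
      ![⟨0, 0, -(2 * j.Z0)⟩, ⟨0, -(1 / 2 * j.ps), 0⟩, ⟨0, 0, -(2 * j.Z1)⟩],
      ![⟨0, j.d1Y0, 0⟩, ⟨0, 0, -(1 / 2 * j.ps1)⟩, ⟨0, j.d1Y1, 0⟩]]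
  h := ![![⟨-(2 * j.f * j.om), 0, j.E00⟩, 0, ⟨0, 0, j.E01⟩],
      ![0, ⟨0, 0, j.Err⟩, 0],
      ![⟨0, 0, j.E01⟩, 0, ⟨2 * j.f * j.om, 0, j.E11⟩]]
  dh := ![![![⟨0, -(4 * j.f * j.om * j.p0) - 2 * j.f * j.om0, 0⟩, 0, 0],
      ![0, 0, 0],
      ![0, 0, ⟨0, 4 * j.f * j.om * j.p0 + 2 * j.f * j.om0, 0⟩]],
    ![![⟨-(4 * j.f * j.om), 0, 0⟩, 0, 0],
      ![0, ⟨0, 0, -(4 * j.Err)⟩, 0],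
      ![0, 0, ⟨4 * j.f * j.om, 0, 0⟩]],
    ![![⟨0, -(4 * j.f * j.om * j.p1) - 2 * j.f * j.om1, 0⟩, 0, 0],
      ![0, 0, 0],
      ![0, 0, ⟨0, 4 * j.f * j.om * j.p1 + 2 * j.f * j.om1, 0⟩]]]

/-- Intermediate tensors are tabulated and checked one at a time, so that the final identity is a
polynomial computation of moderate size. -/
def JetData.covVTab (j : JetData) : Fin 3 → Fin 3 → Trunc ℂ :=
  ![![⟨0, j.Y0 * j.p0 + j.Y1 * j.p1 + j.d0Y0 - 1 / 2 * j.ps, 0⟩, ⟨j.Y0 * j.f * j.l⁻¹ ^ 2, 0, -(j.Crr * j.Y0 * j.f * j.l⁻¹ ^ 4) + j.Z0 * j.f * j.l⁻¹ ^ 2 - 1 / 2 * j.ps0⟩, ⟨0, j.Y0 * j.p1 + j.Y1 * j.p0 + j.d0Y1, 0⟩],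
      ![⟨j.Y0, 0, j.C00 * j.Y0 * j.f⁻¹ + j.C01 * j.Y1 * j.f⁻¹ - j.Z0⟩, 0, ⟨j.Y1, 0, -(j.C01 * j.Y0 * j.f⁻¹) - j.C11 * j.Y1 * j.f⁻¹ - j.Z1⟩],
      ![⟨0, j.Y0 * j.p1 + j.Y1 * j.p0 + j.d1Y0, 0⟩, ⟨-(j.Y1 * j.f * j.l⁻¹ ^ 2), 0, j.Crr * j.Y1 * j.f * j.l⁻¹ ^ 4 - j.Z1 * j.f * j.l⁻¹ ^ 2 - 1 / 2 * j.ps1⟩, ⟨0, j.Y0 * j.p0 + j.Y1 * j.p1 + j.d1Y1 - 1 / 2 * j.ps, 0⟩]]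

theorem JetData.covV_eq (j : JetData) (hl : j.l ≠ 0) (hf : j.f ≠ 0) (c a : Fin 3) :
    j.coeffs.covV c a = j.covVTab c a := by
  fin_cases c <;> fin_cases a <;>
  simp only [FieldCoeffs.covV, Fin.sum_univ_three] <;>
  simp [coeffs, covVTab, mk_add_mk, mk_mul_mk, mk_eq_zero] <;>
  (try constructorm* _ ∧ _) <;> (try field_simp) <;> (try ring)

def JetData.covHTab (j : JetData) : Fin 3 → Fin 3 → Fin 3 → Trunc ℂ :=
  ![![![⟨0, -(2 * j.f * j.om0), 0⟩, ⟨2 * j.f * j.om, 0, 2 * j.C00 * j.om - j.E00 - j.Err * j.f * j.l⁻¹ ^ 2⟩, 0],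
      ![⟨2 * j.f * j.om, 0, 2 * j.C00 * j.om - j.E00 - j.Err * j.f * j.l⁻¹ ^ 2⟩, 0, ⟨0, 0, 2 * j.C01 * j.om - j.E01⟩],
      ![0, ⟨0, 0, 2 * j.C01 * j.om - j.E01⟩, ⟨0, 2 * j.f * j.om0, 0⟩]],
    ![![⟨0, 0, 4 * j.C00 * j.om - 2 * j.E00⟩, 0, ⟨0, 0, 4 * j.C01 * j.om - 2 * j.E01⟩],
      ![0, ⟨0, 0, -(2 * j.Err)⟩, 0],
      ![⟨0, 0, 4 * j.C01 * j.om - 2 * j.E01⟩, 0, ⟨0, 0, 4 * j.C11 * j.om - 2 * j.E11⟩]],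
    ![![⟨0, -(2 * j.f * j.om1), 0⟩, ⟨0, 0, 2 * j.C01 * j.om - j.E01⟩, 0],
      ![⟨0, 0, 2 * j.C01 * j.om - j.E01⟩, 0, ⟨-(2 * j.f * j.om), 0, 2 * j.C11 * j.om - j.E11 + j.Err * j.f * j.l⁻¹ ^ 2⟩],
      ![0, ⟨-(2 * j.f * j.om), 0, 2 * j.C11 * j.om - j.E11 + j.Err * j.f * j.l⁻¹ ^ 2⟩, ⟨0, 2 * j.f * j.om1, 0⟩]]]

theorem JetData.covH_eq (j : JetData) (hl : j.l ≠ 0) (hf : j.f ≠ 0) (c a b : Fin 3) :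
    j.coeffs.covH c a b = j.covHTab c a b := by
  fin_cases c <;> fin_cases a <;> fin_cases b <;>
  simp only [FieldCoeffs.covH, Fin.sum_univ_three] <;>
  simp [coeffs, covHTab, mk_add_mk, mk_sub_mk, neg_mk, mk_mul_mk, mk_eq_zero] <;>
  (try constructorm* _ ∧ _) <;> (try field_simp) <;> (try ring)

def JetData.covVMixTab (j : JetData) : Fin 3 → Fin 3 → Trunc ℂ :=
  ![![⟨0, j.Y0 * j.p0 + j.Y1 * j.p1 + j.d0Y0 - 1 / 2 * j.ps, 0⟩, ⟨-(j.Y0), 0, -(j.C00 * j.Y0 * j.f⁻¹) - j.C01 * j.Y1 * j.f⁻¹ - j.Z0 + 1 / 2 * j.f⁻¹ * j.l ^ 2 * j.ps0⟩, ⟨0, -(j.Y0 * j.p1) - j.Y1 * j.p0 - j.d0Y1, 0⟩],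
      ![⟨-(j.Y0 * j.f * j.l⁻¹ ^ 2), 0, j.Crr * j.Y0 * j.f * j.l⁻¹ ^ 4 + j.Z0 * j.f * j.l⁻¹ ^ 2⟩, 0, ⟨j.Y1 * j.f * j.l⁻¹ ^ 2, 0, -(j.Crr * j.Y1 * j.f * j.l⁻¹ ^ 4) - j.Z1 * j.f * j.l⁻¹ ^ 2⟩],
      ![⟨0, -(j.Y0 * j.p1) - j.Y1 * j.p0 - j.d1Y0, 0⟩, ⟨-(j.Y1), 0, j.C01 * j.Y0 * j.f⁻¹ + j.C11 * j.Y1 * j.f⁻¹ - j.Z1 - 1 / 2 * j.f⁻¹ * j.l ^ 2 * j.ps1⟩, ⟨0, j.Y0 * j.p0 + j.Y1 * j.p1 + j.d1Y1 - 1 / 2 * j.ps, 0⟩]]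

theorem JetData.covVMix_eq (j : JetData) (hl : j.l ≠ 0) (hf : j.f ≠ 0) (m a : Fin 3) :
    j.coeffs.covVMix m a = j.covVMixTab m a := by
  fin_cases m <;> fin_cases a <;>
  simp only [FieldCoeffs.covVMix, FieldCoeffs.covVLow, j.covV_eq hl hf, covVTab, Fin.sum_univ_three] <;>
  simp [coeffs, covVMixTab, mk_add_mk, mk_mul_mk] <;>
  (try constructorm* _ ∧ _) <;> (try field_simp) <;> (try ring)

def JetData.hUpTab (j : JetData) : Fin 3 → Fin 3 → Trunc ℂ :=
  ![![⟨-(2 * j.f⁻¹ * j.om), 0, -(4 * j.C00 * j.f⁻¹ ^ 2 * j.om) + j.E00 * j.f⁻¹ ^ 2⟩, 0, ⟨0, 0, 4 * j.C01 * j.f⁻¹ ^ 2 * j.om - j.E01 * j.f⁻¹ ^ 2⟩],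
      ![0, ⟨0, 0, j.Err * j.l⁻¹ ^ 4⟩, 0],
      ![⟨0, 0, 4 * j.C01 * j.f⁻¹ ^ 2 * j.om - j.E01 * j.f⁻¹ ^ 2⟩, 0, ⟨2 * j.f⁻¹ * j.om, 0, -(4 * j.C11 * j.f⁻¹ ^ 2 * j.om) + j.E11 * j.f⁻¹ ^ 2⟩]]

theorem JetData.hUp_eq (j : JetData) (hl : j.l ≠ 0) (hf : j.f ≠ 0) (a b : Fin 3) :
    j.coeffs.hUp a b = j.hUpTab a b := by
  fin_cases a <;> fin_cases b <;>
  simp only [FieldCoeffs.hUp, Fin.sum_univ_three] <;>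
  simp [coeffs, hUpTab, mk_add_mk, mk_mul_mk] <;>
  (try constructorm* _ ∧ _) <;> (try field_simp) <;> (try ring)

/-- Raising one index first lets ∇_c h^{ab} and ∇^m h share the same single contractions and avoids
expanding double sums. -/
def FieldCoeffs.covHMix (D : FieldCoeffs) (c a b : Fin 3) : Trunc ℂ :=
  ∑ e, D.Gi b e * D.covH c a e

theorem FieldCoeffs.covHUp_eq (D : FieldCoeffs) (c a b : Fin 3) :
    D.covHUp c a b = ∑ d, D.Gi a d * D.covHMix c d b := by
  simp only [FieldCoeffs.covHUp, FieldCoeffs.covHMix, Finset.mul_sum, mul_assoc]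

theorem FieldCoeffs.covTrUp_eq (D : FieldCoeffs) (m : Fin 3) :
    D.covTrUp m = ∑ c, D.Gi m c * ∑ a, D.covHMix c a a := by
  simp only [FieldCoeffs.covTrUp, FieldCoeffs.covHMix, Finset.mul_sum, mul_assoc]

def JetData.covHMixTab (j : JetData) : Fin 3 → Fin 3 → Fin 3 → Trunc ℂ :=
  ![![![⟨0, 2 * j.om0, 0⟩, ⟨2 * j.f * j.l⁻¹ ^ 2 * j.om, 0, 2 * j.C00 * j.l⁻¹ ^ 2 * j.om - 2 * j.Crr * j.f * j.l⁻¹ ^ 4 * j.om - j.E00 * j.l⁻¹ ^ 2 - j.Err * j.f * j.l⁻¹ ^ 4⟩, 0],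
      ![⟨-(2 * j.om), 0, -(4 * j.C00 * j.f⁻¹ * j.om) + j.E00 * j.f⁻¹ + j.Err * j.l⁻¹ ^ 2⟩, 0, ⟨0, 0, 4 * j.C01 * j.f⁻¹ * j.om - j.E01 * j.f⁻¹⟩],
      ![0, ⟨0, 0, 2 * j.C01 * j.l⁻¹ ^ 2 * j.om - j.E01 * j.l⁻¹ ^ 2⟩, ⟨0, 2 * j.om0, 0⟩]],
    ![![⟨0, 0, -(4 * j.C00 * j.f⁻¹ * j.om) + 2 * j.E00 * j.f⁻¹⟩, 0, ⟨0, 0, 4 * j.C01 * j.f⁻¹ * j.om - 2 * j.E01 * j.f⁻¹⟩],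
      ![0, ⟨0, 0, -(2 * j.Err * j.l⁻¹ ^ 2)⟩, 0],
      ![⟨0, 0, -(4 * j.C01 * j.f⁻¹ * j.om) + 2 * j.E01 * j.f⁻¹⟩, 0, ⟨0, 0, 4 * j.C11 * j.f⁻¹ * j.om - 2 * j.E11 * j.f⁻¹⟩]],
    ![![⟨0, 2 * j.om1, 0⟩, ⟨0, 0, 2 * j.C01 * j.l⁻¹ ^ 2 * j.om - j.E01 * j.l⁻¹ ^ 2⟩, 0],
      ![⟨0, 0, -(4 * j.C01 * j.f⁻¹ * j.om) + j.E01 * j.f⁻¹⟩, 0, ⟨-(2 * j.om), 0, 4 * j.C11 * j.f⁻¹ * j.om - j.E11 * j.f⁻¹ + j.Err * j.l⁻¹ ^ 2⟩],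
      ![0, ⟨-(2 * j.f * j.l⁻¹ ^ 2 * j.om), 0, 2 * j.C11 * j.l⁻¹ ^ 2 * j.om + 2 * j.Crr * j.f * j.l⁻¹ ^ 4 * j.om - j.E11 * j.l⁻¹ ^ 2 + j.Err * j.f * j.l⁻¹ ^ 4⟩, ⟨0, 2 * j.om1, 0⟩]]]

theorem JetData.covHMix_eq (j : JetData) (hl : j.l ≠ 0) (hf : j.f ≠ 0) (c a b : Fin 3) :
    j.coeffs.covHMix c a b = j.covHMixTab c a b := by
  fin_cases c <;> fin_cases a <;> fin_cases b <;>
  simp only [FieldCoeffs.covHMix, j.covH_eq hl hf, covHTab, Fin.sum_univ_three] <;>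
  simp [coeffs, covHMixTab, mk_add_mk, mk_mul_mk, mk_eq_zero] <;>
  (try constructorm* _ ∧ _) <;> (try field_simp) <;> (try ring)

def JetData.covTrUpTab (j : JetData) : Fin 3 → Trunc ℂ :=
  ![⟨0, -(4 * j.f⁻¹ * j.om0), 0⟩, ⟨0, 0, -(4 * j.C00 * j.f⁻¹ * j.l⁻¹ ^ 2 * j.om) + 4 * j.C11 * j.f⁻¹ * j.l⁻¹ ^ 2 * j.om + 2 * j.E00 * j.f⁻¹ * j.l⁻¹ ^ 2 - 2 * j.E11 * j.f⁻¹ * j.l⁻¹ ^ 2 - 2 * j.Err * j.l⁻¹ ^ 4⟩, ⟨0, 4 * j.f⁻¹ * j.om1, 0⟩]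

theorem JetData.covTrUp_eq (j : JetData) (hl : j.l ≠ 0) (hf : j.f ≠ 0) (m : Fin 3) :
    j.coeffs.covTrUp m = j.covTrUpTab m := by
  fin_cases m <;>
  simp only [FieldCoeffs.covTrUp_eq, j.covHMix_eq hl hf, covHMixTab, Fin.sum_univ_three] <;>
  simp [coeffs, covTrUpTab, mk_add_mk, mk_mul_mk] <;>
  (try field_simp) <;> (try ring)

def JetData.covHUpTab (j : JetData) : Fin 3 → Fin 3 → Fin 3 → Trunc ℂ :=
  ![![![⟨0, -(2 * j.f⁻¹ * j.om0), 0⟩, ⟨-(2 * j.l⁻¹ ^ 2 * j.om), 0, -(4 * j.C00 * j.f⁻¹ * j.l⁻¹ ^ 2 * j.om) + 2 * j.Crr * j.l⁻¹ ^ 4 * j.om + j.E00 * j.f⁻¹ * j.l⁻¹ ^ 2 + j.Err * j.l⁻¹ ^ 4⟩, 0],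
      ![⟨-(2 * j.l⁻¹ ^ 2 * j.om), 0, -(4 * j.C00 * j.f⁻¹ * j.l⁻¹ ^ 2 * j.om) + 2 * j.Crr * j.l⁻¹ ^ 4 * j.om + j.E00 * j.f⁻¹ * j.l⁻¹ ^ 2 + j.Err * j.l⁻¹ ^ 4⟩, 0, ⟨0, 0, 4 * j.C01 * j.f⁻¹ * j.l⁻¹ ^ 2 * j.om - j.E01 * j.f⁻¹ * j.l⁻¹ ^ 2⟩],
      ![0, ⟨0, 0, 4 * j.C01 * j.f⁻¹ * j.l⁻¹ ^ 2 * j.om - j.E01 * j.f⁻¹ * j.l⁻¹ ^ 2⟩, ⟨0, 2 * j.f⁻¹ * j.om0, 0⟩]],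
    ![![⟨0, 0, 4 * j.C00 * j.f⁻¹ ^ 2 * j.om - 2 * j.E00 * j.f⁻¹ ^ 2⟩, 0, ⟨0, 0, -(4 * j.C01 * j.f⁻¹ ^ 2 * j.om) + 2 * j.E01 * j.f⁻¹ ^ 2⟩],
      ![0, ⟨0, 0, -(2 * j.Err * j.l⁻¹ ^ 4)⟩, 0],
      ![⟨0, 0, -(4 * j.C01 * j.f⁻¹ ^ 2 * j.om) + 2 * j.E01 * j.f⁻¹ ^ 2⟩, 0, ⟨0, 0, 4 * j.C11 * j.f⁻¹ ^ 2 * j.om - 2 * j.E11 * j.f⁻¹ ^ 2⟩]],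
    ![![⟨0, -(2 * j.f⁻¹ * j.om1), 0⟩, ⟨0, 0, -(4 * j.C01 * j.f⁻¹ * j.l⁻¹ ^ 2 * j.om) + j.E01 * j.f⁻¹ * j.l⁻¹ ^ 2⟩, 0],
      ![⟨0, 0, -(4 * j.C01 * j.f⁻¹ * j.l⁻¹ ^ 2 * j.om) + j.E01 * j.f⁻¹ * j.l⁻¹ ^ 2⟩, 0, ⟨-(2 * j.l⁻¹ ^ 2 * j.om), 0, 4 * j.C11 * j.f⁻¹ * j.l⁻¹ ^ 2 * j.om + 2 * j.Crr * j.l⁻¹ ^ 4 * j.om - j.E11 * j.f⁻¹ * j.l⁻¹ ^ 2 + j.Err * j.l⁻¹ ^ 4⟩],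
      ![0, ⟨-(2 * j.l⁻¹ ^ 2 * j.om), 0, 4 * j.C11 * j.f⁻¹ * j.l⁻¹ ^ 2 * j.om + 2 * j.Crr * j.l⁻¹ ^ 4 * j.om - j.E11 * j.f⁻¹ * j.l⁻¹ ^ 2 + j.Err * j.l⁻¹ ^ 4⟩, ⟨0, 2 * j.f⁻¹ * j.om1, 0⟩]]]

theorem JetData.covHUp_eq (j : JetData) (hl : j.l ≠ 0) (hf : j.f ≠ 0) (c a b : Fin 3) :
    j.coeffs.covHUp c a b = j.covHUpTab c a b := by
  fin_cases c <;> fin_cases a <;> fin_cases b <;>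
  simp only [FieldCoeffs.covHUp_eq, j.covHMix_eq hl hf, covHMixTab, Fin.sum_univ_three] <;>
  simp [coeffs, covHUpTab, mk_add_mk, mk_mul_mk, mk_eq_zero] <;>
  (try constructorm* _ ∧ _) <;> (try field_simp) <;> (try ring)

/-- The cancellation of the two leading coefficients is what makes the charges finite. All
derivatives of Y and of φ drop out of the third. -/
theorem JetData.bbTerm_sub (j : JetData) (hl : j.l ≠ 0) (hf : j.f ≠ 0) :
    j.coeffs.bbTerm 0 1 - j.coeffs.bbTerm 1 0 = ⟨0, 0, 2 * j.C00 * j.Y0 * j.f⁻¹ * j.l⁻¹ ^ 2 * j.om - 2 * j.C11 * j.Y0 * j.f⁻¹ * j.l⁻¹ ^ 2 * j.om + 2 * j.E01 * j.Y1 * j.f⁻¹ * j.l⁻¹ ^ 2 + 2 * j.E11 * j.Y0 * j.f⁻¹ * j.l⁻¹ ^ 2 + j.Err * j.Y0 * j.l⁻¹ ^ 4 - 2 * j.Z0 * j.l⁻¹ ^ 2 * j.om - 1 / 2 * j.f⁻¹ * j.om * j.ps0 + j.f⁻¹ * j.om0 * j.ps⟩ := by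
  simp only [FieldCoeffs.bbTerm, FieldCoeffs.covHUpUp, FieldCoeffs.covVUp, FieldCoeffs.trH,
    j.covV_eq hl hf, j.covVMix_eq hl hf, j.hUp_eq hl hf, j.covTrUp_eq hl hf, j.covHUp_eq hl hf,
    Fin.sum_univ_three]
  ext <;>
  simp [coeffs, covVTab, covVMixTab, hUpTab, covTrUpTab, covHUpTab, const] <;>
  (try field_simp) <;> (try ring)

end

section

open Asymptotics AdSCharges.Trunc

/-! ### Expansions of a variation and of an asymptotic symmetry -/

/-- A bare bound becomes an exact expansion when the rescaled function itself is the last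
coefficient. It serves for h_rA and for the remainder of ξ^A. -/
theorem HasExp.of_bigO {𝕜 : Type*} [RCLike 𝕜] {k : ℕ} {n : ℤ} {f : Pt → 𝕜} (hs : FarSmooth f)
    (hf : BigO k f (n - 2)) : HasExp k n f (fun x => ⟨0, 0, (x 1) ^ (2 - n) • f x⟩) := by
  have h1 : FarSmooth (fun x : Pt => (x 1) ^ (2 - n) • f x) := (farSmooth_zpow _).smul hs
  have h2 : BigO k (fun x : Pt => (x 1) ^ (2 - n) • f x) 0 := by
    have := BigO.smul (farSmooth_zpow (2 - n)) hs (by simpa using bigO_zpow (k := k) 1 (2 - n)) hf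
    simpa using this
  refine HasExp.of_littleO hs ⟨farSmooth_const _, farSmooth_const _, h1⟩
    ⟨bigO_const _, bigO_const _, h2⟩ ?_
  refine (LittleO.of_zero (E := 𝕜) k (n - 2)).congr ?_
  filter_upwards [eventually_far_pos] with x hx
  simp only [model, smul_zero, zero_add, smul_smul]
  rw [← zpow_add₀ hx.ne']
  simp

/-- The weight of the component `ξ^a` of a vector field. -/
def nV : Fin 3 → ℤ := ![0, 1, 0]

theorem ofReal_zpow_eq (r : ℝ) (n : ℤ) : (r : ℂ) ^ n = ((r ^ n : ℝ) : ℂ) := by push_cast; rfl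

section

variable {l : ℝ} {p : PhasePoint l}

/-- The coefficients `Z^A = -(l²/4) γ^{AB} ∂_B ψ` of an asymptotic symmetry. -/
def PhasePoint.subY (p : PhasePoint l) (ψ : Bdy → ℂ) (A : Fin 2) (y : Bdy) : ℂ :=
  -((l ^ 2 / 4 * (p.fac y)⁻¹ : ℝ) * ∑ B, (flat A B : ℂ) * pd B ψ y)

theorem PhasePoint.smooth_subY {ψ : Bdy → ℂ} (hψ : ContDiff ℝ ∞ ψ) (A : Fin 2) :
    ContDiff ℝ ∞ (p.subY ψ A) := by
  have h1 : ContDiff ℝ ∞ (fun y => ((l ^ 2 / 4 * (p.fac y)⁻¹ : ℝ) : ℂ)) :=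
    Complex.ofRealCLM.contDiff.comp (contDiff_const.mul p.smooth_fac_inv)
  exact (h1.mul (ContDiff.sum fun B _ => contDiff_const.mul (contDiff_pd B hψ))).neg

/-- The coefficients of an asymptotic symmetry. -/
def PhasePoint.genT (p : PhasePoint l) (a : Param) (X : Bdy → ℂ) (c : Fin 3) (x : Pt) : Trunc ℂ :=
  ![⟨a.1 (proj x) 0, 0, p.subY a.2 0 (proj x)⟩, ⟨-(1 / 2 * a.2 (proj x)), 0, X (proj x)⟩,
    ⟨a.1 (proj x) 1, 0, p.subY a.2 1 (proj x)⟩] c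

theorem IsGenerator.farSmooth {a : Param} {ξ : Pt → Fin 3 → ℂ} (h : IsGenerator p a ξ) (c : Fin 3) :
    FarSmooth (fun x => ξ x c) :=
  let ⟨_, hR⟩ := h.smooth
  farSmooth_of_contDiffOn (hR c)

theorem BigO.littleO {E : Type*} [NormedAddCommGroup E] [NormedSpace ℝ E] {k : ℕ} :
    ∀ {f : Pt → E} {n m : ℤ}, BigO k f n → n < m → LittleO k f m := by
  have h0 : ∀ {f : Pt → E} {n m : ℤ}, BigO 0 f n → n < m → LittleO 0 f m := by
    intro f n m h hnm
    rw [bigO_zero_iff] at h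
    rw [littleO_zero_iff]
    exact fun K hK => (h K hK).trans_isLittleO ((isLittleO_zpow hnm).mono (farOn_le K))
  induction k with
  | zero => exact h0
  | succ k ih =>
    intro f n m h hnm
    rw [BigO] at h
    rw [LittleO]
    exact ⟨h0 h.1 hnm, ih h.2.1 hnm, ih h.2.2.1 (by omega), ih h.2.2.2 hnm⟩

theorem IsGenerator.exp_r {a : Param} (ha : IsSymmetry a) {ξ : Pt → Fin 3 → ℂ}
    (h : IsGenerator p a ξ) : ∃ X : Bdy → ℂ, ContDiff ℝ ∞ X ∧
      HasExp 2 1 (fun x => ξ x 1) (p.genT a X 1) := by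
  obtain ⟨X, hX, hr⟩ := h.expand_r
  refine ⟨X, hX, HasExp.of_littleO (h.farSmooth 1)
    ⟨farSmooth_proj ((contDiff_const.mul ha.smooth_ψ).neg), farSmooth_const _, farSmooth_proj hX⟩
    ⟨bigO_proj ((contDiff_const.mul ha.smooth_ψ).neg), bigO_const _, bigO_proj hX⟩ ?_⟩
  refine hr.congr (.of_forall fun x => ?_)
  simp [model, PhasePoint.genT, Complex.real_smul]
  ring

theorem IsGenerator.exp_A {a : Param} (ha : IsSymmetry a) {ξ : Pt → Fin 3 → ℂ}
    (h : IsGenerator p a ξ) (A : Fin 2) : HasExp 2 0 (fun x => ξ x (bIdx A))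
      (fun x => ⟨a.1 (proj x) A, 0, p.subY a.2 A (proj x)⟩) := by
  refine HasExp.of_littleO (h.farSmooth _)
    ⟨farSmooth_proj (ha.smooth_Y A), farSmooth_const _, farSmooth_proj (p.smooth_subY ha.smooth_ψ A)⟩
    ⟨bigO_proj (ha.smooth_Y A), bigO_const _, bigO_proj (p.smooth_subY ha.smooth_ψ A)⟩ ?_
  refine ((h.expand_A A).littleO (by norm_num : (-4 : ℤ) < 0 - 2)).congr (.of_forall fun x => ?_)
  simp only [model, PhasePoint.subY, Complex.real_smul, p.exp_neg, ofReal_zpow_eq]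
  simp
  ring

theorem IsGenerator.exp {a : Param} (ha : IsSymmetry a) {ξ : Pt → Fin 3 → ℂ}
    (h : IsGenerator p a ξ) : ∃ X : Bdy → ℂ, ContDiff ℝ ∞ X ∧
      ∀ c, HasExp 2 (nV c) (fun x => ξ x c) (p.genT a X c) := by
  obtain ⟨X, hX, hr⟩ := h.exp_r ha
  refine ⟨X, hX, fun c => ?_⟩
  fin_cases c
  · exact h.exp_A ha 0
  · exact hr
  · exact h.exp_A ha 1

/-- The coefficients of a variation of the metric. -/
def PhasePoint.varT (p : PhasePoint l) (h : Pt → Matrix (Fin 3) (Fin 3) ℂ) (om ηrr : Bdy → ℂ)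
    (η : Bdy → Matrix (Fin 2) (Fin 2) ℂ) (a b : Fin 3) (x : Pt) : Trunc ℂ :=
  !![⟨-(2 * p.fac (proj x) * om (proj x)), 0, η (proj x) 0 0⟩,
      ⟨0, 0, (x 1) ^ (3 : ℤ) • h x 1 0⟩, ⟨0, 0, η (proj x) 0 1⟩;
    ⟨0, 0, (x 1) ^ (3 : ℤ) • h x 1 0⟩, ⟨0, 0, ηrr (proj x)⟩, ⟨0, 0, (x 1) ^ (3 : ℤ) • h x 1 2⟩;
    ⟨0, 0, η (proj x) 0 1⟩, ⟨0, 0, (x 1) ^ (3 : ℤ) • h x 1 2⟩,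
      ⟨2 * p.fac (proj x) * om (proj x), 0, η (proj x) 1 1⟩] a b

theorem HasVariation.exp {h : Pt → Matrix (Fin 3) (Fin 3) ℂ} {om ηrr : Bdy → ℂ}
    {η : Bdy → Matrix (Fin 2) (Fin 2) ℂ} (hv : HasVariation p h om ηrr η)
    (hs : ∀ a b, FarSmooth (fun x => h x a b)) (hsym : ∀ a b, ∀ᶠ x in far, h x a b = h x b a)
    (a b : Fin 3) : HasExp 1 (nG a b) (fun x => h x a b) (p.varT h om ηrr η a b) := by
  have er : HasExp 1 (-2) (fun x => h x 1 1) (p.varT h om ηrr η 1 1) := by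
    refine HasExp.of_littleO (hs 1 1) ⟨farSmooth_const _, farSmooth_const _,
      farSmooth_proj hv.smooth_ηrr⟩ ⟨bigO_const _, bigO_const _, bigO_proj hv.smooth_ηrr⟩ ?_
    refine hv.expand_rr.congr (.of_forall fun x => ?_)
    simp [model, PhasePoint.varT, Complex.real_smul]
    ring
  have eA : ∀ A, HasExp 1 (-1) (fun x => h x 1 (bIdx A))
      (fun x => ⟨0, 0, (x 1) ^ (3 : ℤ) • h x 1 (bIdx A)⟩) := fun A =>
    HasExp.of_bigO (n := -1) (hs 1 (bIdx A)) (hv.expand_rA A)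
  have eAB : ∀ A B, HasExp 1 2 (fun x => h x (bIdx A) (bIdx B))
      (fun x => ⟨2 * p.fac (proj x) * flat A B * om (proj x), 0, η (proj x) A B⟩) := by
    intro A B
    have hf : ContDiff ℝ ∞ (fun y => (p.fac y : ℂ)) := Complex.ofRealCLM.contDiff.comp p.smooth_fac
    have h0 : ContDiff ℝ ∞ (fun y => 2 * (p.fac y : ℂ) * flat A B * om y) :=
      ((contDiff_const.mul hf).mul contDiff_const).mul hv.smooth_om
    refine HasExp.of_littleO (hs _ _) ⟨farSmooth_proj h0, farSmooth_const _,
      farSmooth_proj (hv.smooth_η A B)⟩ ⟨bigO_proj h0, bigO_const _, bigO_proj (hv.smooth_η A B)⟩ ?_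
    refine (hv.expand_AB A B).congr (.of_forall fun x => ?_)
    simp [model, PhasePoint.fac, Complex.real_smul]
    ring
  fin_cases a <;> fin_cases b
  · exact (eAB 0 0).congr_coeff (.of_forall fun x => by ext <;> simp [PhasePoint.varT, flat])
  · exact (eA 0).congr (hsym 1 0) (.of_forall fun x => rfl)
  · exact (eAB 0 1).congr_coeff (.of_forall fun x => by ext <;> simp [PhasePoint.varT, flat])
  · exact eA 0
  · exact er
  · exact eA 1
  · exact (eAB 0 1).congr (hsym 0 2)
      (.of_forall fun x => by ext <;> simp [PhasePoint.varT, flat])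
  · exact (eA 1).congr (hsym 1 2) (.of_forall fun x => rfl)
  · exact (eAB 1 1).congr_coeff (.of_forall fun x => by ext <;> simp [PhasePoint.varT, flat])

/-- The boundary data that enter the superpotential. -/
def PhasePoint.jet (p : PhasePoint l) (a : Param) (om ηrr : Bdy → ℂ)
    (η : Bdy → Matrix (Fin 2) (Fin 2) ℂ) (y : Bdy) : JetData where
  C00 := p.C y 0 0
  C01 := p.C y 0 1
  C11 := p.C y 1 1
  Crr := p.Crr y
  E00 := η y 0 0
  E01 := η y 0 1
  E11 := η y 1 1
  Err := ηrr y
  Y0 := a.1 y 0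
  Y1 := a.1 y 1
  Z0 := p.subY a.2 0 y
  Z1 := p.subY a.2 1 y
  d0Y0 := pd 0 (fun z => a.1 z 0) y
  d0Y1 := pd 0 (fun z => a.1 z 1) y
  d1Y0 := pd 1 (fun z => a.1 z 0) y
  d1Y1 := pd 1 (fun z => a.1 z 1) y
  f := p.fac y
  l := l
  om := om y
  om0 := pd 0 om y
  om1 := pd 1 om y
  p0 := ((pd 0 p.conf y : ℝ) : ℂ)
  p1 := ((pd 1 p.conf y : ℝ) : ℂ)
  ps := a.2 y
  ps0 := pd 0 a.2 y
  ps1 := pd 1 a.2 y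

theorem smooth_ofReal {a : Bdy → ℝ} (h : ContDiff ℝ ∞ a) : ContDiff ℝ ∞ (fun y => (a y : ℂ)) :=
  Complex.ofRealCLM.contDiff.comp h

-- At these weights everything not fixed by the boundary data is shifted beyond the truncation: X,
-- the mixed components of g and h, and the derivatives of C and δC. Hence the limit of the
-- superpotential does not see the choice of ξ.
set_option maxHeartbeats 1000000 in
theorem HasVariation.hasFieldCoeffs (hl : l ≠ 0) {h : Pt → Matrix (Fin 3) (Fin 3) ℂ}
    {om ηrr : Bdy → ℂ} {η : Bdy → Matrix (Fin 2) (Fin 2) ℂ} (hv : HasVariation p h om ηrr η)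
    (hs : ∀ a b, FarSmooth (fun x => h x a b)) (hsym : ∀ a b, ∀ᶠ x in far, h x a b = h x b a)
    {a : Param} (ha : IsSymmetry a) {ξ : Pt → Fin 3 → ℂ} (hξ : IsGenerator p a ξ) :
    HasFieldCoeffs p.g ξ h (fun x => (p.jet a om ηrr η (proj x)).coeffs) := by
  obtain ⟨X, hX, eξ⟩ := hξ.exp ha
  have eh := hv.exp hs hsym
  have dY0 : Differentiable ℝ (fun y => a.1 y 0) := (ha.smooth_Y 0).differentiable (by simp)
  have dY1 : Differentiable ℝ (fun y => a.1 y 1) := (ha.smooth_Y 1).differentiable (by simp)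
  have dψ : Differentiable ℝ (fun y => (2 : ℂ)⁻¹ * a.2 y) :=
    (contDiff_const.mul ha.smooth_ψ).differentiable (by simp)
  have dψ' : ∀ A y, pd A (fun y => (2 : ℂ)⁻¹ * a.2 y) y = 2⁻¹ * pd A a.2 y := by
    intro A y
    rw [pd_mul A (differentiableAt_const _) (ha.smooth_ψ.differentiable (by simp) y), pd_const]
    simp
  have dZ0 : Differentiable ℝ (p.subY a.2 0) :=
    (p.smooth_subY ha.smooth_ψ 0).differentiable (by simp)
  have dZ1 : Differentiable ℝ (p.subY a.2 1) :=
    (p.smooth_subY ha.smooth_ψ 1).differentiable (by simp)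
  have dηr : Differentiable ℝ ηrr := hv.smooth_ηrr.differentiable (by simp)
  have hfc : ContDiff ℝ ∞ (fun y => (p.fac y : ℂ)) := smooth_ofReal p.smooth_fac
  have dfo : Differentiable ℝ (fun y => 2 * (p.fac y : ℂ) * om y) :=
    ((contDiff_const.mul hfc).mul hv.smooth_om).differentiable (by simp)
  have dfo' : ∀ A y, pd A (fun y => 2 * (p.fac y : ℂ) * om y) y
      = 4 * p.fac y * om y * pd A p.conf y + 2 * p.fac y * pd A om y := by
    intro A y
    have df := hfc.differentiable (by simp) y
    rw [pd_mul (f := fun y => 2 * (p.fac y : ℂ)) A ((differentiableAt_const _).mul df) (hv.smooth_om.differentiable (by simp) y),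
      pd_mul A (differentiableAt_const _) df, pd_const, pd_ofReal A (p.differentiable_fac y),
      p.pd_fac]
    push_cast
    ring
  have dE : ∀ A B, Differentiable ℝ (fun y => η y A B) :=
    fun A B => (hv.smooth_η A B).differentiable (by simp)
  refine ⟨fun a b => ?_, fun a b => ?_, fun a b c => ?_, fun c => ?_, fun c b => ?_, fun a b => ?_,
    fun c a b => ?_⟩
  · refine ((p.exp_g a b).of_succ.of_succ.ofReal.raise (N := wt a + wt b)
      (by revert a b; decide)).congr_coeff (.of_forall fun x => ?_)
    fin_cases a <;> fin_cases b <;>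
      simp [Trunc.raise, wt, par, PhasePoint.gT, JetData.coeffs, PhasePoint.jet, Trunc.map, shift,
        Trunc.ext_iff]
  · refine ((p.exp_gi hl a b).of_succ.of_succ.ofReal.raise (N := -wt a - wt b)
      (by revert a b; decide)).congr_coeff (.of_forall fun x => ?_)
    fin_cases a <;> fin_cases b <;>
      simp [Trunc.raise, wt, par, PhasePoint.giT, JetData.coeffs, PhasePoint.jet, Trunc.map, shift,
        Trunc.ext_iff, mul_comm, ← pow_mul]
  · refine ((p.exp_chr hl a b c).of_succ.ofReal.raise (N := -wt a + wt b + wt c)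
      (by revert a b c; decide)).congr_coeff (.of_forall fun x => ?_)
    fin_cases a <;> fin_cases b <;> fin_cases c <;>
      simp [Trunc.raise, nChr, wt, par, PhasePoint.chrTab, JetData.coeffs, PhasePoint.jet, Trunc.map,
        shift, Trunc.ext_iff, ← pow_mul] <;> (try ring)
  · refine ((eξ c).of_succ.of_succ.raise (N := 1 - wt c)
      (by revert c; decide)).congr_coeff (.of_forall fun x => ?_)
    fin_cases c <;>
      simp [Trunc.raise, nV, wt, PhasePoint.genT, JetData.coeffs, PhasePoint.jet, shift]
  · refine (((eξ b).pd c).of_succ.raise (N := 1 - wt b + wt c)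
      (by revert b c; decide)).congr_coeff (.of_forall fun x => ?_)
    fin_cases c <;> fin_cases b <;>
      simp [Trunc.raise, nV, wt, dw, dT, pdT, pdr, PhasePoint.genT, JetData.coeffs, PhasePoint.jet,
        shift, pd_proj_zero dY0, pd_proj_two dY0, pd_proj_one dY0, pd_proj_zero dY1,
        pd_proj_two dY1, pd_proj_one dY1, pd_proj_zero dψ, pd_proj_one dψ, pd_proj_two dψ,
        pd_proj_one dZ0, pd_proj_one dZ1, dψ', pd_const, pd_neg]
  · refine ((eh a b).of_succ.raise (N := wt a + wt b)
      (by revert a b; decide)).congr_coeff (.of_forall fun x => ?_)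
    fin_cases a <;> fin_cases b <;>
      simp [Trunc.raise, nG, wt, par, PhasePoint.varT, JetData.coeffs, PhasePoint.jet, shift,
        Trunc.ext_iff]
  · refine (((eh a b).pd c).raise (N := wt c + wt a + wt b)
      (by revert a b c; decide)).congr_coeff (.of_forall fun x => ?_)
    fin_cases c <;> fin_cases a <;> fin_cases b <;>
      simp [Trunc.raise, nG, wt, par, dw, dT, pdT, pdr, PhasePoint.varT, JetData.coeffs,
        PhasePoint.jet, shift, Trunc.ext_iff, pd_proj_zero dfo, pd_proj_one dfo, pd_proj_two dfo,
        dfo', pd_const,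
        pd_proj_one dηr, pd_proj_one (dE _ _), pd_neg] <;> try ring
end

end

section

open Asymptotics AdSCharges.Trunc

/-! ### The limit of the Barnich-Brandt integral -/

section

variable {l : ℝ} {p : PhasePoint l}

/-- The linearized constraint `δρ = 0`. -/
def LinearizedRho (p : PhasePoint l) (om ηrr : Bdy → ℂ)
    (η : Bdy → Matrix (Fin 2) (Fin 2) ℂ) : Prop :=
  ∀ y, (∑ A, ∑ B, (Real.exp (-2 * p.conf y) * flat A B : ℝ) *
      (-2 * om y * (p.C y A B : ℂ) + η y A B)) + ηrr y / (l : ℂ) ^ 2 = 0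

/-- The integrand of the variation of the charge, up to normalization. -/
def chargeDensity (l : ℝ) (a : Param) (om : Bdy → ℂ) (η : Bdy → Matrix (Fin 2) (Fin 2) ℂ)
    (y : Bdy) : ℂ :=
  (l : ℂ) ^ 2 * (a.2 y * pd 0 om y - pd 0 a.2 y * om y)
    + 2 * (a.1 y 0 * (1 / 2 * (η y 0 0 + η y 1 1)) + a.1 y 1 * η y 0 1)

theorem continuous_chargeDensity {a : Param} (ha : IsSymmetry a) {om : Bdy → ℂ}
    {η : Bdy → Matrix (Fin 2) (Fin 2) ℂ} (hom : ContDiff ℝ ∞ om)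
    (hη : ∀ A B, ContDiff ℝ ∞ (fun y => η y A B)) : Continuous (chargeDensity l a om η) := by
  have h1 := ha.smooth_ψ.continuous
  have h2 := (contDiff_pd 0 ha.smooth_ψ).continuous
  have h3 := (contDiff_pd 0 hom).continuous
  have h4 := hom.continuous
  have h5 := fun A => (ha.smooth_Y A).continuous
  have h6 := fun A B => (hη A B).continuous
  exact (continuous_const.mul ((h1.mul h3).sub (h2.mul h4))).add (continuous_const.mul
    (((h5 0).mul (continuous_const.mul ((h6 0 0).add (h6 1 1)))).add ((h5 1).mul (h6 0 1))))

/-- δρ = 0 replaces δC_rr, after which the terms C δφ cancel and only the trace-free part of δC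
remains. The value of Z^τ doubles the term δφ ∂_τ ψ, giving the antisymmetric pairing of ψ and δφ.
-/
theorem jet_coeff (hl : l ≠ 0) {a : Param} {om ηrr : Bdy → ℂ}
    {η : Bdy → Matrix (Fin 2) (Fin 2) ℂ} (hρ : LinearizedRho p om ηrr η) (y : Bdy) :
    (p.jet a om ηrr η y).coeffs.bbTerm 0 1 - (p.jet a om ηrr η y).coeffs.bbTerm 1 0
      = ⟨0, 0, ((l : ℂ) * p.fac y)⁻¹ * (1 / l * chargeDensity l a om η y)⟩ := by
  have hl' : (l : ℂ) ≠ 0 := by exact_mod_cast hl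
  have hf : (p.fac y : ℂ) ≠ 0 := by exact_mod_cast (p.fac_pos y).ne'
  rw [JetData.bbTerm_sub _ hl' hf]
  have h := hρ y
  simp only [Fin.sum_univ_two, p.exp_neg, flat] at h
  simp at h
  have h' : ηrr y = -(l : ℂ) ^ 2 * ((p.fac y : ℂ)⁻¹ * (2 * om y * p.C y 0 0 - η y 0 0
      + (-2 * om y * p.C y 1 1 + η y 1 1))) := by
    field_simp at h ⊢
    linear_combination h
  ext
  · rfl
  · rfl
  · simp only [PhasePoint.jet, chargeDensity, PhasePoint.subY, Fin.sum_univ_two, flat, h']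
    simp
    field_simp
    ring

/-- The rescaled volume density. -/
theorem tendsto_sqrt_det (hl : 0 < l) {K : Set Bdy} (hK : IsCompact K) :
    Tendsto (fun x => (x 1)⁻¹ * Real.sqrt (-(p.g x).det) - l * p.fac (proj x)) (farOn K) (𝓝 0) := by
  have h := p.exp_det.zero_of.rem
  rw [littleO_zero_iff] at h
  have h1 : Tendsto (fun x => -(p.g x).det * (x 1) ^ (-2 : ℤ) - (l * p.fac (proj x)) ^ 2)
      (farOn K) (𝓝 0) := by
    have e := bigO_zero_iff.1 p.exp_det.zero_of.bdd_coeff.2.2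
    have h2 := (h K hK)
    have h3 := ((isLittleO_zpow (show (-2 : ℤ) < 0 by norm_num)).mono (farOn_le K))
    have h4 := h2.mul_isBigO (isBigO_refl (fun x : Pt => (x 1) ^ (-2 : ℤ)) (farOn K))
    have h5 := (e K hK).mul_isLittleO h3
    have h6 : (fun x => -(p.g x).det * (x 1) ^ (-2 : ℤ) - (l * p.fac (proj x)) ^ 2)
        =o[farOn K] fun _ => (1 : ℝ) := by
      have h4' := h4.trans_isBigO (IsBigO.trans (g := fun x : Pt => (x 1) ^ (-2 : ℤ))
        (IsBigO.of_bound 1 (by simp)) h3.isBigO)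
      have := (h4'.add (h5.trans_isBigO (IsBigO.of_bound 1 (by simp)))).neg_left
      simp only [zpow_zero] at this
      refine this.congr' ?_ EventuallyEq.rfl
      filter_upwards [farOn_le K eventually_far_pos] with x hx
      have hx' := hx.ne'
      simp only [model, smul_eq_mul]
      norm_num
      field_simp
      ring
    exact (isLittleO_one_iff ℝ).1 h6
  have h7 : Tendsto (fun x => Real.sqrt |-(p.g x).det * (x 1) ^ (-2 : ℤ) - (l * p.fac (proj x)) ^ 2|)
      (farOn K) (𝓝 0) := by
    exact (Real.continuous_sqrt.tendsto' |0| 0 (by simp)).comp h1.abs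
  refine squeeze_zero_norm' ?_ h7
  filter_upwards [farOn_le K eventually_far_pos, farOn_le K p.far_mem] with x hx hR
  have hd : 0 ≤ -(p.g x).det := by linarith [p.lorentz_g x hR]
  have hm : 0 ≤ l * p.fac (proj x) := (mul_pos hl (p.fac_pos _)).le
  have e1 : (x 1)⁻¹ * Real.sqrt (-(p.g x).det) = Real.sqrt (-(p.g x).det * (x 1) ^ (-2 : ℤ)) := by
    rw [Real.sqrt_mul hd, mul_comm]
    congr 1
    rw [zpow_neg, Real.sqrt_inv]
    congr 1
    exact (Real.sqrt_sq hx.le).symm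
  have e2 : l * p.fac (proj x) = Real.sqrt ((l * p.fac (proj x)) ^ 2) := (Real.sqrt_sq hm).symm
  rw [e1]
  nth_rewrite 1 [e2]
  rw [Real.norm_eq_abs]
  -- With this modulus of continuity of the square root no lower bound on the limit is needed.
  have key : ∀ u v : ℝ, 0 ≤ v → v ≤ u → |√u - √v| ≤ √|u - v| := by
    intro u v hv huv
    rw [abs_of_nonneg (sub_nonneg.2 (Real.sqrt_le_sqrt huv)), abs_of_nonneg (sub_nonneg.2 huv),
      sub_le_iff_le_add]
    refine Real.sqrt_le_iff.2 ⟨by positivity, ?_⟩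
    nlinarith [Real.sq_sqrt hv, Real.sq_sqrt (sub_nonneg.2 huv),
      mul_nonneg (Real.sqrt_nonneg (u - v)) (Real.sqrt_nonneg v)]
  rcases le_total ((l * p.fac (proj x)) ^ 2) (-(p.g x).det * (x 1) ^ (-2 : ℤ)) with h | h
  · exact key _ _ (sq_nonneg _) h
  · rw [abs_sub_comm, abs_sub_comm (-(p.g x).det * (x 1) ^ (-2 : ℤ))]
    exact key _ _ (by positivity) h

/-- Uniform convergence of the integrand. -/
theorem tendsto_bbTerm (hl : 0 < l) {h : Pt → Matrix (Fin 3) (Fin 3) ℂ}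
    {om ηrr : Bdy → ℂ} {η : Bdy → Matrix (Fin 2) (Fin 2) ℂ} (hv : HasVariation p h om ηrr η)
    (hs : ∀ a b, FarSmooth (fun x => h x a b)) (hsym : ∀ a b, ∀ᶠ x in far, h x a b = h x b a)
    (hρ : LinearizedRho p om ηrr η)
    {a : Param} (ha : IsSymmetry a) {ξ : Pt → Fin 3 → ℂ} (hξ : IsGenerator p a ξ)
    {K : Set Bdy} (hK : IsCompact K) :
    Tendsto (fun x => (Real.sqrt (-(p.g x).det) : ℂ) * (bbTerm p.g ξ h 0 1 x - bbTerm p.g ξ h 1 0 x)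
      - 1 / l * chargeDensity l a om η (proj x)) (farOn K) (𝓝 0) := by
  have H := hv.hasFieldCoeffs hl.ne' hs hsym ha hξ
  have e : HasExp 0 1 (fun x => bbTerm p.g ξ h 0 1 x - bbTerm p.g ξ h 1 0 x)
      (fun x => ⟨0, 0, ((l : ℂ) * p.fac (proj x))⁻¹ *
        (1 / l * chargeDensity l a om η (proj x))⟩) :=
    (((H.bbTerm 0 1).cast (m := 1) rfl).sub ((H.bbTerm 1 0).cast (m := 1) rfl)).congr_coeff
      (.of_forall fun x => jet_coeff hl.ne' hρ (proj x))
  have b2 := bigO_zero_iff.1 e.zero_of.bdd_coeff.2.2 K hK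
  have r := e.zero_of.rem
  rw [littleO_zero_iff] at r
  have r := (r K hK).mul_isBigO (IsBigO.of_bound 1 (by simp) :
    (fun x : Pt => (x 1 : ℂ)) =O[farOn K] fun x : Pt => x 1)
  have ds : (fun x => (((x 1)⁻¹ * Real.sqrt (-(p.g x).det) - l * p.fac (proj x) : ℝ) : ℂ))
      =o[farOn K] fun _ => (1 : ℝ) := by
    rw [isLittleO_one_iff]
    exact (Complex.continuous_ofReal.tendsto' 0 0 (by simp)).comp (tendsto_sqrt_det hl hK)
  have bm : (fun x => ((l * p.fac (proj x) : ℝ) : ℂ)) =O[farOn K] fun _ => (1 : ℝ) := by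
    have := bigO_proj (k := 0) (smooth_ofReal (contDiff_const.mul p.smooth_fac) :
      ContDiff ℝ ∞ fun y => ((l * p.fac y : ℝ) : ℂ))
    rw [bigO_zero_iff] at this
    simpa using this K hK
  have r' : (fun x => ((x 1 : ℝ) : ℂ) * (bbTerm p.g ξ h 0 1 x - bbTerm p.g ξ h 1 0 x)
      - ((l : ℂ) * p.fac (proj x))⁻¹ * (1 / l * chargeDensity l a om η (proj x)))
      =o[farOn K] fun _ => (1 : ℝ) := by
    refine (r.trans_isBigO ?_).congr' ?_ EventuallyEq.rfl
    · refine IsBigO.of_bound 1 ?_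
      filter_upwards [farOn_le K eventually_far_pos] with x hx
      norm_num [hx.ne']
    · filter_upwards [farOn_le K eventually_far_pos] with x hx
      have hx' : (x 1 : ℂ) ≠ 0 := by exact_mod_cast hx.ne'
      simp [model, Complex.real_smul]
      field_simp
  rw [← isLittleO_one_iff ℝ]
  have b2' : (fun x => ((l : ℂ) * p.fac (proj x))⁻¹ * (1 / l * chargeDensity l a om η (proj x)))
      =O[farOn K] fun _ => (1 : ℝ) := by simpa using b2
  -- Writing the two factors as limit plus error, these are the products error·error, error·limit
  -- and limit·error.
  have t1 := ds.mul r'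
  have t2 := ds.mul_isBigO b2'
  have t3 := bm.mul_isLittleO r'
  simp only [one_mul] at t1 t2 t3
  refine ((t1.add t2).add t3).congr' ?_ EventuallyEq.rfl
  filter_upwards [farOn_le K eventually_far_pos] with x hx
  have hx' : (x 1 : ℂ) ≠ 0 := by exact_mod_cast hx.ne'
  have hl' : (l : ℂ) ≠ 0 := by exact_mod_cast hl.ne'
  have hf : (p.fac (proj x) : ℂ) ≠ 0 := by exact_mod_cast (p.fac_pos _).ne'
  push_cast
  field_simp
  ring

theorem proj_cons (τ r φ : ℝ) : proj ![τ, r, φ] = ![τ, φ] := by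
  funext A; fin_cases A <;> rfl

theorem continuous_circle (τ₀ : ℝ) : Continuous fun φ : ℝ => (![τ₀, φ] : Bdy) := by
  refine continuous_pi fun A => ?_
  fin_cases A
  · exact continuous_const
  · exact continuous_id

/-- Locally uniform convergence implies the convergence of the integrals over the circles. -/
theorem tendsto_integral_circle {F : Pt → ℂ} {v : Bdy → ℂ} (hF : ∀ᶠ x in far, ContinuousAt F x)
    (hv : Continuous v) (τ₀ : ℝ) (h : ∀ K : Set Bdy, IsCompact K →
      Tendsto (fun x => F x - v (proj x)) (farOn K) (𝓝 0)) :
    Tendsto (fun r : ℝ => ∫ φ in (0 : ℝ)..(2 * Real.pi), F ![τ₀, r, φ]) atTop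
      (𝓝 (∫ φ in (0 : ℝ)..(2 * Real.pi), v ![τ₀, φ])) := by
  have hπ := Real.pi_pos
  have hK : IsCompact ((fun φ : ℝ => (![τ₀, φ] : Bdy)) '' Set.Icc 0 (2 * Real.pi)) :=
    isCompact_Icc.image (continuous_circle τ₀)
  obtain ⟨R₀, hR₀⟩ := eventually_far.1 hF
  rw [Metric.tendsto_atTop]
  intro ε hε
  -- Times the length 2π of the circle this is ε/2, which leaves the strict inequality.
  have hδ : 0 < ε / (4 * Real.pi) := by positivity
  have h1 := (Metric.tendsto_nhds.1 (h _ hK)) _ hδ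
  obtain ⟨R, hR⟩ := eventually_farOn.1 h1
  refine ⟨max R R₀ + 1, fun r hr => ?_⟩
  have hr1 : R < r := by linarith [le_max_left R R₀]
  have hr2 : R₀ < r := by linarith [le_max_right R R₀]
  have cF : Continuous fun φ : ℝ => F ![τ₀, r, φ] := by
    refine continuous_iff_continuousAt.2 fun φ => ?_
    have hc : Continuous fun φ : ℝ => (![τ₀, r, φ] : Pt) := by
      refine continuous_pi fun A => ?_
      fin_cases A
      · exact continuous_const
      · exact continuous_const
      · exact continuous_id
    exact ContinuousAt.comp (f := fun φ : ℝ => (![τ₀, r, φ] : Pt)) (hR₀ _ hr2) hc.continuousAt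
  have cv : Continuous fun φ : ℝ => v ![τ₀, φ] := hv.comp (continuous_circle τ₀)
  rw [dist_eq_norm, ← intervalIntegral.integral_sub (cF.intervalIntegrable _ _)
    (cv.intervalIntegrable _ _)]
  refine (intervalIntegral.norm_integral_le_of_norm_le_const (C := ε / (4 * Real.pi))
    fun φ hφ => ?_).trans_lt ?_
  · rw [Set.uIoc_of_le (by positivity)] at hφ
    have := hR ![τ₀, r, φ] (by rw [proj_cons]; exact ⟨φ, ⟨hφ.1.le, hφ.2⟩, rfl⟩) hr1
    rw [dist_zero_right, proj_cons] at this
    exact this.le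
  · rw [sub_zero, abs_of_pos (by positivity)]
    have : ε / (4 * Real.pi) * (2 * Real.pi) = ε / 2 := by field_simp; norm_num
    linarith

/-- The limit of the Barnich-Brandt integral. -/
def chargeVariation (l G τ₀ : ℝ) (a : Param) (om : Bdy → ℂ) (η : Bdy → Matrix (Fin 2) (Fin 2) ℂ) :
    ℂ :=
  (1 / (16 * Real.pi * G * l) : ℝ) * ∫ φ in (0 : ℝ)..(2 * Real.pi), chargeDensity l a om η ![τ₀, φ]

/-- By antisymmetry of the form, half the difference of its τr and rτ components is the τr component
itself. The convergence of the density is uniform over the circle, so it passes to the integral. -/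
theorem tendsto_bbCircle (hl : 0 < l) (G τ₀ : ℝ) {h : Pt → Matrix (Fin 3) (Fin 3) ℂ}
    {om ηrr : Bdy → ℂ} {η : Bdy → Matrix (Fin 2) (Fin 2) ℂ} (hv : HasVariation p h om ηrr η)
    (hs : ∀ a b, FarSmooth (fun x => h x a b)) (hsym : ∀ a b, ∀ᶠ x in far, h x a b = h x b a)
    (hρ : LinearizedRho p om ηrr η)
    {a : Param} (ha : IsSymmetry a) {ξ : Pt → Fin 3 → ℂ} (hξ : IsGenerator p a ξ) :
    Tendsto (bbCircle p.g G τ₀ ξ h) atTop (𝓝 (chargeVariation l G τ₀ a om η)) := by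
  have H := hv.hasFieldCoeffs hl.ne' hs hsym ha hξ
  have hF : ∀ᶠ x in far, ContinuousAt (fun x => (Real.sqrt (-(p.g x).det) : ℂ) *
      (bbTerm p.g ξ h 0 1 x - bbTerm p.g ξ h 1 0 x)) x := by
    filter_upwards [p.exp_det.smooth, (H.bbTerm 0 1).smooth, (H.bbTerm 1 0).smooth] with x h1 h2 h3
    have h4 := h1.continuousAt
    exact (Complex.continuous_ofReal.continuousAt.comp
      (Real.continuous_sqrt.continuousAt.comp h4.neg)).mul (h2.continuousAt.sub h3.continuousAt)
  have t := tendsto_integral_circle hF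
    (continuous_const.mul (continuous_chargeDensity (l := l) ha hv.smooth_om hv.smooth_η)) τ₀
    fun K hK => tendsto_bbTerm hl hv hs hsym hρ ha hξ hK
  have t' := t.const_mul ((1 / (16 * Real.pi * G) : ℝ) : ℂ)
  have hl' : (l : ℂ) ≠ 0 := by exact_mod_cast hl.ne'
  have e : chargeVariation l G τ₀ a om η = ((1 / (16 * Real.pi * G) : ℝ) : ℂ) *
      ∫ φ in (0 : ℝ)..(2 * Real.pi), 1 / (l : ℂ) * chargeDensity l a om η ![τ₀, φ] := by
    rw [intervalIntegral.integral_const_mul, chargeVariation]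
    push_cast
    field_simp
  rw [e]
  refine t'.congr fun r => ?_
  rw [bbCircle, ← intervalIntegral.integral_const_mul]
  refine intervalIntegral.integral_congr fun φ _ => ?_
  simp only [bbForm]
  push_cast
  ring

end

end

section

open Asymptotics AdSCharges.Trunc

/-! ### The Lie derivative of the metric along an asymptotic symmetry -/

section

variable {l : ℝ} {p : PhasePoint l}

/-- The variation of the conformal factor. -/
def PhasePoint.lieConf (p : PhasePoint l) (a : Param) (y : Bdy) : ℂ :=
  ∑ D, a.1 y D * (pd D p.conf y : ℝ) + 1 / 2 * ∑ D, pd D (fun z => a.1 z D) y - 1 / 2 * a.2 y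

/-- The variation of `C_rr`. -/
def PhasePoint.lieRr (p : PhasePoint l) (a : Param) (X : Bdy → ℂ) (y : Bdy) : ℂ :=
  a.2 y * p.Crr y - 4 * l ^ 2 * X y + ∑ D, a.1 y D * (pd D p.Crr y : ℝ)

/-- The variation of `C_AB`. -/
def PhasePoint.lieC (p : PhasePoint l) (a : Param) (X : Bdy → ℂ) (y : Bdy) :
    Matrix (Fin 2) (Fin 2) ℂ := fun A B =>
  2 * p.fac y * flat A B * X y
    + ∑ D, (a.1 y D * (pd D (fun z => p.C z A B) y : ℝ)
      + p.C y D B * pd A (fun z => a.1 z D) y + p.C y A D * pd B (fun z => a.1 z D) y)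
    + ∑ D, (2 * p.fac y * (pd D p.conf y : ℝ) * flat A B * p.subY a.2 D y
      + p.fac y * flat D B * pd A (p.subY a.2 D) y + p.fac y * flat A D * pd B (p.subY a.2 D) y)

theorem IsSymmetry.smooth_pd_Y {a : Param} (ha : IsSymmetry a) (A D : Fin 2) :
    ContDiff ℝ ∞ (pd A fun z => a.1 z D) :=
  contDiff_pd A (ha.smooth_Y D)

theorem IsSymmetry.smooth_pd_ψ {a : Param} (ha : IsSymmetry a) (A : Fin 2) :
    ContDiff ℝ ∞ (pd A a.2) :=
  contDiff_pd A ha.smooth_ψ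

theorem PhasePoint.smooth_lieConf {a : Param} (ha : IsSymmetry a) : ContDiff ℝ ∞ (p.lieConf a) :=
  ((ContDiff.sum fun D _ => (ha.smooth_Y D).mul (smooth_ofReal (p.smooth_pd_conf D))).add
    (contDiff_const.mul (ContDiff.sum fun D _ => ha.smooth_pd_Y D D))).sub
    (contDiff_const.mul ha.smooth_ψ)

theorem PhasePoint.smooth_lieRr {a : Param} (ha : IsSymmetry a) {X : Bdy → ℂ}
    (hX : ContDiff ℝ ∞ X) : ContDiff ℝ ∞ (p.lieRr a X) :=
  ((ha.smooth_ψ.mul (smooth_ofReal p.smooth_Crr)).sub (contDiff_const.mul hX)).add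
    (ContDiff.sum fun D _ => (ha.smooth_Y D).mul (smooth_ofReal (contDiff_pd D p.smooth_Crr)))

theorem PhasePoint.smooth_lieC {a : Param} (ha : IsSymmetry a) {X : Bdy → ℂ}
    (hX : ContDiff ℝ ∞ X) (A B : Fin 2) : ContDiff ℝ ∞ (fun y => p.lieC a X y A B) := by
  have hf := smooth_ofReal p.smooth_fac
  have hZ := fun D => p.smooth_subY ha.smooth_ψ D
  refine ContDiff.add (ContDiff.add (((contDiff_const.mul hf).mul contDiff_const).mul hX)
    (ContDiff.sum fun D _ => ?_)) (ContDiff.sum fun D _ => ?_)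
  · exact (((ha.smooth_Y D).mul (smooth_ofReal (contDiff_pd D (p.smooth_C A B)))).add
      ((smooth_ofReal (p.smooth_C D B)).mul (ha.smooth_pd_Y A D))).add
      ((smooth_ofReal (p.smooth_C A D)).mul (ha.smooth_pd_Y B D))
  · exact (((((contDiff_const.mul hf).mul (smooth_ofReal (p.smooth_pd_conf D))).mul
      contDiff_const).mul (hZ D)).add ((hf.mul contDiff_const).mul (contDiff_pd A (hZ D)))).add
      ((hf.mul contDiff_const).mul (contDiff_pd B (hZ D)))

/-- The conformal Killing equation in components. -/
theorem IsSymmetry.ckv {a : Param} (ha : IsSymmetry a) (y : Bdy) :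
    pd 0 (fun z => a.1 z 0) y = pd 1 (fun z => a.1 z 1) y ∧
      pd 0 (fun z => a.1 z 1) y = pd 1 (fun z => a.1 z 0) y := by
  have h0 := ha.killing y 0 0
  have h1 := ha.killing y 0 1
  simp [Fin.sum_univ_two, flat] at h0 h1
  exact ⟨by linear_combination h0, by linear_combination h1⟩

/-- The wave equation in components. -/
theorem IsSymmetry.wave {a : Param} (ha : IsSymmetry a) (y : Bdy) :
    pd 1 (pd 1 a.2) y = pd 0 (pd 0 a.2) y := by
  have h := ha.harmonic y
  simp [Fin.sum_univ_two, flat] at h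
  linear_combination h

theorem PhasePoint.pd_subY {ψ : Bdy → ℂ} (hψ : ContDiff ℝ ∞ ψ) (A D : Fin 2) (y : Bdy) :
    pd A (p.subY ψ D) y = -((l : ℂ) ^ 2 / 4 * (p.fac y : ℂ)⁻¹ * flat D D *
      (pd A (pd D ψ) y - 2 * (pd A p.conf y : ℝ) * pd D ψ y)) := by
  have hf : p.fac y ≠ 0 := (p.fac_pos y).ne'
  have dψ : DifferentiableAt ℝ (pd D ψ) y := (contDiff_pd D hψ).differentiable (by simp) y
  have df : DifferentiableAt ℝ (fun y => (p.fac y)⁻¹) y :=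
    p.smooth_fac_inv.differentiable (by simp) y
  have dF : DifferentiableAt ℝ (fun y => (((p.fac y)⁻¹ : ℝ) : ℂ)) y :=
    (smooth_ofReal p.smooth_fac_inv).differentiable (by simp) y
  have e : p.subY ψ D = fun y => (-((l : ℂ) ^ 2 / 4 * flat D D)) *
      ((((p.fac y)⁻¹ : ℝ) : ℂ) * pd D ψ y) := by
    funext y
    fin_cases D <;> simp [PhasePoint.subY, flat, Fin.sum_univ_two] <;> ring
  rw [e, pd_mul (g := fun y => (((p.fac y)⁻¹ : ℝ) : ℂ) * pd D ψ y) A (differentiableAt_const _)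
    (dF.mul dψ), pd_const, pd_mul A dF dψ,
    pd_ofReal A df, pd_inv A (p.differentiable_fac y) hf, p.pd_fac]
  have hf' : (p.fac y : ℂ) ≠ 0 := by exact_mod_cast hf
  push_cast
  field_simp
  ring

/-- δρ = Y·∂ρ + ψρ - (l²/2) e^{-2φ}(∂_φ² - ∂_τ²)ψ: the first two terms vanish by ρ = 0, the last by
harmonicity. X cancels between the trace of δC_AB and δC_rr. -/
theorem linearizedRho_lie (hl : l ≠ 0) {a : Param} (ha : IsSymmetry a) (X : Bdy → ℂ) :
    LinearizedRho p (p.lieConf a) (p.lieRr a X) (p.lieC a X) := by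
  intro y
  have hl' : (l : ℂ) ≠ 0 := by exact_mod_cast hl
  have hf : (p.fac y : ℂ) ≠ 0 := by exact_mod_cast (p.fac_pos y).ne'
  obtain ⟨k1, k2⟩ := ha.ckv y
  have w := ha.wave y
  have r := congrArg Complex.ofReal (p.rho_eq y)
  have r0 := congrArg Complex.ofReal (p.pd_rho_eq 0 y)
  have r1 := congrArg Complex.ofReal (p.pd_rho_eq 1 y)
  have s : p.C y 1 0 = p.C y 0 1 := (p.symm_C y).apply 0 1
  push_cast at r r0 r1
  simp only [PhasePoint.lieConf, PhasePoint.lieRr, PhasePoint.lieC, Fin.sum_univ_two, p.exp_neg,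
    p.pd_subY ha.smooth_ψ, k1, k2, s, flat]
  simp [PhasePoint.subY, Fin.sum_univ_two, flat]
  linear_combination (norm := (field_simp; ring)) a.1 y 0 * r0 + a.1 y 1 * r1 + a.2 y * r
    - l ^ 2 / 2 * (p.fac y : ℂ)⁻¹ * w
/-! #### Expansions -/

theorem PhasePoint.exp_pd_g (a b c : Fin 3) : HasExp 1 (nG a b + dw c)
    (fun x => ((pd c (fun y => p.g y a b) x : ℝ) : ℂ))
    (fun x => (dT c (nG a b) (p.gT a b) x).map Complex.ofReal) :=
  ((p.exp_g a b).pd c).ofReal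

theorem PhasePoint.exp_g_ofReal (a b : Fin 3) : HasExp 2 (nG a b) (fun x => (p.g x a b : ℂ))
    (fun x => (p.gT a b x).map Complex.ofReal) :=
  (p.exp_g a b).ofReal

theorem farSmooth_lieMetric {a : Param} {ξ : Pt → Fin 3 → ℂ} (hξ : IsGenerator p a ξ) (i j : Fin 3) :
    FarSmooth (fun x => lieMetric p.g ξ x i j) := by
  have h : ∀ c, FarSmooth (fun x => ξ x c * ((pd c (fun y => p.g y i j) x : ℝ) : ℂ)
      + (p.g x c j : ℂ) * pd i (fun y => ξ y c) x + (p.g x i c : ℂ) * pd j (fun y => ξ y c) x) :=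
    fun c => (((hξ.farSmooth c).mul ((p.farSmooth_g i j).pd c).ofReal).add
      ((p.farSmooth_g c j).ofReal.mul ((hξ.farSmooth c).pd i))).add
      ((p.farSmooth_g i c).ofReal.mul ((hξ.farSmooth c).pd j))
  simp only [lieMetric, Fin.sum_univ_three]
  exact ((h 0).add (h 1)).add (h 2)

theorem lieMetric_symm (ξ : Pt → Fin 3 → ℂ) (i j : Fin 3) :
    ∀ᶠ x in far, lieMetric p.g ξ x i j = lieMetric p.g ξ x j i := by
  have h : ∀ᶠ x in far, ∀ a b, p.g x a b = p.g x b a := by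
    filter_upwards [p.far_mem] with x hx a b using (p.symm_g x hx).apply b a
  filter_upwards [h, eventually_far_nhds h] with x h1 h2
  simp only [lieMetric]
  refine Finset.sum_congr rfl fun c _ => ?_
  rw [pd_congr (g := fun y => p.g y j i) c (h2.mono fun y hy => hy i j), h1 c j, h1 i c]
  ring


theorem IsSymmetry.differentiable_Y {a : Param} (ha : IsSymmetry a) (A : Fin 2) :
    Differentiable ℝ (fun y => a.1 y A) :=
  (ha.smooth_Y A).differentiable (by simp)

/-- The form dr/r is invariant under scalings of r, so the leading part -½ψ r of ξ^r leaves the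
r^(-2) term of g_rr unchanged. -/
theorem exp_lie_rr {a : Param} (ha : IsSymmetry a) {ξ : Pt → Fin 3 → ℂ} {X : Bdy → ℂ}
    (hX : ContDiff ℝ ∞ X) (e : ∀ c, HasExp 2 (nV c) (fun x => ξ x c) (p.genT a X c)) :
    HasExp 1 (-2) (fun x => lieMetric p.g ξ x 1 1) (fun x => ⟨0, 0, p.lieRr a X (proj x)⟩) := by
  have t : ∀ c, HasExp 1 (-2) (fun x => ξ x c * ((pd c (fun y => p.g y 1 1) x : ℝ) : ℂ)
      + (p.g x c 1 : ℂ) * pd 1 (fun y => ξ y c) x + (p.g x 1 c : ℂ) * pd 1 (fun y => ξ y c) x) _ :=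
    fun c => ((((e c).of_succ.mul (p.exp_pd_g 1 1 c)).cast (by revert c; decide)).add
      (((p.exp_g_ofReal c 1).of_succ.mul ((e c).pd 1)).cast (by revert c; decide))).add
      (((p.exp_g_ofReal 1 c).of_succ.mul ((e c).pd 1)).cast (by revert c; decide))
  refine (HasExp.sum Finset.univ fun c _ => t c).congr_coeff (.of_forall fun x => ?_)
  have dψ : Differentiable ℝ (fun y => (2 : ℂ)⁻¹ * a.2 y) :=
    (contDiff_const.mul ha.smooth_ψ).differentiable (by simp)
  have dX := hX.differentiable (by simp)
  have dr := p.differentiable_Crr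
  have hY := ha.differentiable_Y
  ext <;> simp [Fin.sum_univ_three, nV, nG, wt, par, dT, pdT, pdr, PhasePoint.genT,
    PhasePoint.gT, Trunc.map, pd_proj_one dψ, pd_proj_one dX, pd_proj_zero dr, pd_proj_one dr,
    pd_proj_two dr, pd_proj_one (hY _), pd_const, pd_neg, PhasePoint.lieRr, Fin.sum_univ_two]
  all_goals ring

/-- The conformal Killing equation makes the r² part a multiple of the boundary metric, so that it
is a mere change of φ. -/
theorem exp_lie_AB {a : Param} (ha : IsSymmetry a) {ξ : Pt → Fin 3 → ℂ} {X : Bdy → ℂ}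
    (e : ∀ c, HasExp 2 (nV c) (fun x => ξ x c) (p.genT a X c)) (A B : Fin 2) :
    HasExp 1 2 (fun x => lieMetric p.g ξ x (bIdx A) (bIdx B))
      (fun x => ⟨2 * p.lieConf a (proj x) * p.fac (proj x) * flat A B, 0,
        p.lieC a X (proj x) A B⟩) := by
  have t : ∀ i j : Fin 3, i ≠ 1 → j ≠ 1 → ∀ c, HasExp 1 2
      (fun x => ξ x c * ((pd c (fun y => p.g y i j) x : ℝ) : ℂ)
      + (p.g x c j : ℂ) * pd i (fun y => ξ y c) x + (p.g x i c : ℂ) * pd j (fun y => ξ y c) x) _ :=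
    fun i j hi hj c => ((((e c).of_succ.mul (p.exp_pd_g i j c)).cast
      (by revert hi hj; revert i j c; decide)).add
      (((p.exp_g_ofReal c j).of_succ.mul_raise ((e c).pd i)
        (by revert hi hj; revert i j c; decide)))).add
      (((p.exp_g_ofReal i c).of_succ.mul_raise ((e c).pd j)
        (by revert hi hj; revert i j c; decide)))
  have hi : ∀ A, bIdx A ≠ 1 := by decide
  refine (HasExp.sum Finset.univ fun c _ => t _ _ (hi A) (hi B) c).congr_coeff
    (.of_forall fun x => ?_)
  have dψ : Differentiable ℝ (fun y => (2 : ℂ)⁻¹ * a.2 y) :=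
    (contDiff_const.mul ha.smooth_ψ).differentiable (by simp)
  have df := p.differentiable_fac
  have dC := p.differentiable_C
  have hY := ha.differentiable_Y
  have hZ : ∀ A, Differentiable ℝ (p.subY a.2 A) :=
    fun A => (p.smooth_subY ha.smooth_ψ A).differentiable (by simp)
  obtain ⟨k1, k2⟩ := ha.ckv (proj x)
  have s : ∀ y, p.C y 1 0 = p.C y 0 1 := fun y => (p.symm_C y).apply 0 1
  fin_cases A <;> fin_cases B <;> ext <;>
    simp [Fin.sum_univ_three, nV, nG, wt, par, bIdx, dw, dT, pdT, pdr, Trunc.raise, shift,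
      PhasePoint.genT, PhasePoint.gT, Trunc.map, pd_proj_zero df, pd_proj_one df, pd_proj_two df,
      pd_proj_zero (dC _ _), pd_proj_one (dC _ _), pd_proj_two (dC _ _), pd_proj_zero (hY _),
      pd_proj_two (hY _), pd_proj_zero (hZ _), pd_proj_two (hZ _), pd_const, pd_neg,
      PhasePoint.pd_fac, PhasePoint.lieConf, PhasePoint.lieC, Fin.sum_univ_two, flat, s] <;>
    (try simp only [k1, k2]) <;> (try ring)

/-- In the mixed components ∂_r ξ^A is multiplied by g_AB ~ r², so two more orders are required than
the expansion of ξ^A at weight 0 offers. The O(r^(-4)) condition supplies them once Y^A, which ∂_r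
kills, is split off. -/
theorem IsGenerator.exp_pd_one {a : Param} (ha : IsSymmetry a) {ξ : Pt → Fin 3 → ℂ}
    (h : IsGenerator p a ξ) (A : Fin 2) : ∃ ζ : Pt → ℂ,
      HasExp 1 (-3) (pd 1 (fun x => ξ x (bIdx A))) (fun x => ⟨-2 * p.subY a.2 A (proj x), 0, ζ x⟩) := by
  have sY := farSmooth_proj (ha.smooth_Y A)
  have sZ := farSmooth_proj (p.smooth_subY ha.smooth_ψ A)
  have hξ := h.farSmooth (bIdx A)
  have e1 := HasExp.of_bigO (k := 2) (n := -2) (f := fun x => ξ x (bIdx A) - a.1 (proj x) A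
      - (x 1) ^ (-2 : ℤ) • p.subY a.2 A (proj x))
      ((hξ.sub sY).sub ((farSmooth_zpow _).smul sZ)) <| by
    refine (h.expand_A A).congr (.of_forall fun x => ?_)
    simp only [PhasePoint.subY, p.exp_neg, ofReal_zpow_eq, Complex.real_smul]
    ring
  have e2 : HasExp 2 (-2) (fun x => (x 1) ^ (-2 : ℤ) • p.subY a.2 A (proj x))
      (fun x => ⟨p.subY a.2 A (proj x), 0, 0⟩) := by
    refine HasExp.of_littleO ((farSmooth_zpow _).smul sZ) ⟨sZ, farSmooth_const _, farSmooth_const _⟩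
      ⟨bigO_proj (p.smooth_subY ha.smooth_ψ A), bigO_const _, bigO_const _⟩ ?_
    simpa [model] using LittleO.of_zero (E := ℂ) 2 (-2 - 2)
  have dZ := (p.smooth_subY ha.smooth_ψ A).differentiable (by simp)
  obtain ⟨T, hT, e3⟩ : ∃ T : Pt → Trunc ℂ, (∀ x, (T x).c0 = -2 * p.subY a.2 A (proj x) ∧
      (T x).c1 = 0) ∧ HasExp 1 (-3) (pd 1 fun x => ξ x (bIdx A) - a.1 (proj x) A
        - (x 1) ^ (-2 : ℤ) • p.subY a.2 A (proj x) + (x 1) ^ (-2 : ℤ) • p.subY a.2 A (proj x)) T :=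
    ⟨_, fun x => by simp [pdr, pd_proj_one dZ, pd_const], (e1.add e2).pd_one.cast (m := -3) rfl⟩
  refine ⟨fun x => (T x).c2, e3.congr ?_ (.of_forall fun x => Trunc.ext (hT x).1 (hT x).2 rfl)⟩
  filter_upwards [hξ.differentiable] with x hx
  have e : (fun x => ξ x (bIdx A) - a.1 (proj x) A - (x 1) ^ (-2 : ℤ) • p.subY a.2 A (proj x)
      + (x 1) ^ (-2 : ℤ) • p.subY a.2 A (proj x)) = fun x => ξ x (bIdx A) - a.1 (proj x) A := by
    funext x; ring
  rw [e, pd_sub (g := fun x => a.1 (proj x) A) 1 hx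
    ((ha.differentiable_Y A).comp (contDiff_proj.differentiable (by simp)) x),
    pd_proj_one (ha.differentiable_Y A), sub_zero]

/-- At order r^(-1) the terms g_rr ∂_A ξ^r and g_AB ∂_r ξ^B are -(l²/2) ∂_A ψ and +(l²/2) ∂_A ψ;
this cancellation dictates the coefficient l²/4 in ξ^A. -/
theorem bigO_lie_rA {a : Param} (ha : IsSymmetry a) {ξ : Pt → Fin 3 → ℂ} {X : Bdy → ℂ}
    (hξ : IsGenerator p a ξ) (e : ∀ c, HasExp 2 (nV c) (fun x => ξ x c) (p.genT a X c))
    (B : Fin 2) : BigO 1 (fun x => lieMetric p.g ξ x 1 (bIdx B)) (-3) := by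
  have w1 : ∀ c, nV c + (nG 1 (bIdx B) + dw c) = -1 := by revert B; decide
  have w2 : ∀ c, nG 1 c + (nV c + dw (bIdx B)) = -1 := by revert B; decide
  have w3 : nG 1 (bIdx B) + (nV 1 + dw 1) = -1 := by revert B; decide
  have w4 : ∀ C, nG (bIdx C) (bIdx B) + -3 = -1 := by revert B; decide
  choose ζ hζ using hξ.exp_pd_one ha
  have t1 : ∀ c, HasExp 1 (-1) (fun x => ξ x c * ((pd c (fun y => p.g y 1 (bIdx B)) x : ℝ) : ℂ)) _ :=
    fun c => ((e c).of_succ.mul (p.exp_pd_g 1 (bIdx B) c)).cast (w1 c)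
  have t2 : ∀ c, HasExp 1 (-1) (fun x => (p.g x 1 c : ℂ) * pd (bIdx B) (fun y => ξ y c) x) _ :=
    fun c => ((p.exp_g_ofReal 1 c).of_succ.mul ((e c).pd (bIdx B))).cast (w2 c)
  have t3 := ((p.exp_g_ofReal 1 (bIdx B)).of_succ.mul ((e 1).pd 1)).cast w3
  have t4 : ∀ C, HasExp 1 (-1) (fun x => (p.g x (bIdx C) (bIdx B) : ℂ) * pd 1 (fun y => ξ y (bIdx C)) x) _ :=
    fun C => ((p.exp_g_ofReal (bIdx C) (bIdx B)).of_succ.mul (hζ C)).cast (w4 C)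
  -- The summands are ordered as in the expanded Lie derivative, so that the two functions agree
  -- definitionally.
  have t := ((((t1 0).add (t4 0)).add (t2 0)).add (((t1 1).add t3).add (t2 1))).add
    (((t1 2).add (t4 1)).add (t2 2))
  have dψ : Differentiable ℝ (fun y => (2 : ℂ)⁻¹ * a.2 y) :=
    (contDiff_const.mul ha.smooth_ψ).differentiable (by simp)
  have dψ' : ∀ A y, pd A (fun y => (2 : ℂ)⁻¹ * a.2 y) y = 2⁻¹ * pd A a.2 y := by
    intro A y
    rw [pd_mul A (differentiableAt_const _) (ha.smooth_ψ.differentiable (by simp) y), pd_const]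
    simp
  refine (t.bigO (.of_forall fun x => ?_)).congr (.of_forall fun x => ?_)
  · have hf : (p.fac (proj x) : ℂ) ≠ 0 := by exact_mod_cast (p.fac_pos _).ne'
    fin_cases B <;> constructor <;>
      simp [nV, nG, wt, par, bIdx, dT, pdT, pdr, PhasePoint.genT, PhasePoint.gT, Trunc.map,
        pd_proj_one dψ, pd_proj_zero dψ, pd_proj_two dψ, pd_const, pd_neg, dψ', PhasePoint.subY,
        Fin.sum_univ_two, flat] <;>
      field_simp <;> ring
  · simp only [lieMetric, Fin.sum_univ_three]
    rfl

/-- The Lie derivative of the metric along an asymptotic symmetry is a variation within the phase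
space. -/
theorem IsGenerator.hasVariation_lie {a : Param} (ha : IsSymmetry a) {ξ : Pt → Fin 3 → ℂ}
    (hξ : IsGenerator p a ξ) : ∃ X : Bdy → ℂ, ContDiff ℝ ∞ X ∧
      HasVariation p (lieMetric p.g ξ) (p.lieConf a) (p.lieRr a X) (p.lieC a X) := by
  obtain ⟨X, hX, e⟩ := hξ.exp ha
  refine ⟨X, hX, p.smooth_lieConf ha, p.smooth_lieRr ha hX, p.smooth_lieC ha hX, ?_,
    bigO_lie_rA ha hξ e, fun A B => ?_⟩
  · refine (exp_lie_rr ha hX e).littleO.congr (.of_forall fun x => ?_)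
    simp [model, Complex.real_smul]
    ring
  · refine (exp_lie_AB ha e A B).littleO.congr (.of_forall fun x => ?_)
    simp [model, Complex.real_smul, PhasePoint.fac]
    ring

theorem IsGenerator.isTangent_lie (hl : l ≠ 0) {a : Param} (ha : IsSymmetry a)
    {ξ : Pt → Fin 3 → ℂ} (hξ : IsGenerator p a ξ) : IsTangent p (lieMetric p.g ξ) :=
  let ⟨X, _, h⟩ := hξ.hasVariation_lie ha
  ⟨_, _, _, h, linearizedRho_lie hl ha X⟩

/-! ### Periodicity and the construction of asymptotic symmetries -/

theorem pd_periodic {n : ℕ} {f : (Fin n → ℝ) → ℂ} {v : Fin n → ℝ} (h : ∀ y, f (y + v) = f y)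
    (i : Fin n) (y : Fin n → ℝ) : pd i f (y + v) = pd i f y := by
  have : (fun y => f (y + v)) = f := funext h
  rw [pd, ← fderiv_comp_add_right, this]
  rfl

theorem proj_add_single (x : Pt) (c : ℝ) :
    proj (x + Pi.single 2 c) = proj x + Pi.single 1 c := by
  funext A; fin_cases A <;> simp [proj, bIdx]

theorem PhasePoint.periodic_subY (p : PhasePoint l) {a : Param} (ha : IsSymmetry a) (A : Fin 2)
    (y : Bdy) : p.subY a.2 A (y + Pi.single 1 (2 * Real.pi)) = p.subY a.2 A y := by
  simp only [PhasePoint.subY, PhasePoint.fac, p.periodic_conf, pd_periodic ha.periodic_ψ]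

/-- Existence of asymptotic symmetries. -/
theorem IsSymmetry.exists_generator (p : PhasePoint l) {a : Param} (ha : IsSymmetry a) :
    ∃ ξ, IsGenerator p a ξ := by
  -- The prescribed terms alone, with X = 0 and no remainder.
  refine ⟨fun x => ![a.1 (proj x) 0 + (x 1 : ℂ) ^ (-2 : ℤ) * p.subY a.2 0 (proj x),
    -(1 / 2 * a.2 (proj x) * (x 1 : ℂ)),
    a.1 (proj x) 1 + (x 1 : ℂ) ^ (-2 : ℤ) * p.subY a.2 1 (proj x)], ⟨0, fun c x hx => ?_⟩,
    ⟨0, fun x _ => ?_⟩, ⟨0, contDiff_const, ?_⟩, fun A => ?_⟩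
  · have hx0 : x 1 ≠ 0 := (show (0 : ℝ) < x 1 from hx).ne'
    have h1 : ContDiffAt ℝ ∞ (fun x : Pt => (x 1 : ℂ)) x :=
      Complex.ofRealCLM.contDiff.contDiffAt.comp x (by fun_prop)
    have hz : ContDiffAt ℝ ∞ (fun x : Pt => (x 1 : ℂ) ^ (-2 : ℤ)) x := by
      have : (fun x : Pt => (x 1 : ℂ) ^ (-2 : ℤ)) = fun x : Pt => ((x 1 : ℂ) ^ 2)⁻¹ := by
        funext y; rw [zpow_neg]; norm_cast
      rw [this]
      exact (h1.pow 2).inv (pow_ne_zero 2 (by exact_mod_cast hx0))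
    have hY : ∀ A, ContDiffAt ℝ ∞ (fun x => a.1 (proj x) A) x :=
      fun A => ((ha.smooth_Y A).comp contDiff_proj).contDiffAt
    have hZ : ∀ A, ContDiffAt ℝ ∞ (fun x => p.subY a.2 A (proj x)) x :=
      fun A => ((p.smooth_subY ha.smooth_ψ A).comp contDiff_proj).contDiffAt
    have hψ : ContDiffAt ℝ ∞ (fun x => a.2 (proj x)) x :=
      (ha.smooth_ψ.comp contDiff_proj).contDiffAt
    refine ContDiffAt.contDiffWithinAt ?_
    fin_cases c
    · exact (hY 0).add (hz.mul (hZ 0))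
    · exact ((contDiffAt_const.mul hψ).mul h1).neg
    · exact (hY 1).add (hz.mul (hZ 1))
  · simp only [proj_add_single, ha.periodic_Y, ha.periodic_ψ, p.periodic_subY ha]
    simp
  · convert LittleO.of_zero (E := ℂ) 2 (-1) using 2 with x
    simp
  · convert BigO.of_zero (E := ℂ) 2 (-4) using 2 with x
    fin_cases A <;> simp [bIdx, PhasePoint.subY, ← p.exp_neg] <;> ring

end

end

section

open Asymptotics

/-! ### The bracket on shell -/

theorem pd_comm {n : ℕ} {E : Type*} [NormedAddCommGroup E] [NormedSpace ℝ E]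
    {f : (Fin n → ℝ) → E} (hf : ContDiff ℝ ∞ f) (i j : Fin n) (y : Fin n → ℝ) :
    pd i (pd j f) y = pd j (pd i f) y := by
  have h : IsSymmSndFDerivAt ℝ f y := hf.contDiffAt.isSymmSndFDerivAt <| by
    simp only [minSmoothness_of_isRCLikeNormedField]
    exact WithTop.coe_le_coe.2 (le_top : (2 : ℕ∞) ≤ ⊤)
  have hd : DifferentiableAt ℝ (fderiv ℝ f) y :=
    (hf.fderiv_right (m := ∞) (by simp)).differentiable (by simp) y
  have key : ∀ i j : Fin n, pd i (pd j f) y = fderiv ℝ (fderiv ℝ f) y (Pi.single i 1) (Pi.single j 1) := by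
    intro i j
    have := hd.hasFDerivAt.clm_apply (hasFDerivAt_const (Pi.single j (1 : ℝ)) y)
    have e : pd j f = fun y => fderiv ℝ f y (Pi.single j 1) := rfl
    rw [e, pd, this.fderiv]
    simp
  rw [key, key, h.eq]

/-- The algebraic identity behind the representation of the charges: `Y0, Y1` and `V0, V1` are the
components of conformal Killing vectors, `ψ1`, `ψ2` and `Φ` are harmonic, and `T = Ξ_00`,
`S = Ξ_01` are the components of a conserved traceless tensor. -/
theorem bracket_density {Y0 Y1 V0 V1 ψ1 ψ2 Φ S T : Bdy → ℂ}
    (sY0 : ContDiff ℝ ∞ Y0) (sY1 : ContDiff ℝ ∞ Y1) (sV0 : ContDiff ℝ ∞ V0)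
    (sV1 : ContDiff ℝ ∞ V1) (s1 : ContDiff ℝ ∞ ψ1) (s2 : ContDiff ℝ ∞ ψ2) (sΦ : ContDiff ℝ ∞ Φ)
    (sS : ContDiff ℝ ∞ S) (sT : ContDiff ℝ ∞ T)
    (kY : ∀ y, pd 0 Y0 y = pd 1 Y1 y) (kY' : ∀ y, pd 0 Y1 y = pd 1 Y0 y)
    (kV : ∀ y, pd 0 V0 y = pd 1 V1 y) (kV' : ∀ y, pd 0 V1 y = pd 1 V0 y)
    (w1 : ∀ y, pd 1 (pd 1 ψ1) y = pd 0 (pd 0 ψ1) y) (w2 : ∀ y, pd 1 (pd 1 ψ2) y = pd 0 (pd 0 ψ2) y)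
    (wΦ : ∀ y, pd 1 (pd 1 Φ) y = pd 0 (pd 0 Φ) y) (cT : ∀ y, pd 0 T y = pd 1 S y)
    (cS : ∀ y, pd 1 T y = pd 0 S y) (L : ℂ) (y : Bdy) :
    L * (ψ1 y * pd 0 (fun y => V0 y * pd 0 Φ y + V1 y * pd 1 Φ y
          + 1 / 2 * (pd 0 V0 y + pd 1 V1 y) - 1 / 2 * ψ2 y) y
        - pd 0 ψ1 y * (V0 y * pd 0 Φ y + V1 y * pd 1 Φ y
          + 1 / 2 * (pd 0 V0 y + pd 1 V1 y) - 1 / 2 * ψ2 y))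
      + 2 * (Y0 y * (V0 y * pd 0 T y + V1 y * pd 1 T y + 2 * pd 1 V1 y * T y + 2 * pd 1 V0 y * S y
            - L / 2 * (pd 0 (pd 0 ψ2) y - pd 0 Φ y * pd 0 ψ2 y - pd 1 Φ y * pd 1 ψ2 y))
        + Y1 y * (V0 y * pd 0 S y + V1 y * pd 1 S y + 2 * pd 1 V1 y * S y + 2 * pd 1 V0 y * T y
            - L / 2 * (pd 1 (pd 0 ψ2) y - pd 0 Φ y * pd 1 ψ2 y - pd 1 Φ y * pd 0 ψ2 y)))
    = L * ((Y0 y * pd 0 ψ2 y + Y1 y * pd 1 ψ2 y - (V0 y * pd 0 ψ1 y + V1 y * pd 1 ψ1 y)) * pd 0 Φ y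
        - pd 0 (fun y => Y0 y * pd 0 ψ2 y + Y1 y * pd 1 ψ2 y
          - (V0 y * pd 0 ψ1 y + V1 y * pd 1 ψ1 y)) y * Φ y)
      + 2 * ((Y0 y * pd 0 V0 y + Y1 y * pd 1 V0 y - (V0 y * pd 0 Y0 y + V1 y * pd 1 Y0 y)) * T y
        + (Y0 y * pd 0 V1 y + Y1 y * pd 1 V1 y - (V0 y * pd 0 Y1 y + V1 y * pd 1 Y1 y)) * S y)
      + (L * (ψ1 y * pd 0 (fun y => 1 / 2 * (pd 0 V0 y + pd 1 V1 y) - 1 / 2 * ψ2 y) y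
          - pd 0 ψ1 y * (1 / 2 * (pd 0 V0 y + pd 1 V1 y) - 1 / 2 * ψ2 y))
        - L * (Y0 y * pd 0 (pd 0 ψ2) y + Y1 y * pd 1 (pd 0 ψ2) y))
      + pd 1 (fun y => 2 * ((Y0 y * V0 y + Y1 y * V1 y) * S y + (Y0 y * V1 y + Y1 y * V0 y) * T y)
        + L * (ψ1 y * (V0 y * pd 1 Φ y + V1 y * pd 0 Φ y)
          + Φ y * (Y0 y * pd 1 ψ2 y + Y1 y * pd 0 ψ2 y - (V0 y * pd 1 ψ1 y + V1 y * pd 0 ψ1 y)))) y := by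
  have D : ∀ {f : Bdy → ℂ}, ContDiff ℝ ∞ f → Differentiable ℝ f := fun h => h.differentiable (by simp)
  have dY0 := D sY0
  have dY1 := D sY1
  have dV0 := D sV0
  have dV1 := D sV1
  have d1 := D s1
  have d2 := D s2
  have dΦ := D sΦ
  have dS := D sS
  have dT := D sT
  have dV00 := D (contDiff_pd 0 sV0)
  have dV11 := D (contDiff_pd 1 sV1)
  have dψ10 := D (contDiff_pd 0 s1)
  have dψ11 := D (contDiff_pd 1 s1)
  have dψ20 := D (contDiff_pd 0 s2)
  have dψ21 := D (contDiff_pd 1 s2)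
  have dΦ0 := D (contDiff_pd 0 sΦ)
  have dΦ1 := D (contDiff_pd 1 sΦ)
  -- Each differential equation is oriented to eliminate one kind of derivative, and mixed second
  -- derivatives are put in one order; a polynomial identity remains.
  simp (disch := fun_prop) only [pd_add, pd_sub, pd_mul, pd_const, kY, kY', kV, kV', w1, w2, wΦ, cT,
    cS, pd_comm s1 0 1, pd_comm s2 0 1, pd_comm sΦ 0 1]
  ring

/-- The total derivative in the antisymmetrization of the central term. -/
theorem central_density {Y0 Y1 V0 V1 ψ1 ψ2 : Bdy → ℂ}
    (sY0 : ContDiff ℝ ∞ Y0) (sY1 : ContDiff ℝ ∞ Y1) (sV0 : ContDiff ℝ ∞ V0)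
    (sV1 : ContDiff ℝ ∞ V1) (s1 : ContDiff ℝ ∞ ψ1) (s2 : ContDiff ℝ ∞ ψ2)
    (kY : ∀ y, pd 0 Y0 y = pd 1 Y1 y) (kY' : ∀ y, pd 0 Y1 y = pd 1 Y0 y)
    (kV : ∀ y, pd 0 V0 y = pd 1 V1 y) (kV' : ∀ y, pd 0 V1 y = pd 1 V0 y)
    (w1 : ∀ y, pd 1 (pd 1 ψ1) y = pd 0 (pd 0 ψ1) y) (w2 : ∀ y, pd 1 (pd 1 ψ2) y = pd 0 (pd 0 ψ2) y)
    (L : ℂ) (y : Bdy) :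
    (L * (ψ1 y * pd 0 (fun y => 1 / 2 * (pd 0 V0 y + pd 1 V1 y) - 1 / 2 * ψ2 y) y
          - pd 0 ψ1 y * (1 / 2 * (pd 0 V0 y + pd 1 V1 y) - 1 / 2 * ψ2 y))
        - L * (Y0 y * pd 0 (pd 0 ψ2) y + Y1 y * pd 1 (pd 0 ψ2) y))
      + (L * (ψ2 y * pd 0 (fun y => 1 / 2 * (pd 0 Y0 y + pd 1 Y1 y) - 1 / 2 * ψ1 y) y
          - pd 0 ψ2 y * (1 / 2 * (pd 0 Y0 y + pd 1 Y1 y) - 1 / 2 * ψ1 y))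
        - L * (V0 y * pd 0 (pd 0 ψ1) y + V1 y * pd 1 (pd 0 ψ1) y))
    = pd 1 (fun y => L * (ψ2 y * pd 1 Y0 y + ψ1 y * pd 1 V0 y
        - (V0 y * pd 1 ψ1 y + V1 y * pd 0 ψ1 y) - (Y0 y * pd 1 ψ2 y + Y1 y * pd 0 ψ2 y))) y := by
  have D : ∀ {f : Bdy → ℂ}, ContDiff ℝ ∞ f → Differentiable ℝ f := fun h => h.differentiable (by simp)
  have dY0 := D sY0
  have dY1 := D sY1
  have dV0 := D sV0
  have dV1 := D sV1
  have d1 := D s1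
  have d2 := D s2
  have dV00 := D (contDiff_pd 0 sV0)
  have dV01 := D (contDiff_pd 1 sV0)
  have dV11 := D (contDiff_pd 1 sV1)
  have dY00 := D (contDiff_pd 0 sY0)
  have dY01 := D (contDiff_pd 1 sY0)
  have dY11 := D (contDiff_pd 1 sY1)
  have dψ10 := D (contDiff_pd 0 s1)
  have dψ11 := D (contDiff_pd 1 s1)
  have dψ20 := D (contDiff_pd 0 s2)
  have dψ21 := D (contDiff_pd 1 s2)
  have eY : pd 0 Y0 = pd 1 Y1 := funext kY
  have eV : pd 0 V0 = pd 1 V1 := funext kV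
  have eY' : pd 1 Y0 = pd 0 Y1 := funext fun y => (kY' y).symm
  have eV' : pd 1 V0 = pd 0 V1 := funext fun y => (kV' y).symm
  simp (disch := fun_prop) only [pd_add, pd_sub, pd_mul, pd_const, w1, w2,
    eY, eV]
  -- The second derivatives of Y and V match through ∂_φ∂_φ Y^τ = ∂_φ∂_τ Y^φ = ∂_τ∂_φ Y^φ.
  rw [eY', eV', pd_comm sY1 1 0, pd_comm sV1 1 0]
  ring

theorem add_circle (τ₀ : ℝ) :
    (![τ₀, 2 * Real.pi] : Bdy) = ![τ₀, 0] + Pi.single 1 (2 * Real.pi) := by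
  funext A; fin_cases A <;> simp

theorem hasDerivAt_circle {B : Bdy → ℂ} (hB : Differentiable ℝ B) (τ₀ φ : ℝ) :
    HasDerivAt (fun φ : ℝ => B ![τ₀, φ]) (pd 1 B ![τ₀, φ]) φ := by
  have h : HasDerivAt (fun φ : ℝ => (![τ₀, φ] : Bdy)) (Pi.single 1 1) φ := by
    rw [hasDerivAt_pi]
    intro A
    fin_cases A
    · simpa using hasDerivAt_const φ τ₀
    · exact hasDerivAt_id' φ
  exact (hB ![τ₀, φ]).hasFDerivAt.comp_hasDerivAt φ h

theorem integral_pd_one {B : Bdy → ℂ} (hB : ContDiff ℝ ∞ B)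
    (hp : ∀ y, B (y + Pi.single 1 (2 * Real.pi)) = B y) (τ₀ : ℝ) :
    ∫ φ in (0 : ℝ)..(2 * Real.pi), pd 1 B ![τ₀, φ] = 0 := by
  rw [intervalIntegral.integral_eq_sub_of_hasDerivAt
    (fun φ _ => hasDerivAt_circle (hB.differentiable (by simp)) τ₀ φ)
    (((contDiff_pd 1 hB).continuous.comp (continuous_circle τ₀)).intervalIntegrable _ _),
    add_circle, hp, sub_self]

/-- The commutator of symmetry parameters. -/
def bracketParam (a b : Param) : Param :=
  (fun y A => ∑ D, a.1 y D * pd D (fun z => b.1 z A) y - ∑ D, b.1 y D * pd D (fun z => a.1 z A) y,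
    fun y => ∑ D, a.1 y D * pd D b.2 y - ∑ D, b.1 y D * pd D a.2 y)

/-- The integrand of the central term. -/
def centralDensity (l : ℝ) (a b : Param) (y : Bdy) : ℂ :=
  (l : ℂ) ^ 2 * (a.2 y * pd 0 (fun y => 1 / 2 * ∑ D, pd D (fun z => b.1 z D) y - 1 / 2 * b.2 y) y
      - pd 0 a.2 y * (1 / 2 * ∑ D, pd D (fun z => b.1 z D) y - 1 / 2 * b.2 y))
    - (l : ℂ) ^ 2 * (∑ D, a.1 y D * pd D (pd 0 b.2) y)

/-- The central term. -/
def centralTerm (l G τ₀ : ℝ) (a b : Param) : ℂ :=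
  (1 / (16 * Real.pi * G * l) : ℝ) * ∫ φ in (0 : ℝ)..(2 * Real.pi), centralDensity l a b ![τ₀, φ]

/-- The integrand of the surface charge, up to normalization. -/
def surfaceDensity {l : ℝ} (p : PhasePoint l) (a : Param) (y : Bdy) : ℂ :=
  (l : ℂ) ^ 2 * (a.2 y * (pd 0 p.conf y : ℝ) - pd 0 a.2 y * (p.conf y : ℝ))
      + 2 * ∑ A, a.1 y A * (p.Xi y 0 A : ℝ)

theorem surfaceCharge_eq (l G τ₀ : ℝ) (a : Param) (p : PhasePoint l) :
    surfaceCharge l G τ₀ a p = (1 / (16 * Real.pi * G * l) : ℝ) *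
      ∫ φ in (0 : ℝ)..(2 * Real.pi), surfaceDensity p a ![τ₀, φ] := rfl

section

variable {l : ℝ} {p : PhasePoint l}

theorem PhasePoint.Xi_zero (y : Bdy) :
    p.Xi y 0 0 = 1 / 2 * (p.C y 0 0 + p.C y 1 1) ∧ p.Xi y 0 1 = p.C y 0 1 := by
  constructor <;> simp [PhasePoint.Xi, flat, Fin.sum_univ_two]
  ring

/-- The variation of the charge of `a` along an asymptotic symmetry with parameter `b`. -/
theorem chargeDensity_lie (hl : l ≠ 0) (hp : OnShell p) {a b : Param} (ha : IsSymmetry a)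
    (hb : IsSymmetry b) (X : Bdy → ℂ) : ∃ B : Bdy → ℂ, ContDiff ℝ ∞ B ∧
      (∀ y, B (y + Pi.single 1 (2 * Real.pi)) = B y) ∧
      ∀ y, chargeDensity l a (p.lieConf b) (p.lieC b X) y
        = surfaceDensity p (bracketParam a b) y + centralDensity l a b y + pd 1 B y := by
  have kY := fun y => (ha.ckv y).1
  have kY' := fun y => (ha.ckv y).2
  have kV := fun y => (hb.ckv y).1
  have kV' := fun y => (hb.ckv y).2
  have dc := p.smooth_conf.differentiable (by simp)
  have sΦ := smooth_ofReal p.smooth_conf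
  have sT : ContDiff ℝ ∞ (fun y => ((1 / 2 * (p.C y 0 0 + p.C y 1 1) : ℝ) : ℂ)) :=
    smooth_ofReal (contDiff_const.mul ((p.smooth_C 0 0).add (p.smooth_C 1 1)))
  have sS := smooth_ofReal (p.smooth_C 0 1)
  have pΦ : ∀ A, pd A (fun y => (p.conf y : ℂ)) = fun y => ((pd A p.conf y : ℝ) : ℂ) :=
    fun A => funext fun y => pd_ofReal A (dc y)
  have pS : ∀ A y, pd A (fun y => (p.C y 0 1 : ℂ)) y = ((pd A (fun y => p.C y 0 1) y : ℝ) : ℂ) :=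
    fun A y => pd_ofReal A (p.differentiable_C 0 1 y)
  have pT : ∀ A y, pd A (fun y => ((1 / 2 * (p.C y 0 0 + p.C y 1 1) : ℝ) : ℂ)) y
      = 1 / 2 * (((pd A (fun y => p.C y 0 0) y : ℝ) : ℂ) + ((pd A (fun y => p.C y 1 1) y : ℝ) : ℂ)) := by
    intro A y
    have d0 := p.differentiable_C 0 0 y
    have d1 := p.differentiable_C 1 1 y
    rw [pd_ofReal (f := fun y => 1 / 2 * (p.C y 0 0 + p.C y 1 1)) A
        ((differentiableAt_const _).mul (d0.add d1)),
      pd_mul (g := fun y => p.C y 0 0 + p.C y 1 1) A (differentiableAt_const _) (d0.add d1),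
      pd_add A d0 d1, pd_const]
    push_cast
    ring
  have cons := fun y => hp.conserved hl y
  have id := fun y => bracket_density (ha.smooth_Y 0) (ha.smooth_Y 1) (hb.smooth_Y 0)
    (hb.smooth_Y 1) ha.smooth_ψ hb.smooth_ψ sΦ sS sT kY kY' kV kV' ha.wave hb.wave
    (fun y => by
      rw [pΦ, pΦ, pd_ofReal 1 ((p.smooth_pd_conf 1).differentiable (by simp) y),
        pd_ofReal 0 ((p.smooth_pd_conf 0).differentiable (by simp) y), hp.wave_conf hl y])
    (fun y => by
      rw [pT, pS]
      have := congrArg Complex.ofReal (cons y).1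
      push_cast at this
      linear_combination 1 / 2 * this)
    (fun y => by
      rw [pT, pS]
      have := congrArg Complex.ofReal (cons y).2
      push_cast at this
      linear_combination 1 / 2 * this) ((l : ℂ) ^ 2) y
  -- The primitive from `bracket_density`, with Φ = φ, S = Ξ_τφ = C_τφ and T = Ξ_ττ = ½(C_ττ +
  -- C_φφ).
  refine ⟨fun y => 2 * ((a.1 y 0 * b.1 y 0 + a.1 y 1 * b.1 y 1) * (p.C y 0 1 : ℂ)
      + (a.1 y 0 * b.1 y 1 + a.1 y 1 * b.1 y 0) * ((1 / 2 * (p.C y 0 0 + p.C y 1 1) : ℝ) : ℂ))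
    + (l : ℂ) ^ 2 * (a.2 y * (b.1 y 0 * pd 1 (fun y => (p.conf y : ℂ)) y
        + b.1 y 1 * pd 0 (fun y => (p.conf y : ℂ)) y)
      + (p.conf y : ℂ) * (a.1 y 0 * pd 1 b.2 y + a.1 y 1 * pd 0 b.2 y
        - (b.1 y 0 * pd 1 a.2 y + b.1 y 1 * pd 0 a.2 y))),
    ?_, fun y => ?_, fun y => Eq.trans ?_ ((id y).trans ?_)⟩
  · have h1 := fun A => ha.smooth_Y A
    have h2 := fun A => hb.smooth_Y A
    have h3 := fun A => ha.smooth_pd_ψ A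
    have h4 := fun A => hb.smooth_pd_ψ A
    have h5 := fun A => contDiff_pd A sΦ
    have h6 := ha.smooth_ψ
    exact (contDiff_const.mul (((((h1 0).mul (h2 0)).add ((h1 1).mul (h2 1))).mul sS).add
      ((((h1 0).mul (h2 1)).add ((h1 1).mul (h2 0))).mul sT))).add (contDiff_const.mul
      ((h6.mul (((h2 0).mul (h5 1)).add ((h2 1).mul (h5 0)))).add
      (sΦ.mul ((((h1 0).mul (h4 1)).add ((h1 1).mul (h4 0))).sub
        (((h2 0).mul (h3 1)).add ((h2 1).mul (h3 0)))))))
  · clear id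
    have q : ∀ y, (p.conf (y + Pi.single 1 (2 * Real.pi)) : ℂ) = p.conf y := fun y => by
      rw [p.periodic_conf]
    simp only [ha.periodic_Y, hb.periodic_Y, ha.periodic_ψ, p.periodic_C, p.periodic_conf,
      pd_periodic ha.periodic_ψ, pd_periodic hb.periodic_ψ, pd_periodic (f := fun y => (p.conf y : ℂ)) q]
  · have eom : p.lieConf b = fun y => b.1 y 0 * pd 0 (fun y => (p.conf y : ℂ)) y
        + b.1 y 1 * pd 1 (fun y => (p.conf y : ℂ)) y
        + 1 / 2 * (pd 0 (fun z => b.1 z 0) y + pd 1 (fun z => b.1 z 1) y) - 1 / 2 * b.2 y := by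
      funext y
      simp only [PhasePoint.lieConf, Fin.sum_univ_two, pΦ]
    have hf : (p.fac y : ℂ) ≠ 0 := by exact_mod_cast (p.fac_pos y).ne'
    have hs : p.C y 1 0 = p.C y 0 1 := (p.symm_C y).apply 0 1
    -- X enters with the entries -1 and +1 of the flat metric and cancels in this sum.
    have e0 : 1 / 2 * (p.lieC b X y 0 0 + p.lieC b X y 1 1)
        = b.1 y 0 * pd 0 (fun y => ((1 / 2 * (p.C y 0 0 + p.C y 1 1) : ℝ) : ℂ)) y
          + b.1 y 1 * pd 1 (fun y => ((1 / 2 * (p.C y 0 0 + p.C y 1 1) : ℝ) : ℂ)) y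
          + 2 * pd 1 (fun y => b.1 y 1) y * ((1 / 2 * (p.C y 0 0 + p.C y 1 1) : ℝ) : ℂ)
          + 2 * pd 1 (fun y => b.1 y 0) y * (p.C y 0 1 : ℂ)
          - (l : ℂ) ^ 2 / 2 * (pd 0 (pd 0 b.2) y - pd 0 (fun y => (p.conf y : ℂ)) y * pd 0 b.2 y
            - pd 1 (fun y => (p.conf y : ℂ)) y * pd 1 b.2 y) := by
      simp only [PhasePoint.lieC, Fin.sum_univ_two, p.pd_subY hb.smooth_ψ, pΦ, pT, kV, kV', hs,
        hb.wave, flat]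
      simp
      field_simp
      ring
    have e1 : p.lieC b X y 0 1
        = b.1 y 0 * pd 0 (fun y => (p.C y 0 1 : ℂ)) y + b.1 y 1 * pd 1 (fun y => (p.C y 0 1 : ℂ)) y
          + 2 * pd 1 (fun y => b.1 y 1) y * (p.C y 0 1 : ℂ)
          + 2 * pd 1 (fun y => b.1 y 0) y * ((1 / 2 * (p.C y 0 0 + p.C y 1 1) : ℝ) : ℂ)
          - (l : ℂ) ^ 2 / 2 * (pd 1 (pd 0 b.2) y - pd 0 (fun y => (p.conf y : ℂ)) y * pd 1 b.2 y
            - pd 1 (fun y => (p.conf y : ℂ)) y * pd 0 b.2 y) := by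
      simp only [PhasePoint.lieC, Fin.sum_univ_two, p.pd_subY hb.smooth_ψ, pΦ, pS, kV, kV',
        pd_comm hb.smooth_ψ 0 1, flat]
      simp
      field_simp
      ring
    simp only [chargeDensity]
    rw [e0, e1, eom]
  · simp only [surfaceDensity, centralDensity, bracketParam, Fin.sum_univ_two, p.Xi_zero, pΦ]

theorem smooth_bracketParam {a b : Param} (ha : IsSymmetry a) (hb : IsSymmetry b) :
    (∀ A, ContDiff ℝ ∞ (fun y => (bracketParam a b).1 y A)) ∧ ContDiff ℝ ∞ (bracketParam a b).2 :=
  ⟨fun A => (ContDiff.sum fun D _ => (ha.smooth_Y D).mul (hb.smooth_pd_Y D A)).sub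
    (ContDiff.sum fun D _ => (hb.smooth_Y D).mul (ha.smooth_pd_Y D A)),
    (ContDiff.sum fun D _ => (ha.smooth_Y D).mul (hb.smooth_pd_ψ D)).sub
    (ContDiff.sum fun D _ => (hb.smooth_Y D).mul (ha.smooth_pd_ψ D))⟩

theorem continuous_surfaceDensity (p : PhasePoint l) {a : Param}
    (h1 : ∀ A, ContDiff ℝ ∞ (fun y => a.1 y A)) (h2 : ContDiff ℝ ∞ a.2) :
    Continuous (surfaceDensity p a) := by
  have c0 : Continuous fun y => ((pd 0 p.conf y : ℝ) : ℂ) :=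
    (smooth_ofReal (p.smooth_pd_conf 0)).continuous
  have c1 : Continuous fun y => (p.conf y : ℂ) := (smooth_ofReal p.smooth_conf).continuous
  have c2 : ∀ A, Continuous fun y => (p.Xi y 0 A : ℂ) := fun A =>
    (smooth_ofReal ((p.smooth_C 0 A).sub (contDiff_const.mul (ContDiff.sum fun D _ =>
      ContDiff.sum fun E _ => contDiff_const.mul (p.smooth_C D E))))).continuous
  exact (continuous_const.mul ((h2.continuous.mul c0).sub
    ((contDiff_pd 0 h2).continuous.mul c1))).add (continuous_const.mul
      (continuous_finsetSum _ fun A _ => (h1 A).continuous.mul (c2 A)))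

theorem continuous_centralDensity {a b : Param} (ha : IsSymmetry a) (hb : IsSymmetry b) :
    Continuous (centralDensity l a b) := by
  have h : ContDiff ℝ ∞ fun y => 1 / 2 * ∑ D, pd D (fun z => b.1 z D) y - 1 / 2 * b.2 y :=
    (contDiff_const.mul (ContDiff.sum fun D _ => hb.smooth_pd_Y D D)).sub
      (contDiff_const.mul hb.smooth_ψ)
  exact (continuous_const.mul ((ha.smooth_ψ.continuous.mul (contDiff_pd 0 h).continuous).sub
    ((ha.smooth_pd_ψ 0).continuous.mul h.continuous))).sub (continuous_const.mul
      (continuous_finsetSum _ fun D _ => (ha.smooth_Y D).continuous.mul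
        (contDiff_pd D (hb.smooth_pd_ψ 0)).continuous))

theorem Continuous.intervalIntegrable_circle {v : Bdy → ℂ} (hv : Continuous v) (τ₀ : ℝ) :
    IntervalIntegrable (fun φ => v ![τ₀, φ]) MeasureTheory.volume 0 (2 * Real.pi) :=
  (hv.comp (continuous_circle τ₀)).intervalIntegrable _ _

/-- The charges represent the commutator of parameters up to a term that does not depend on the
metric; the total φ-derivative of a periodic function integrates to zero. -/
theorem chargeVariation_lie (hl : l ≠ 0) (hp : OnShell p) (G τ₀ : ℝ) {a b : Param}
    (ha : IsSymmetry a) (hb : IsSymmetry b) (X : Bdy → ℂ) :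
    chargeVariation l G τ₀ a (p.lieConf b) (p.lieC b X)
      = surfaceCharge l G τ₀ (bracketParam a b) p + centralTerm l G τ₀ a b := by
  obtain ⟨B, sB, pB, hB⟩ := chargeDensity_lie hl hp ha hb X
  obtain ⟨h1, h2⟩ := smooth_bracketParam ha hb
  have i1 := Continuous.intervalIntegrable_circle (continuous_surfaceDensity p h1 h2) τ₀
  have i2 := Continuous.intervalIntegrable_circle (continuous_centralDensity (l := l) ha hb) τ₀
  have i3 := Continuous.intervalIntegrable_circle (contDiff_pd 1 sB).continuous τ₀
  simp only [chargeVariation, hB, surfaceCharge_eq, centralTerm]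
  rw [intervalIntegral.integral_add (i1.add i2) i3, intervalIntegral.integral_add i1 i2,
    integral_pd_one sB pB, add_zero, mul_add]

/-- The limit involves only the parameters: ξ₁ enters the density only through a, and the
coefficient X of ξ₂ has dropped out. -/
theorem OnShell.hasIBracket (hl : 0 < l) (hp : OnShell p) (G τ₀ : ℝ) {a b : Param}
    (ha : IsSymmetry a) (hb : IsSymmetry b) {w : ℂ}
    (hw : Complex.I * (surfaceCharge l G τ₀ (bracketParam a b) p + centralTerm l G τ₀ a b) = w) :
    HasIBracket l G τ₀ p a b w := by
  intro ξ₁ ξ₂ h1 h2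
  obtain ⟨X, _, hv⟩ := h2.hasVariation_lie hb
  have t := tendsto_bbCircle hl G τ₀ hv (farSmooth_lieMetric h2) (fun i j => lieMetric_symm ξ₂ i j)
    (linearizedRho_lie hl.ne' hb X) ha h1
  rw [chargeVariation_lie hl.ne' hp G τ₀ ha hb X] at t
  rw [← hw]
  exact t.const_mul _

theorem centralTerm_antisymm (G τ₀ : ℝ) {a b : Param} (ha : IsSymmetry a) (hb : IsSymmetry b) :
    centralTerm l G τ₀ b a = -centralTerm l G τ₀ a b := by
  rw [eq_neg_iff_add_eq_zero, add_comm, centralTerm, centralTerm, ← mul_add,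
    ← intervalIntegral.integral_add
      (Continuous.intervalIntegrable_circle (continuous_centralDensity ha hb) τ₀)
      (Continuous.intervalIntegrable_circle (continuous_centralDensity hb ha) τ₀)]
  have id := central_density (ha.smooth_Y 0) (ha.smooth_Y 1) (hb.smooth_Y 0)
    (hb.smooth_Y 1) ha.smooth_ψ hb.smooth_ψ (fun y => (ha.ckv y).1) (fun y => (ha.ckv y).2)
    (fun y => (hb.ckv y).1) (fun y => (hb.ckv y).2) ha.wave hb.wave ((l : ℂ) ^ 2)
  simp only [centralDensity, Fin.sum_univ_two, id]
  rw [integral_pd_one, mul_zero]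
  · exact contDiff_const.mul ((((hb.smooth_ψ.mul (ha.smooth_pd_Y 1 0)).add
      (ha.smooth_ψ.mul (hb.smooth_pd_Y 1 0))).sub (((hb.smooth_Y 0).mul (ha.smooth_pd_ψ 1)).add
      ((hb.smooth_Y 1).mul (ha.smooth_pd_ψ 0)))).sub (((ha.smooth_Y 0).mul (hb.smooth_pd_ψ 1)).add
      ((ha.smooth_Y 1).mul (hb.smooth_pd_ψ 0))))
  · intro y
    have qa : ∀ y, a.1 (y + Pi.single 1 (2 * Real.pi)) 0 = a.1 y 0 := fun y => by rw [ha.periodic_Y]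
    have qb : ∀ y, b.1 (y + Pi.single 1 (2 * Real.pi)) 0 = b.1 y 0 := fun y => by rw [hb.periodic_Y]
    simp only [ha.periodic_Y, hb.periodic_Y, ha.periodic_ψ, hb.periodic_ψ,
      pd_periodic ha.periodic_ψ, pd_periodic hb.periodic_ψ,
      pd_periodic (f := fun y => a.1 y 0) qa, pd_periodic (f := fun y => b.1 y 0) qb]

theorem surfaceCharge_smul (G τ₀ : ℝ) (c : ℂ) {a : Param} (ha : ContDiff ℝ ∞ a.2) :
    surfaceCharge l G τ₀ (c • a) p = c * surfaceCharge l G τ₀ a p := by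
  have e : ∀ y, surfaceDensity p (c • a) y = c * surfaceDensity p a y := by
    intro y
    have : pd 0 (fun y => c * a.2 y) y = c * pd 0 a.2 y := by
      rw [pd_mul 0 (differentiableAt_const _) (ha.differentiable (by simp) y), pd_const]
      ring
    have e2 : (c • a).2 = fun y => c * a.2 y := rfl
    simp only [surfaceDensity, e2, this, Fin.sum_univ_two, Prod.smul_fst, Pi.smul_apply, smul_eq_mul]
    ring
  simp only [surfaceCharge_eq, e]
  rw [intervalIntegral.integral_const_mul]
  ring

theorem surfaceCharge_add (G τ₀ : ℝ) {a b : Param} (ha : ∀ A, ContDiff ℝ ∞ (fun y => a.1 y A))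
    (ha' : ContDiff ℝ ∞ a.2) (hb : ∀ A, ContDiff ℝ ∞ (fun y => b.1 y A))
    (hb' : ContDiff ℝ ∞ b.2) :
    surfaceCharge l G τ₀ (a + b) p = surfaceCharge l G τ₀ a p + surfaceCharge l G τ₀ b p := by
  have e : ∀ y, surfaceDensity p (a + b) y = surfaceDensity p a y + surfaceDensity p b y := by
    intro y
    have : pd 0 (fun y => a.2 y + b.2 y) y = pd 0 a.2 y + pd 0 b.2 y :=
      pd_add 0 (ha'.differentiable (by simp) y) (hb'.differentiable (by simp) y)
    have e2 : (a + b).2 = fun y => a.2 y + b.2 y := rfl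
    simp only [surfaceDensity, e2, this, Fin.sum_univ_two, Prod.fst_add, Pi.add_apply]
    ring
  simp only [surfaceCharge_eq, e]
  rw [intervalIntegral.integral_add
    (Continuous.intervalIntegrable_circle (continuous_surfaceDensity p ha ha') τ₀)
    (Continuous.intervalIntegrable_circle (continuous_surfaceDensity p hb hb') τ₀), mul_add]

theorem OnShell.exists_bracket (hl : 0 < l) (hp : OnShell p) (G τ₀ : ℝ) {a b : Param}
    (ha : IsSymmetry a) (hb : IsSymmetry b) :
    ∃ w : ℂ, HasIBracket l G τ₀ p a b w ∧ HasIBracket l G τ₀ p b a (-w) := by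
  refine ⟨_, hp.hasIBracket hl G τ₀ ha hb rfl, hp.hasIBracket hl G τ₀ hb ha ?_⟩
  -- Stated as a scalar multiple so that the linearity of the charge applies.
  have e : bracketParam b a = (-1 : ℂ) • bracketParam a b := by
    refine Prod.ext (funext fun y => funext fun A => ?_) (funext fun y => ?_) <;>
      simp [bracketParam]
  rw [centralTerm_antisymm G τ₀ ha hb, e, surfaceCharge_smul G τ₀ _ (smooth_bracketParam ha hb).2]
  ring

end

end

section

open Asymptotics

/-! ### The algebra of the modes -/

/-- With the exponent as a continuous linear map, smoothness and derivatives of the modes follow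
from those of the exponential. -/
theorem mode_eq (s : ℤˣ) (m : ℤ) : mode s m = fun y => Complex.exp
    (((Complex.I * m) • (Complex.ofRealCLM ∘L ContinuousLinearMap.proj (R := ℝ) (φ := fun _ => ℝ) 0
      + ((s : ℤ) : ℂ) • (Complex.ofRealCLM ∘L ContinuousLinearMap.proj (R := ℝ) (φ := fun _ => ℝ) 1) :
        Bdy →L[ℝ] ℂ)) y) := by
  funext y
  simp [mode, mul_add]

theorem smooth_mode (s : ℤˣ) (m : ℤ) : ContDiff ℝ ∞ (mode s m) := by
  rw [mode_eq]
  exact (ContinuousLinearMap.contDiff _).cexp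

theorem pd_mode (s : ℤˣ) (m : ℤ) (y : Bdy) :
    pd 0 (mode s m) y = Complex.I * m * mode s m y ∧
      pd 1 (mode s m) y = Complex.I * m * ((s : ℤ) : ℂ) * mode s m y := by
  have h := fun L : Bdy →L[ℝ] ℂ => (L.hasFDerivAt (x := y)).cexp
  rw [mode_eq]
  constructor <;>
  · rw [pd, (h _).fderiv]
    simp
    ring

theorem pd_mode_zero (s : ℤˣ) (m : ℤ) :
    pd 0 (mode s m) = fun y => Complex.I * m * mode s m y :=
  funext fun y => (pd_mode s m y).1

theorem pd_mode_one (s : ℤˣ) (m : ℤ) :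
    pd 1 (mode s m) = fun y => Complex.I * m * ((s : ℤ) : ℂ) * mode s m y :=
  funext fun y => (pd_mode s m y).2

theorem periodic_mode (s : ℤˣ) (m : ℤ) (y : Bdy) :
    mode s m (y + Pi.single 1 (2 * Real.pi)) = mode s m y := by
  have := Complex.exp_periodic.int_mul (m * s)
    (Complex.I * m * ((y 0 : ℂ) + ((s : ℤ) : ℂ) * (y 1 : ℂ)))
  rw [mode, mode, ← this]
  congr 1
  simp
  ring

theorem mode_zero (s : ℤˣ) (y : Bdy) : mode s 0 y = 1 := by simp [mode]

theorem mode_mul (s : ℤˣ) (m n : ℤ) (y : Bdy) : mode s m y * mode s n y = mode s (m + n) y := by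
  rw [mode, mode, mode, ← Complex.exp_add]
  congr 1
  push_cast
  ring

theorem units_cast_sq (s : ℤˣ) : ((s : ℤ) : ℂ) ^ 2 = 1 := by
  rcases Int.units_eq_one_or s with rfl | rfl <;> simp

theorem integral_mode (s : ℤˣ) (m : ℤ) (τ₀ : ℝ) :
    ∫ φ in (0 : ℝ)..(2 * Real.pi), mode s m ![τ₀, φ] = if m = 0 then 2 * Real.pi else 0 := by
  split_ifs with h
  · simp [h, mode_zero]
  · have h1 := integral_pd_one (smooth_mode s m) (periodic_mode s m) τ₀
    simp only [pd_mode_one] at h1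
    rw [intervalIntegral.integral_const_mul, mul_eq_zero] at h1
    refine h1.resolve_left ?_
    have hs : ((s : ℤ) : ℂ) ≠ 0 := by
      intro h0
      have := units_cast_sq s
      simp [h0] at this
    exact mul_ne_zero (mul_ne_zero Complex.I_ne_zero (by exact_mod_cast h)) hs

/-- Modes of opposite chirality multiply to e^{i(m+n)τ} e^{is(m-n)φ}, whose integral can be nonzero
only for m = n, where the prefactor vanishes. -/
theorem integral_mode_mul (s : ℤˣ) (m n : ℤ) (τ₀ : ℝ) :
    ((n : ℂ) - m) * ∫ φ in (0 : ℝ)..(2 * Real.pi), mode s m ![τ₀, φ] * mode (-s) n ![τ₀, φ] = 0 := by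
  have h1 := integral_pd_one ((smooth_mode s m).mul (smooth_mode (-s) n))
    (fun y => by rw [periodic_mode, periodic_mode]) τ₀
  have e : ∀ y, pd 1 (fun y => mode s m y * mode (-s) n y) y
      = (Complex.I * ((s : ℤ) : ℂ) * (m - n)) * (mode s m y * mode (-s) n y) := by
    intro y
    rw [pd_mul 1 ((smooth_mode s m).differentiable (by simp) y)
      ((smooth_mode (-s) n).differentiable (by simp) y), pd_mode_one, pd_mode_one]
    push_cast
    ring
  simp only [e] at h1
  rw [intervalIntegral.integral_const_mul] at h1
  have hs := units_cast_sq s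
  linear_combination (Complex.I * ((s : ℤ) : ℂ)) * h1 + ((n : ℂ) - m) *
    (∫ φ in (0 : ℝ)..(2 * Real.pi), mode s m ![τ₀, φ] * mode (-s) n ![τ₀, φ])
      * (-hs + ((s : ℤ) : ℂ) ^ 2 * (Complex.I_sq))

/-- The combination `u l^±_m + α p^±_m`. -/
def modeParam (s : ℤˣ) (m : ℤ) (u α : ℂ) : Param :=
  (fun y => ![u / 2 * mode s m y, u / 2 * ((s : ℤ) : ℂ) * mode s m y], fun y => α * mode s m y)

theorem lGen_eq (s : ℤˣ) (m : ℤ) : lGen s m = modeParam s m 1 0 := by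
  simp only [lGen, modeParam, zero_mul]
  rfl

theorem pGen_eq (s : ℤˣ) (m : ℤ) : pGen s m = modeParam s m 0 1 := by
  refine Prod.ext (funext fun y => funext fun A => ?_) (funext fun y => ?_)
  · fin_cases A <;> simp [pGen, modeParam]
  · simp [pGen, modeParam]

theorem modeParam_eq (s : ℤˣ) (m : ℤ) (u α : ℂ) :
    modeParam s m u α = u • lGen s m + α • pGen s m := by
  refine Prod.ext (funext fun y => funext fun A => ?_) (funext fun y => ?_)
  · fin_cases A <;> simp [pGen, lGen, modeParam] <;> ring
  · simp [pGen, lGen, modeParam]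

theorem lTilde_eq (s : ℤˣ) (m : ℤ) : lTilde s m = modeParam s m 1 (Complex.I * m) := by
  rw [modeParam_eq, one_smul, lTilde]

theorem pd_const_mul_mode (c : ℂ) (s : ℤˣ) (m : ℤ) :
    (pd 0 fun y => c * mode s m y) = (fun y => c * (Complex.I * m) * mode s m y) ∧
      (pd 1 fun y => c * mode s m y) = fun y => c * (Complex.I * m * ((s : ℤ) : ℂ)) * mode s m y := by
  have d := (smooth_mode s m).differentiable (by simp)
  constructor <;> funext y <;>
    rw [pd_mul _ (differentiableAt_const _) (d y), pd_const] <;>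
    simp only [pd_mode_zero, pd_mode_one] <;> ring

theorem isSymmetry_modeParam (s : ℤˣ) (m : ℤ) (u α : ℂ) : IsSymmetry (modeParam s m u α) where
  smooth_Y A := by
    fin_cases A
    · exact contDiff_const.mul (smooth_mode s m)
    · exact contDiff_const.mul (smooth_mode s m)
  smooth_ψ := contDiff_const.mul (smooth_mode s m)
  periodic_Y y := by simp only [modeParam, periodic_mode]
  periodic_ψ y := by simp only [modeParam, periodic_mode]
  killing y A B := by
    have hs := units_cast_sq s
    fin_cases A <;> fin_cases B <;>
      simp [modeParam, Fin.sum_univ_two, flat, pd_const_mul_mode] <;> ring_nf <;> simp [hs]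
  harmonic y := by
    have hs := units_cast_sq s
    simp only [modeParam, Fin.sum_univ_two, flat, pd_const_mul_mode]
    simp
    linear_combination (α * (Complex.I * m) ^ 2 * mode s m y) * hs

theorem pd_time : (pd 0 fun y : Bdy => (y 0 : ℂ)) = (fun _ => 1) ∧
    (pd 1 fun y : Bdy => (y 0 : ℂ)) = fun _ => 0 := by
  have h : ∀ A y, pd A (fun y : Bdy => (y 0 : ℂ)) y = ((Pi.single A 1 : Bdy) 0 : ℝ) := by
    intro A y
    have := (Complex.ofRealCLM ∘L ContinuousLinearMap.proj (R := ℝ) (φ := fun _ : Fin 2 => ℝ) 0).hasFDerivAt (x := y)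
    rw [pd]
    exact congrArg (fun L : Bdy →L[ℝ] ℂ => L (Pi.single A 1)) this.fderiv
  constructor <;> funext y <;> rw [h] <;> simp

theorem isSymmetry_qGen : IsSymmetry qGen where
  smooth_Y _ := contDiff_const
  smooth_ψ := Complex.ofRealCLM.contDiff.comp (contDiff_apply ℝ ℝ 0)
  periodic_Y _ := rfl
  periodic_ψ y := by simp [qGen]
  killing y A B := by simp [qGen, pd_zero]
  harmonic y := by simp [qGen, Fin.sum_univ_two, pd_time, pd_const]

/-- With free coefficients u and α one computation covers L, P and L̃ at once; s² = 1 collapses the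
τ and φ contributions. -/
theorem bracketParam_same (s : ℤˣ) (m n : ℤ) (u α u' α' : ℂ) :
    bracketParam (modeParam s m u α) (modeParam s n u' α')
      = modeParam s (m + n) (Complex.I * (n - m) * (u * u'))
        (Complex.I * (n * (u * α') - m * (u' * α))) := by
  have hs := units_cast_sq s
  refine Prod.ext (funext fun y => funext fun A => ?_) (funext fun y => ?_)
  · fin_cases A <;>
    simp only [bracketParam, modeParam, Fin.sum_univ_two, ← mode_mul] <;>
    simp [pd_const_mul_mode]
    · linear_combination (u * u' / 4 * Complex.I * (n - m) * (mode s m y * mode s n y)) * hs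
    · linear_combination (u * u' / 4 * ((s : ℤ) : ℂ) * Complex.I * (n - m)
        * (mode s m y * mode s n y)) * hs
  · simp only [bracketParam, modeParam, Fin.sum_univ_two, ← mode_mul, pd_const_mul_mode]
    simp
    linear_combination (Complex.I * (n * (u * α') - m * (u' * α)) / 2
        * (mode s m y * mode s n y)) * hs

/-- ∂_+ annihilates functions of x^-, so the chiral halves commute. Zero is written as a multiple of
`qGen` so that the linearity of the charge evaluates it. -/
theorem bracketParam_opposite (s : ℤˣ) (m n : ℤ) (u α u' α' : ℂ) :
    bracketParam (modeParam s m u α) (modeParam (-s) n u' α') = (0 : ℂ) • qGen := by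
  have hs := units_cast_sq s
  refine Prod.ext (funext fun y => funext fun A => ?_) (funext fun y => ?_)
  · fin_cases A <;>
    simp only [bracketParam, modeParam, Fin.sum_univ_two] <;>
    simp [pd_const_mul_mode, pd_neg]
    · linear_combination (-(u * u' / 4 * Complex.I * (n - m) * (mode s m y * mode (-s) n y))) * hs
    · linear_combination (u * u' / 4 * ((s : ℤ) : ℂ) * Complex.I * (n + m)
        * (mode s m y * mode (-s) n y)) * hs
  · simp only [bracketParam, modeParam, Fin.sum_univ_two, pd_const_mul_mode]
    simp
    linear_combination (-(Complex.I * (n * (u * α') - m * (u' * α)) / 2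
        * (mode s m y * mode (-s) n y))) * hs

theorem bracketParam_time (s : ℤˣ) (m : ℤ) (u α : ℂ) :
    bracketParam (modeParam s m u α) qGen = modeParam s m 0 (u / 2) := by
  refine Prod.ext (funext fun y => funext fun A => ?_) (funext fun y => ?_)
  · fin_cases A <;> simp [bracketParam, modeParam, qGen, Fin.sum_univ_two, pd_const]
  · simp [bracketParam, modeParam, qGen, Fin.sum_univ_two, pd_time]

/-- The factor i n u' - α' comes from ½ div Y - ½ψ and vanishes for L̃. The term n² u α' comes from
the second derivative of ψ; the factor 1 + s s' restricts it to equal chirality. -/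
theorem centralDensity_modeParam (l : ℝ) (s s' : ℤˣ) (m n : ℤ) (u α u' α' : ℂ) (y : Bdy) :
    centralDensity l (modeParam s m u α) (modeParam s' n u' α') y
      = (l : ℂ) ^ 2 * (Complex.I / 2 * (n - m) * (α * (Complex.I * n * u' - α'))
        + (1 + ((s : ℤ) : ℂ) * ((s' : ℤ) : ℂ)) / 2 * n ^ 2 * (u * α'))
        * (mode s m y * mode s' n y) := by
  have hs := units_cast_sq s'
  have e : (fun y => 1 / 2 * ∑ D, pd D (fun z => (modeParam s' n u' α').1 z D) y
      - 1 / 2 * (modeParam s' n u' α').2 y)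
      = fun y => ((Complex.I * n * u' - α') / 2) * mode s' n y := by
    funext y
    simp only [modeParam, Fin.sum_univ_two]
    simp [pd_const_mul_mode]
    linear_combination (u' * Complex.I * n * mode s' n y / 4) * hs
  have e' := congrFun e y
  simp only [centralDensity, e, e']
  simp only [modeParam, Fin.sum_univ_two, pd_const_mul_mode]
  simp
  linear_combination (-(l : ℂ) ^ 2 / 2 * n ^ 2 * (u * α') * (mode s m y * mode s' n y)
    * (1 + ((s : ℤ) : ℂ) * ((s' : ℤ) : ℂ))) * Complex.I_sq

theorem centralDensity_time (l : ℝ) (s : ℤˣ) (m : ℤ) (u α : ℂ) (y : Bdy) :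
    centralDensity l (modeParam s m u α) qGen y
      = -(l : ℂ) ^ 2 / 2 * α * (1 - Complex.I * m * y 0) * mode s m y := by
  have e : (fun y => 1 / 2 * ∑ D, pd D (fun z => qGen.1 z D) y - 1 / 2 * qGen.2 y)
      = fun y : Bdy => (-(1 / 2) : ℂ) * (y 0 : ℂ) := by
    funext y
    simp [qGen, pd_const]
  have e' := congrFun e y
  have d : pd 0 (fun y : Bdy => (-(1 / 2) : ℂ) * (y 0 : ℂ)) y = -(1 / 2) := by
    rw [pd_mul (g := fun y : Bdy => (y 0 : ℂ)) 0 (differentiableAt_const _)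
      ((Complex.ofRealCLM.contDiff.comp (contDiff_apply ℝ ℝ 0)).differentiable (n := ∞) (by simp) y),
      pd_const, pd_time.1]
    simp
  simp only [centralDensity, e, e', d]
  simp only [modeParam, qGen, Fin.sum_univ_two, pd_const_mul_mode, pd_time, pd_const]
  ring

section

variable {l : ℝ} {p : PhasePoint l}

theorem centralTerm_same (hl : l ≠ 0) (G τ₀ : ℝ) (s : ℤˣ) (m n : ℤ) (u α u' α' : ℂ) :
    centralTerm l G τ₀ (modeParam s m u α) (modeParam s n u' α')
      = l / (8 * G) * (Complex.I / 2 * (n - m) * (α * (Complex.I * n * u' - α'))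
        + n ^ 2 * (u * α')) * (if m + n = 0 then 1 else 0) := by
  have hl' : (l : ℂ) ≠ 0 := by exact_mod_cast hl
  have hπ : (Real.pi : ℂ) ≠ 0 := by exact_mod_cast Real.pi_ne_zero
  have hs := units_cast_sq s
  rw [pow_two] at hs
  simp only [centralTerm, centralDensity_modeParam, hs, mode_mul]
  rw [intervalIntegral.integral_const_mul, integral_mode]
  -- For G = 0 both sides are zero, since division by zero gives zero.
  rcases eq_or_ne G 0 with rfl | hG
  · simp
  have hG' : (G : ℂ) ≠ 0 := by exact_mod_cast hG
  split_ifs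
  · push_cast
    field_simp
    ring
  · simp

theorem centralTerm_opposite (G τ₀ : ℝ) (s : ℤˣ) (m n : ℤ) (u α u' α' : ℂ) :
    centralTerm l G τ₀ (modeParam s m u α) (modeParam (-s) n u' α') = 0 := by
  have hs := units_cast_sq s
  have h0 : 1 + ((s : ℤ) : ℂ) * (((-s : ℤˣ) : ℤ) : ℂ) = 0 := by
    push_cast
    linear_combination -hs
  simp only [centralTerm, centralDensity_modeParam, h0]
  rw [intervalIntegral.integral_const_mul]
  linear_combination ((1 / (16 * Real.pi * G * l) : ℝ) * (l : ℂ) ^ 2 * (Complex.I / 2)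
    * (α * (Complex.I * n * u' - α'))) * integral_mode_mul s m n τ₀

/-- The explicit time in the density carries a factor m, while the mode integrates to zero unless m
= 0; hence no τ₀ survives. -/
theorem centralTerm_time (hl : l ≠ 0) (G τ₀ : ℝ) (s : ℤˣ) (m : ℤ) (u α : ℂ) :
    centralTerm l G τ₀ (modeParam s m u α) qGen
      = -(l / (16 * G) * α) * (if m = 0 then 1 else 0) := by
  have hl' : (l : ℂ) ≠ 0 := by exact_mod_cast hl
  have hπ : (Real.pi : ℂ) ≠ 0 := by exact_mod_cast Real.pi_ne_zero
  simp only [centralTerm, centralDensity_time, Matrix.cons_val_zero]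
  rw [intervalIntegral.integral_const_mul, integral_mode]
  rcases eq_or_ne G 0 with rfl | hG
  · simp
  have hG' : (G : ℂ) ≠ 0 := by exact_mod_cast hG
  split_ifs with hm
  · subst hm
    push_cast
    field_simp
    ring
  · simp

theorem surfaceCharge_modeParam (G τ₀ : ℝ) (s : ℤˣ) (m : ℤ) (u α : ℂ) :
    surfaceCharge l G τ₀ (modeParam s m u α) p = u * surfaceCharge l G τ₀ (lGen s m) p
      + α * surfaceCharge l G τ₀ (pGen s m) p := by
  have hL := isSymmetry_modeParam s m 1 0
  have hP := isSymmetry_modeParam s m 0 1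
  rw [← lGen_eq] at hL
  rw [← pGen_eq] at hP
  rw [modeParam_eq, surfaceCharge_add, surfaceCharge_smul _ _ _ hL.smooth_ψ,
    surfaceCharge_smul _ _ _ hP.smooth_ψ]
  · exact fun A => contDiff_const.mul (hL.smooth_Y A)
  · exact contDiff_const.mul hL.smooth_ψ
  · exact fun A => contDiff_const.mul (hP.smooth_Y A)
  · exact contDiff_const.mul hP.smooth_ψ

theorem OnShell.hasIBracket_same (hl : 0 < l) (hp : OnShell p) (G τ₀ : ℝ) (s : ℤˣ) (m n : ℤ)
    (u α u' α' : ℂ) : HasIBracket l G τ₀ p (modeParam s m u α) (modeParam s n u' α')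
      ((m - n) * (u * u') * surfaceCharge l G τ₀ (lGen s (m + n)) p
        + (m * (u' * α) - n * (u * α')) * surfaceCharge l G τ₀ (pGen s (m + n)) p
        + Complex.I * (l / (8 * G) * (Complex.I / 2 * (n - m) * (α * (Complex.I * n * u' - α'))
        + n ^ 2 * (u * α')) * (if m + n = 0 then 1 else 0))) := by
  refine hp.hasIBracket hl G τ₀ (isSymmetry_modeParam _ _ _ _) (isSymmetry_modeParam _ _ _ _) ?_
  rw [bracketParam_same, surfaceCharge_modeParam, centralTerm_same hl.ne']
  linear_combination ((n - m) * (u * u') * surfaceCharge l G τ₀ (lGen s (m + n)) p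
    + (n * (u * α') - m * (u' * α)) * surfaceCharge l G τ₀ (pGen s (m + n)) p) * Complex.I_sq

theorem OnShell.hasIBracket_opposite (hl : 0 < l) (hp : OnShell p) (G τ₀ : ℝ) (s : ℤˣ) (m n : ℤ)
    (u α u' α' : ℂ) : HasIBracket l G τ₀ p (modeParam s m u α) (modeParam (-s) n u' α') 0 := by
  refine hp.hasIBracket hl G τ₀ (isSymmetry_modeParam _ _ _ _) (isSymmetry_modeParam _ _ _ _) ?_
  rw [bracketParam_opposite, surfaceCharge_smul _ _ _ isSymmetry_qGen.smooth_ψ,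
    centralTerm_opposite]
  ring

theorem OnShell.hasIBracket_time (hl : 0 < l) (hp : OnShell p) (G τ₀ : ℝ) (s : ℤˣ) (m : ℤ)
    (u α : ℂ) : HasIBracket l G τ₀ p (modeParam s m u α) qGen
      (Complex.I * (u / 2 * surfaceCharge l G τ₀ (pGen s m) p
        - l / (16 * G) * α * (if m = 0 then 1 else 0))) := by
  refine hp.hasIBracket hl G τ₀ (isSymmetry_modeParam _ _ _ _) isSymmetry_qGen ?_
  rw [bracketParam_time, surfaceCharge_modeParam, centralTerm_time hl.ne']
  ring

end

end

section

open Asymptotics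

/-! ### Integrability of the charges -/

section Parameter

variable {E : Type*} [NormedAddCommGroup E] [NormedSpace ℝ E] {n : ℕ}

theorem hasDerivAt_param {Φ : ℝ × (Fin n → ℝ) → E} {t : ℝ} {y : Fin n → ℝ}
    (h : DifferentiableAt ℝ Φ (t, y)) :
    HasDerivAt (fun t => Φ (t, y)) (fderiv ℝ Φ (t, y) (1, 0)) t :=
  h.hasFDerivAt.comp_hasDerivAt t ((hasDerivAt_id t).prodMk (hasDerivAt_const t y))

theorem pd_param {Φ : ℝ × (Fin n → ℝ) → E} {t : ℝ} {y : Fin n → ℝ}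
    (h : DifferentiableAt ℝ Φ (t, y)) (A : Fin n) :
    pd A (fun y => Φ (t, y)) y = fderiv ℝ Φ (t, y) (0, Pi.single A 1) := by
  have := h.hasFDerivAt.comp y ((hasFDerivAt_const t y).prodMk (hasFDerivAt_id y))
  rw [pd]
  exact congrArg (fun L : (Fin n → ℝ) →L[ℝ] E => L (Pi.single A 1)) this.fderiv

theorem ContDiffAt.fderiv_apply_const {F : Type*} [NormedAddCommGroup F] [NormedSpace ℝ F]
    {Φ : F → E} {z : F} (h : ContDiffAt ℝ ∞ Φ z) (v : F) :
    ContDiffAt ℝ ∞ (fun z => fderiv ℝ Φ z v) z :=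
  (h.fderiv_right (m := ∞) (by simp)).clm_apply contDiffAt_const

theorem contDiff_fderiv_apply {F : Type*} [NormedAddCommGroup F] [NormedSpace ℝ F]
    {Φ : F → E} (h : ContDiff ℝ ∞ Φ) (v : F) : ContDiff ℝ ∞ (fun z => fderiv ℝ Φ z v) :=
  contDiff_iff_contDiffAt.2 fun _ => ContDiffAt.fderiv_apply_const h.contDiffAt v

/-- Symmetry of the second derivative on parameter times boundary space, used to exchange ∂_s with
∂_τ. -/
theorem fderiv_apply_comm {F : Type*} [NormedAddCommGroup F] [NormedSpace ℝ F]
    {Φ : F → E} (h : ContDiff ℝ ∞ Φ) (v w z : F) :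
    fderiv ℝ (fun z => fderiv ℝ Φ z v) z w = fderiv ℝ (fun z => fderiv ℝ Φ z w) z v := by
  have hs : IsSymmSndFDerivAt ℝ Φ z := h.contDiffAt.isSymmSndFDerivAt <| by
    simp only [minSmoothness_of_isRCLikeNormedField]
    exact WithTop.coe_le_coe.2 (le_top : (2 : ℕ∞) ≤ ⊤)
  have hd : DifferentiableAt ℝ (fderiv ℝ Φ) z :=
    (h.fderiv_right (m := ∞) (by simp)).differentiable (by simp) z
  have key : ∀ v w, fderiv ℝ (fun z => fderiv ℝ Φ z v) z w = fderiv ℝ (fderiv ℝ Φ) z w v := by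
    intro v w
    rw [(hd.hasFDerivAt.clm_apply (hasFDerivAt_const v z)).fderiv]
    simp
  rw [key, key, hs.eq]

end Parameter

/-- Differentiation under the integral over the circle. -/
theorem hasDerivAt_integral_circle {F F' : ℝ → ℝ → ℂ} (hF : ∀ t, Continuous (F t))
    (hF' : Continuous (Function.uncurry F')) (h : ∀ t φ, HasDerivAt (fun t => F t φ) (F' t φ) t)
    (s : ℝ) : HasDerivAt (fun t => ∫ φ in (0 : ℝ)..(2 * Real.pi), F t φ)
      (∫ φ in (0 : ℝ)..(2 * Real.pi), F' s φ) s := by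
  have hπ := Real.pi_pos
  -- A bound over a compact box around s serves as a constant dominating function.
  obtain ⟨c, hc⟩ := ((isCompact_Icc (a := s - 1) (b := s + 1)).prod
    (isCompact_Icc (a := (0 : ℝ)) (b := 2 * Real.pi))).exists_bound_of_continuousOn hF'.continuousOn
  have hF's : Continuous (F' s) := hF'.comp (continuous_const.prodMk continuous_id)
  refine (intervalIntegral.hasDerivAt_integral_of_dominated_loc_of_deriv_le
    (bound := fun _ => c) (Icc_mem_nhds (show s - 1 < s by linarith) (show s < s + 1 by linarith))
    (.of_forall fun t => (hF t).aestronglyMeasurable) ((hF s).intervalIntegrable _ _)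
    hF's.aestronglyMeasurable (.of_forall fun φ hφ t ht => ?_) intervalIntegrable_const
    (.of_forall fun φ _ t _ => h t φ)).2
  rw [Set.uIoc_of_le (by positivity)] at hφ
  exact hc (t, φ) ⟨ht, hφ.1.le, hφ.2⟩

section

variable {l : ℝ} (γ : PhasePath l)

/-- The variation of the boundary data along a path. -/
def PhasePath.om (s : ℝ) (y : Bdy) : ℂ := ((deriv (fun t => (γ.pt t).conf y) s : ℝ) : ℂ)

def PhasePath.etaRr (s : ℝ) (y : Bdy) : ℂ := ((deriv (fun t => (γ.pt t).Crr y) s : ℝ) : ℂ)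

def PhasePath.eta (s : ℝ) (y : Bdy) : Matrix (Fin 2) (Fin 2) ℂ :=
  fun A B => ((deriv (fun t => (γ.pt t).C y A B) s : ℝ) : ℂ)

theorem PhasePath.hasDerivAt_conf (t : ℝ) (y : Bdy) :
    HasDerivAt (fun t => ((γ.pt t).conf y : ℂ)) (γ.om t y) t := by
  have h := hasDerivAt_param (γ.smooth_conf.differentiable (by simp) (t, y))
  rw [PhasePath.om, h.deriv]
  exact h.ofReal_comp

theorem PhasePath.hasDerivAt_Crr (t : ℝ) (y : Bdy) :
    HasDerivAt (fun t => ((γ.pt t).Crr y : ℂ)) (γ.etaRr t y) t := by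
  have h := hasDerivAt_param (γ.smooth_Crr.differentiable (by simp) (t, y))
  rw [PhasePath.etaRr, h.deriv]
  exact h.ofReal_comp

theorem PhasePath.hasDerivAt_C (A B : Fin 2) (t : ℝ) (y : Bdy) :
    HasDerivAt (fun t => ((γ.pt t).C y A B : ℂ)) (γ.eta t y A B) t := by
  have h := hasDerivAt_param ((γ.smooth_C A B).differentiable (by simp) (t, y))
  rw [PhasePath.eta, h.deriv]
  exact h.ofReal_comp

theorem PhasePath.om_eq (t : ℝ) (y : Bdy) : γ.om t y =
    ((fderiv ℝ (fun z : ℝ × Bdy => (γ.pt z.1).conf z.2) (t, y) (1, 0) : ℝ) : ℂ) := by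
  rw [PhasePath.om, (hasDerivAt_param (γ.smooth_conf.differentiable (by simp) (t, y))).deriv]

theorem PhasePath.eta_eq (A B : Fin 2) (t : ℝ) (y : Bdy) : γ.eta t y A B =
    ((fderiv ℝ (fun z : ℝ × Bdy => (γ.pt z.1).C z.2 A B) (t, y) (1, 0) : ℝ) : ℂ) := by
  rw [PhasePath.eta, (hasDerivAt_param ((γ.smooth_C A B).differentiable (by simp) (t, y))).deriv]

theorem PhasePath.pd_om_eq (t : ℝ) (y : Bdy) : pd 0 (γ.om t) y =
    ((fderiv ℝ (fun z => fderiv ℝ (fun z : ℝ × Bdy => (γ.pt z.1).conf z.2) z (0, Pi.single 0 1))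
      (t, y) (1, 0) : ℝ) : ℂ) := by
  have hs := contDiff_fderiv_apply γ.smooth_conf ((1, 0) : ℝ × Bdy)
  have hd := hs.differentiable (by simp)
  have e : γ.om t = fun y =>
      ((fderiv ℝ (fun z : ℝ × Bdy => (γ.pt z.1).conf z.2) (t, y) (1, 0) : ℝ) : ℂ) :=
    funext (γ.om_eq t)
  rw [e, pd_ofReal
    (f := fun y => fderiv ℝ (fun z : ℝ × Bdy => (γ.pt z.1).conf z.2) (t, y) (1, 0)) 0
    ((hd (t, y)).comp y ((differentiableAt_const t).prodMk differentiableAt_id))]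
  exact congrArg Complex.ofReal ((pd_param (hd (t, y)) 0).trans
    (fderiv_apply_comm γ.smooth_conf _ _ _))

theorem PhasePath.hasDerivAt_pd_conf (t : ℝ) (y : Bdy) :
    HasDerivAt (fun t => ((pd 0 (γ.pt t).conf y : ℝ) : ℂ)) (pd 0 (γ.om t) y) t := by
  have hs := contDiff_fderiv_apply γ.smooth_conf ((0, Pi.single 0 1) : ℝ × Bdy)
  rw [PhasePath.pd_om_eq]
  have h := (hasDerivAt_param (hs.differentiable (by simp) (t, y))).ofReal_comp
  refine h.congr_of_eventuallyEq (.of_forall fun t => ?_)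
  exact congrArg Complex.ofReal (pd_param (γ.smooth_conf.differentiable (by simp) (t, y)) 0)

/-- Along a path ρ vanishes identically, so its derivative in s is zero. -/
theorem PhasePath.linearizedRho (s : ℝ) :
    LinearizedRho (γ.pt s) (γ.om s) (γ.etaRr s) (γ.eta s) := by
  intro y
  have h1 := γ.hasDerivAt_conf s y
  have h2 := γ.hasDerivAt_Crr s y
  have h3 := fun A B => γ.hasDerivAt_C A B s y
  have h4 : HasDerivAt (fun t => ((∑ A, ∑ B, Complex.exp (-2 * ((γ.pt t).conf y : ℂ)) * (flat A B : ℂ)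
      * ((γ.pt t).C y A B : ℂ)) + ((γ.pt t).Crr y : ℂ) / (l : ℂ) ^ 2)) _ s :=
    (HasDerivAt.fun_sum fun A _ => HasDerivAt.fun_sum fun B _ =>
      (((h1.const_mul (-2)).cexp.mul_const _).mul (h3 A B))).add (h2.div_const _)
  have h5 : (fun t => ((∑ A, ∑ B, Complex.exp (-2 * ((γ.pt t).conf y : ℂ)) * (flat A B : ℂ)
      * ((γ.pt t).C y A B : ℂ)) + ((γ.pt t).Crr y : ℂ) / (l : ℂ) ^ 2)) = fun _ => 0 := by
    funext t
    have := congrArg Complex.ofReal ((γ.pt t).rho_eq_zero y)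
    push_cast at this
    exact this
  rw [h5] at h4
  have h6 := h4.unique (hasDerivAt_const s 0)
  simp only [Fin.sum_univ_two] at h6 ⊢
  push_cast
  linear_combination h6

theorem PhasePath.farSmooth_velocity (s : ℝ) (a b : Fin 3) :
    FarSmooth (fun x => velocity γ.pt s x a b) := by
  refine eventually_far.2 ⟨γ.R, fun x hx => ?_⟩
  have ho : IsOpen {z : ℝ × Pt | γ.R < z.2 1} :=
    isOpen_lt continuous_const ((continuous_apply 1).comp continuous_snd)
  have hc : ∀ x : Pt, γ.R < x 1 → ContDiffAt ℝ ∞ (fun z : ℝ × Pt => (γ.pt z.1).g z.2 a b) (s, x) :=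
    fun x hx => (γ.smooth_g a b).contDiffAt (ho.mem_nhds hx)
  have h1 := (ContDiffAt.fderiv_apply_const (hc x hx) (1, 0)).comp x
    (contDiffAt_const.prodMk contDiffAt_id)
  refine (Complex.ofRealCLM.contDiff.contDiffAt.comp x h1).congr_of_eventuallyEq ?_
  filter_upwards [(isOpen_lt continuous_const (continuous_apply 1)).mem_nhds hx] with x' hx'
  exact congrArg Complex.ofReal (hasDerivAt_param ((hc x' hx').differentiableAt (by simp))).deriv

theorem PhasePath.velocity_symm (s : ℝ) (a b : Fin 3) :
    ∀ᶠ x in far, velocity γ.pt s x a b = velocity γ.pt s x b a := by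
  filter_upwards [eventually_far_gt γ.R] with x hx
  have : (fun t => (γ.pt t).g x a b) = fun t => (γ.pt t).g x b a :=
    funext fun t => ((γ.pt t).symm_g x ((γ.R₀_le t).trans_lt hx)).apply b a
  simp only [velocity, this]

/-- The charge is linear in φ, ∂_τ φ and Ξ with coefficients fixed along the path, so
differentiation under the integral replaces these fields by their variations. -/
theorem PhasePath.hasDerivAt_surfaceCharge (G τ₀ : ℝ) {a : Param} (ha : IsSymmetry a) (s : ℝ) :
    HasDerivAt (fun t => surfaceCharge l G τ₀ a (γ.pt t))
      (chargeVariation l G τ₀ a (γ.om s) (γ.eta s)) s := by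
  refine HasDerivAt.const_mul _ (hasDerivAt_integral_circle
    (F := fun t φ => surfaceDensity (γ.pt t) a ![τ₀, φ])
    (F' := fun t φ => chargeDensity l a (γ.om t) (γ.eta t) ![τ₀, φ]) (fun t => ?_) ?_ ?_ s)
  · exact (continuous_surfaceDensity (γ.pt t) ha.smooth_Y ha.smooth_ψ).comp (continuous_circle τ₀)
  · have hz : Continuous fun z : ℝ × ℝ => (z.1, (![τ₀, z.2] : Bdy)) :=
      continuous_fst.prodMk ((continuous_circle τ₀).comp continuous_snd)
    have hy : Continuous fun z : ℝ × ℝ => (![τ₀, z.2] : Bdy) :=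
      (continuous_circle τ₀).comp continuous_snd
    have c1 : Continuous fun z : ℝ × ℝ => γ.om z.1 ![τ₀, z.2] := by
      simp only [PhasePath.om_eq]
      exact Complex.continuous_ofReal.comp
        ((contDiff_fderiv_apply γ.smooth_conf ((1, 0) : ℝ × Bdy)).continuous.comp hz)
    have c2 : ∀ A B, Continuous fun z : ℝ × ℝ => γ.eta z.1 ![τ₀, z.2] A B := by
      intro A B
      simp only [PhasePath.eta_eq]
      exact Complex.continuous_ofReal.comp
        ((contDiff_fderiv_apply (γ.smooth_C A B) ((1, 0) : ℝ × Bdy)).continuous.comp hz)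
    have c3 : Continuous fun z : ℝ × ℝ => pd 0 (γ.om z.1) ![τ₀, z.2] := by
      simp only [PhasePath.pd_om_eq]
      exact Complex.continuous_ofReal.comp ((contDiff_fderiv_apply (contDiff_fderiv_apply
        γ.smooth_conf ((0, Pi.single 0 1) : ℝ × Bdy)) ((1, 0) : ℝ × Bdy)).continuous.comp hz)
    have c4 := ha.smooth_ψ.continuous.comp hy
    have c5 := (ha.smooth_pd_ψ 0).continuous.comp hy
    have c6 := fun A => (ha.smooth_Y A).continuous.comp hy
    exact (continuous_const.mul ((c4.mul c3).sub (c5.mul c1))).add (continuous_const.mul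
      (((c6 0).mul (continuous_const.mul ((c2 0 0).add (c2 1 1)))).add ((c6 1).mul (c2 0 1))))
  · intro t φ
    have h1 := γ.hasDerivAt_conf t ![τ₀, φ]
    have h2 := γ.hasDerivAt_pd_conf t ![τ₀, φ]
    have h3 := fun A B => γ.hasDerivAt_C A B t ![τ₀, φ]
    have h4 := (((h2.const_mul (a.2 ![τ₀, φ])).sub (h1.const_mul (pd 0 a.2 ![τ₀, φ]))).const_mul
      ((l : ℂ) ^ 2)).add (((((((h3 0 0).add (h3 1 1)).const_mul (1 / 2)).const_mul
        (a.1 ![τ₀, φ] 0)).add ((h3 0 1).const_mul (a.1 ![τ₀, φ] 1)))).const_mul 2)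
    refine h4.congr_of_eventuallyEq (.of_forall fun t => ?_)
    simp only [surfaceDensity, Fin.sum_univ_two, (γ.pt t).Xi_zero]
    push_cast
    rfl

theorem PhasePath.integrable (hl : 0 < l) (G τ₀ : ℝ) {a : Param} (ha : IsSymmetry a) (s : ℝ)
    {ξ : Pt → Fin 3 → ℂ} (hξ : IsGenerator (γ.pt s) a ξ) :
    ∃ v : ℂ, HasDerivAt (fun t => surfaceCharge l G τ₀ a (γ.pt t)) v s ∧
      Tendsto (bbCircle (γ.pt s).g G τ₀ ξ (velocity γ.pt s)) atTop (𝓝 v) :=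
  ⟨_, γ.hasDerivAt_surfaceCharge G τ₀ ha s, tendsto_bbCircle hl G τ₀ (γ.variation s)
    (γ.farSmooth_velocity s) (γ.velocity_symm s) (γ.linearizedRho s) ha hξ⟩

end

end

/-! ### Normalization and assembly of the theorem -/

theorem surfaceCharge_background (l G τ₀ : ℝ) (hl : 0 < l) (a : Param) :
    surfaceCharge l G τ₀ a (background l hl) = 0 := by
  simp [surfaceCharge, background, PhasePoint.Xi, pd_zero]

theorem HasIBracket.of_eq {l G τ₀ : ℝ} {p : PhasePoint l} {a b : Param} {w w' : ℂ}
    (h : HasIBracket l G τ₀ p a b w) (e : w = w') : HasIBracket l G τ₀ p a b w' :=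
  e ▸ h

theorem intCast_eq_neg_of_add_eq_zero {m n : ℤ} (h : m + n = 0) : (n : ℂ) = -m := by
  exact_mod_cast eq_neg_of_add_eq_zero_right h

end AdSCharges

end

open AdSCharges

theorem mainTheorem3 (l G : ℝ) (hl : 0 < l) (hG : 0 < G) (τ₀ : ℝ) :
    -- the basis elements are asymptotic symmetries
    ((∀ (s : ℤˣ) (m : ℤ), IsSymmetry (lGen s m) ∧ IsSymmetry (pGen s m)) ∧ IsSymmetry qGen) ∧
    -- every symmetry is realized by vector fields, which preserve the boundary conditions
    (∀ (p : PhasePoint l) (a : Param), IsSymmetry a →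
      (∃ ξ, IsGenerator p a ξ) ∧
      ∀ ξ, IsGenerator p a ξ → IsTangent p (lieMetric p.g ξ)) ∧
    -- the charges are integrable: the Barnich-Brandt one-form is the differential of the charge
    (∀ a : Param, IsSymmetry a → ∀ (γ : PhasePath l) (s : ℝ) (ξ : Pt → Fin 3 → ℂ),
      IsGenerator (γ.pt s) a ξ →
      ∃ v : ℂ, HasDerivAt (fun t => surfaceCharge l G τ₀ a (γ.pt t)) v s ∧
        Tendsto (bbCircle (γ.pt s).g G τ₀ ξ (velocity γ.pt s)) atTop (𝓝 v)) ∧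
    -- normalization at the background
    (∀ a : Param, surfaceCharge l G τ₀ a (background l hl) = 0) ∧
    -- `L̃^±_m = L^±_m + i m P^±_m`
    (∀ (p : PhasePoint l) (s : ℤˣ) (m : ℤ),
      surfaceCharge l G τ₀ (lTilde s m) p = surfaceCharge l G τ₀ (lGen s m) p
        + Complex.I * m * surfaceCharge l G τ₀ (pGen s m) p) ∧
    -- on shell, the brackets of the charges
    (∀ p : PhasePoint l, OnShell p →
      -- the bracket of any two charges is well defined and antisymmetric
      (∀ a b : Param, IsSymmetry a → IsSymmetry b →
        ∃ w : ℂ, HasIBracket l G τ₀ p a b w ∧ HasIBracket l G τ₀ p b a (-w)) ∧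
      -- the algebra in the original basis
      (∀ (s : ℤˣ) (m n : ℤ),
        HasIBracket l G τ₀ p (lGen s m) (lGen s n)
          (((m : ℂ) - n) * surfaceCharge l G τ₀ (lGen s (m + n)) p) ∧
        HasIBracket l G τ₀ p (lGen s m) (lGen (-s) n) 0 ∧
        HasIBracket l G τ₀ p (lGen s m) (pGen s n)
          (-(n : ℂ) * surfaceCharge l G τ₀ (pGen s (m + n)) p
            + (l : ℂ) / (8 * G) * Complex.I * (m : ℂ) ^ 2 * (if m + n = 0 then 1 else 0)) ∧
        HasIBracket l G τ₀ p (lGen s m) (pGen (-s) n) 0 ∧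
        HasIBracket l G τ₀ p (pGen s m) (pGen s n)
          (-((l : ℂ) / (8 * G)) * (m : ℂ) * (if m + n = 0 then 1 else 0)) ∧
        HasIBracket l G τ₀ p (pGen s m) (pGen (-s) n) 0 ∧
        HasIBracket l G τ₀ p (lGen s m) qGen
          (Complex.I / 2 * surfaceCharge l G τ₀ (pGen s m) p) ∧
        HasIBracket l G τ₀ p (pGen s m) qGen
          (-Complex.I * ((l : ℂ) / (16 * G)) * (if m = 0 then 1 else 0))) ∧
      -- the algebra in the new basis, with central charges `c = 3l/2G` and `k = -l/8G`
      (∀ c k : ℂ, c = 3 * (l : ℂ) / (2 * G) → k = -(l : ℂ) / (8 * G) →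
        ∀ (s : ℤˣ) (m n : ℤ),
        HasIBracket l G τ₀ p (lTilde s m) (lTilde s n)
          (((m : ℂ) - n) * surfaceCharge l G τ₀ (lTilde s (m + n)) p
            + c / 12 * (m : ℂ) ^ 3 * (if m + n = 0 then 1 else 0)) ∧
        HasIBracket l G τ₀ p (lTilde s m) (lTilde (-s) n) 0 ∧
        HasIBracket l G τ₀ p (lTilde s m) (pGen s n)
          (-(n : ℂ) * surfaceCharge l G τ₀ (pGen s (m + n)) p) ∧
        HasIBracket l G τ₀ p (lTilde s m) (pGen (-s) n) 0 ∧
        HasIBracket l G τ₀ p (pGen s m) (pGen s n)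
          (k * (m : ℂ) * (if m + n = 0 then 1 else 0)) ∧
        HasIBracket l G τ₀ p (pGen s m) (pGen (-s) n) 0 ∧
        HasIBracket l G τ₀ p (lTilde s m) qGen
          (Complex.I / 2 * surfaceCharge l G τ₀ (pGen s m) p) ∧
        HasIBracket l G τ₀ p (pGen s m) qGen
          (Complex.I * (k / 2) * (if m = 0 then 1 else 0)))) := by
  refine ⟨⟨fun s m => ?_, isSymmetry_qGen⟩, fun p a ha => ⟨ha.exists_generator p,
    fun ξ hξ => hξ.isTangent_lie hl.ne' ha⟩, fun a ha γ s ξ hξ => γ.integrable hl G τ₀ ha s hξ,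
    surfaceCharge_background l G τ₀ hl, fun p s m => ?_, fun p hp =>
    ⟨fun a b ha hb => hp.exists_bracket hl G τ₀ ha hb, fun s m n => ?_,
      fun c k hc hk s m n => ?_⟩⟩
  · rw [lGen_eq, pGen_eq]
    exact ⟨isSymmetry_modeParam _ _ _ _, isSymmetry_modeParam _ _ _ _⟩
  · rw [lTilde_eq, surfaceCharge_modeParam]
    ring
  · have same := hp.hasIBracket_same hl G τ₀ s m n
    have opp := hp.hasIBracket_opposite hl G τ₀ s m n
    have time := hp.hasIBracket_time hl G τ₀ s m
    have L := lGen_eq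
    have P := pGen_eq
    -- The coefficients (u, α) are (1, 0) for L and (0, 1) for P. When the Kronecker delta is
    -- nonzero, n = -m brings the central terms into the stated form.
    refine ⟨?_, ?_, ?_, ?_, ?_, ?_, ?_, ?_⟩
    · refine HasIBracket.of_eq (by simpa only [← L] using same 1 0 1 0) ?_
      ring
    · simpa only [← L] using opp 1 0 1 0
    · refine HasIBracket.of_eq (by simpa only [← L, ← P] using same 1 0 0 1) ?_
      split_ifs with h
      · rw [intCast_eq_neg_of_add_eq_zero h]
        ring
      · ring
    · simpa only [← L, ← P] using opp 1 0 0 1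
    · refine HasIBracket.of_eq (by simpa only [← P] using same 0 1 0 1) ?_
      split_ifs with h
      · rw [intCast_eq_neg_of_add_eq_zero h]
        linear_combination (l / (8 * G) * m : ℂ) * Complex.I_sq
      · ring
    · simpa only [← P] using opp 0 1 0 1
    · refine HasIBracket.of_eq (by simpa only [← L] using time 1 0) ?_
      ring
    · refine HasIBracket.of_eq (by simpa only [← P] using time 0 1) ?_
      ring
  · have same := hp.hasIBracket_same hl G τ₀ s m n
    have opp := hp.hasIBracket_opposite hl G τ₀ s m n
    have time := hp.hasIBracket_time hl G τ₀ s m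
    have T := lTilde_eq
    have P := pGen_eq
    subst hc hk
    have hG' : (G : ℂ) ≠ 0 := by exact_mod_cast hG.ne'
    refine ⟨?_, ?_, ?_, ?_, ?_, ?_, ?_, ?_⟩
    · rw [T s (m + n), surfaceCharge_modeParam]
      -- Only the term n² u α' = i n³ survives here; with n = -m and the outer factor i it becomes
      -- (l/8G) m³ = (c/12) m³.
      refine HasIBracket.of_eq (by simpa only [← T] using same 1 (Complex.I * m) 1 (Complex.I * n)) ?_
      split_ifs with h
      · rw [Int.cast_add, intCast_eq_neg_of_add_eq_zero h]
        linear_combination (-(l / (8 * G) * m ^ 3) : ℂ) * Complex.I_sq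
      · push_cast
        ring
    · simpa only [← T] using opp 1 (Complex.I * m) 1 (Complex.I * n)
    · refine HasIBracket.of_eq (by simpa only [← T, ← P] using same 1 (Complex.I * m) 0 1) ?_
      split_ifs with h
      · rw [intCast_eq_neg_of_add_eq_zero h]
        linear_combination (l / (8 * G) * m ^ 2 * Complex.I : ℂ) * Complex.I_sq
      · ring
    · simpa only [← T, ← P] using opp 1 (Complex.I * m) 0 1
    · refine HasIBracket.of_eq (by simpa only [← P] using same 0 1 0 1) ?_
      split_ifs with h
      · rw [intCast_eq_neg_of_add_eq_zero h]
        linear_combination (l / (8 * G) * m : ℂ) * Complex.I_sq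
      · ring
    · simpa only [← P] using opp 0 1 0 1
    · refine HasIBracket.of_eq (by simpa only [← T] using time 1 (Complex.I * m)) ?_
      -- The extra central term is proportional to m δ_{m,0} and therefore vanishes.
      split_ifs with h
      · rw [h]
        push_cast
        ring
      · ring
    · refine HasIBracket.of_eq (by simpa only [← P] using time 0 1) ?_
      field_simp
      ring
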